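/- **Setting.** Let $\mathbb T=\mathbb R/2\pi\mathbb Z$, let $J\subset\mathbb R$ be open and let $u$ be a solution on $J$ of the cubic NLS $i\partial_tu+\partial_x^2u=|u|^2u$ on $\mathbb T$ which is continuous in time with values in the functions with absolutely summable Fourier coefficients $u_k(t)$ (the equation being tested against $e^{-ikx}$, $k\in\mathbb Z$). Put $v_k(t)=e^{itk^2}u_k(t)$ and fix $N\ge 0$. **Trees.** Edges are decorated by $(\mathfrak t,p)$, $\mathfrak t\in\{\mathfrak t_1,\mathfrak t_2\}$, $p\in\{0,1\}$, and nodes by frequencies in $\mathbb Z$. $\mathcal I_{(\mathfrak t,p)}(\lambda_kF)$ joins the roots of the forest $F$ into a node decorated by $k$ and grafts the result, by an edge decorated by $(\mathfrak t,p)$, onto a new root. For $p\in\{0,1\}$ the non-planar trees of $\mathcal T_p$ are, recursively, $\mathcal I_{(\mathfrak t_1,p)}(\lambda_k)$ and $\mathcal I_{(\mathfrak t_1,p)}(\lambda_k\,\mathcal I_{(\mathfrak t_2,p)}(\lambda_k T_1T_2T_3))$ with $T_1,T_2\in\mathcal T_p$, $T_3\in\mathcal T_{1-p}$ and $k=f_1+f_2-f_3$,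 where $f_j$ is the frequency of the node adjacent to the root of $T_j$. A hatted tree is one of the form $\mathcal I_{(\mathfrak t_2,p)}(\lambda_kT_1T_2T_3)$ with the same constraints. With $P_{\mathfrak t_1}(l)=-l^2$, $P_{\mathfrak t_2}(l)=l^2$, $P_{(\mathfrak t,p)}(l)=(-1)^pP_{\mathfrak t}((-1)^pl)$, let $\mathscr F(T)$ be the sum over the edges $e$ of $T$ of $P_e$ at the frequency of the upper node of $e$. A letter is a hatted tree whose three branches are single edges. The letter of an inner node reached by a $\mathfrak t_2$ edge is obtained by keeping that edge and the three edges above it, with their frequencies; the node is resonant if $\mathscr F$ of its letter vanishes. Let $\hat{\mathcal T}^{n,k}_0$ be the set of hatted trees with $p=0$, root frequency $k$, exactly $n$ edges of type $\mathfrak t_2$ and no resonant node, and $\hat{\mathcal T}^{n,k}_{\mathrm{res},0}$ the set of those with exactly one resonant node, this node being connected to three leaves. A sum over such a set runs over the non-planar trees with edge decorations and, for each of them, over all admissible frequency decorations of its leaves (each leaf being a separate summation variable). $S(T)$ is the order of the automorphism group of $T$ with its edge decorations (frequencies disregarded); $\Upsilon(T)(v)=2^{n}\prod_{\ell}v_{k_\ell,p_\ell}$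 where $n$ is the number of $\mathfrak t_2$ edges, $\ell$ runs over the leaves and $v_{k,0}=v_k$, $v_{k,1}=\bar v_k$; $\varepsilon(T)=(-1)^{m}$ with $m$ the number of edges decorated by $(\mathfrak t_2,1)$. **Words.** The arborification $\mathfrak a$, with values in the linear span of the words in the letters, is given by $\mathfrak a(T)=(\mathfrak a(T_1)\sqcup\!\sqcup \mathfrak a(T_2)\sqcup\!\sqcup \mathfrak a(T_3))\,a$, with $\sqcup\!\sqcup $ the shuffle product, $T_1,T_2,T_3$ the branches at the lowest inner node reached by a $\mathfrak t_2$ edge and $a$ the letter of this node; $\mathfrak a$ of a tree without $\mathfrak t_2$ edge is the empty word. For words $T_m\cdots T_1$ in non-resonant letters let $$\Psi(T_m\cdots T_1)(t)=\mathbf 1_{\{|\mathscr F(T_1)+\dots+\mathscr F(T_j)|>N,\ 1\le j\le m\}}\ \frac{e^{it\sum_{j=1}^m\mathscr F(T_j)}}{\prod_{j=1}^m(\mathscr F(T_1)+\dots+\mathscr F(T_j))},$$ let $\Psi$ vanish on words with a resonant letter, and let $$\hat\Psi(T_m\cdots T_1)(t)=e^{i\mathscr F(T_m)t}\,\frac{\Psi(T_{m-1}\cdots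 T_1)(t)}{\sum_{j=1}^m\mathscr F(T_j)}.$$ Both are extended linearly. For all words $T_m\cdots T_1$ of $\mathfrak a(T)$ one has $\sum_j\mathscr F(T_j)=\mathscr F(T)$; the product $\mathscr F(T)\hat\Psi(\mathfrak a(T))$ is understood with this factor cancelled, i.e. as the linear extension of $T_m\cdots T_1\mapsto e^{i\mathscr F(T_m)t}\Psi(T_{m-1}\cdots T_1)(t)$, also when $\mathscr F(T)=0$. **Theorem.** For $n\ge1$ and $k\in\mathbb Z$ set $$\mathcal N_0^{(n)}(v)(k)=-\sum_{T\in\hat{\mathcal T}^{n,k}_0}\varepsilon(T)\frac{\Upsilon(T)(v)}{S(T)}\Psi(\mathfrak a(T))(t),\qquad \mathcal N_2^{(n)}(v)(k)=-\sum_{T\in\hat{\mathcal T}^{n,k}_0}\varepsilon(T)\frac{\Upsilon(T)(v)}{S(T)}\,i\mathscr F(T)\Psi(\mathfrak a(T))(t),$$ $$\mathcal N^{(n)}(v)(k)=-\sum_{T\in\hat{\mathcal T}^{n,k}_0}\varepsilon(T)\frac{\Upsilon(T)(v)}{S(T)}\,i\mathscr F(T)\hat\Psi(\mathfrak a(T))(t),\qquad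 \mathcal R^{(n)}(v)(k)=-\sum_{T\in\hat{\mathcal T}^{n,k}_{\mathrm{res},0}}\varepsilon(T)\frac{\Upsilon(T)(v)}{S(T)}\,i\mathscr F(T)\hat\Psi(\mathfrak a(T))(t),$$ and let $\mathcal N_1^{(n)}$ be the restriction of the sum $\mathcal N^{(n)}$ to the trees with $|\mathscr F(T)|\le N$. Then $\partial_tv_k=\mathcal N^{(1)}(v)(k)+\mathcal R^{(1)}(v)(k)$ on $J$, and for all $n\ge1$, $k\in\mathbb Z$, at every time in $J$: all these sums converge absolutely, $\mathcal N_0^{(n)}(v)(k)$ is differentiable in time, and $$\mathcal N^{(n)}(v)(k)=\mathcal N_1^{(n)}(v)(k)+\mathcal N_2^{(n)}(v)(k),$$ $$\mathcal N_2^{(n)}(v)(k)=\partial_t\mathcal N_0^{(n)}(v)(k)+\mathcal N^{(n+1)}(v)(k)+\mathcal R^{(n+1)}(v)(k).$$ Moreover $\mathcal N^{(n+1)}(v)(k)$ and $\mathcal R^{(n+1)}(v)(k)$ are the two parts produced by the normal form procedure: they equal $-\sum_{T\in\hat{\mathcal T}^{n,k}_0}\big(-\tfrac{\varepsilon(T)}{S(T)}\big)\,(D\Upsilon(T)(v)[w])\,\Psi(\mathfrak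 a(T))(t)$ with $w=\mathcal N^{(1)}(v)$ and $w=\mathcal R^{(1)}(v)$ respectively, where $D\Upsilon(T)(v)[w]$ is the derivative of $\Upsilon(T)$ at $v$ in the direction $w$ given by the Leibniz rule; these sums converge absolutely as well. -/

import Mathlib

namespace NormalForm

/-! ## Fourier decorated trees for the cubic NLS

A decorated tree has edges decorated by `(t, p)` with `t ∈ {t1, t2}`, `p ∈ {0, 1}` (`p` is a `Bool`,
`true` standing for `1`, i.e. for complex conjugation) and node decorations in `ℤ`. -/

/-- The two edge types. `t2` edges are those that carry a time integral. -/
inductive EdgeType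
  | t1
  | t2

/-- The symbols `P_{t1}(l) = -l²` and `P_{t2}(l) = l²`. -/
def symbol : EdgeType → ℤ → ℤ
  | .t1, l => -l ^ 2
  | .t2, l => l ^ 2

/-- `(-1)^p`. -/
def sgn (p : Bool) : ℤ := if p then -1 else 1

/-- `P_{(t,p)}(k) = (-1)^p P_t((-1)^p k)`. -/
def edgeSymbol (o : EdgeType) (p : Bool) (k : ℤ) : ℤ := sgn p * symbol o (sgn p * k)

/-- `Tree α p` is the set of planar representatives of the trees of `𝒯_p`, with leaves decorated
by `α`:
* `leaf p a` is `I_{(t1,p)}(λ_a)`,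
* `node p T₁ T₂ T₃` is `I_{(t1,p)}(λ_k I_{(t2,p)}(λ_k T₁ · T₂ · T₃))` with `T₁, T₂ ∈ 𝒯_p` and
  `T₃ ∈ 𝒯_{1-p}`.

For `α = ℤ` the decorations are the frequencies of the leaves. The frequencies of the inner nodes
are determined by those (see `Tree.freq`) and are therefore not stored. For `α = Unit` one gets
trees with edge decorations only. -/
inductive Tree (α : Type) : Bool → Type
  | leaf (p : Bool) (a : α) : Tree α p
  | node (p : Bool) (T₁ T₂ : Tree α p) (T₃ : Tree α (!p)) : Tree α p

/-- The planar representative of `I_{(t2,p)}(λ_k T₁ · T₂ · T₃)`, with `T₁, T₂ ∈ 𝒯_p` and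
`T₃ ∈ 𝒯_{1-p}`: a tree whose root edge has type `t2`. -/
structure HatTree (α : Type) (p : Bool) where
  T₁ : Tree α p
  T₂ : Tree α p
  T₃ : Tree α (!p)

/-- `I_{(t1,p)}(λ_k T)` for `T = I_{(t2,p)}(λ_k ...)`. -/
def HatTree.toTree {α : Type} {p : Bool} (T : HatTree α p) : Tree α p :=
  .node p T.T₁ T.T₂ T.T₃

/-- Frequency of the node adjacent to the root. At an inner node `u` with incoming edge
`e_u`, decorated by `p`, the rule is `(-1)^p 𝔣(u) = ∑_{e = (u,v)} (-1)^{p(e)} 𝔣(v)`; both for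
`p = 0` and for `p = 1` this is `𝔣(u) = 𝔣(v₁) + 𝔣(v₂) - 𝔣(v₃)`. -/
def Tree.freq : {p : Bool} → Tree ℤ p → ℤ
  | _, .leaf _ k => k
  | _, .node _ T₁ T₂ T₃ => T₁.freq + T₂.freq - T₃.freq

/-- Frequency of the node adjacent to the root. -/
def HatTree.freq {p : Bool} (T : HatTree ℤ p) : ℤ := T.toTree.freq

/-- The rule that determines the frequencies of the inner nodes. -/
theorem HatTree.freq_rule {p : Bool} (T : HatTree ℤ p) :
    sgn p * T.freq = sgn p * T.T₁.freq + sgn p * T.T₂.freq + sgn (!p) * T.T₃.freq := by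
  cases p <;> simp [sgn, HatTree.freq, HatTree.toTree, Tree.freq] <;> ring

/-- The oscillation `𝓕(T)`: the sum of `P_{(t(e),p(e))}(𝔣(v))` over all the edges `e = (u,v)`. -/
def Tree.osc : {p : Bool} → Tree ℤ p → ℤ
  | _, .leaf p k => edgeSymbol .t1 p k
  | _, .node p T₁ T₂ T₃ =>
      edgeSymbol .t1 p (T₁.freq + T₂.freq - T₃.freq)
        + (edgeSymbol .t2 p (T₁.freq + T₂.freq - T₃.freq) + (T₁.osc + T₂.osc + T₃.osc))

/-- The oscillation `𝓕(T)` of a tree whose root edge has type `t2`. -/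
def HatTree.osc {p : Bool} (T : HatTree ℤ p) : ℤ :=
  edgeSymbol .t2 p T.freq + (T.T₁.osc + T.T₂.osc + T.T₃.osc)

/-- The order `|T|_ord`: the number of edges of type `t2`. -/
def Tree.order {α : Type} : {p : Bool} → Tree α p → ℕ
  | _, .leaf _ _ => 0
  | _, .node _ T₁ T₂ T₃ => T₁.order + T₂.order + T₃.order + 1

/-- The order `|T|_ord`: the number of edges of type `t2`. -/
def HatTree.order {α : Type} {p : Bool} (T : HatTree α p) : ℕ := T.toTree.order

/-- The number of edges decorated by `(t2, 1)`. -/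
def Tree.conjOrder {α : Type} : {p : Bool} → Tree α p → ℕ
  | _, .leaf _ _ => 0
  | _, .node p T₁ T₂ T₃ =>
      T₁.conjOrder + T₂.conjOrder + T₃.conjOrder + (if p then 1 else 0)

/-- The number of edges decorated by `(t2, 1)`. -/
def HatTree.conjOrder {α : Type} {p : Bool} (T : HatTree α p) : ℕ := T.toTree.conjOrder

/-! ### Non-planar trees and symmetry factors -/

/-- Two planar trees represent the same non-planar tree: one is obtained from the other by
permuting, at inner nodes, the branches `T₁` and `T₂` (these are the only two branches at an inner
node that are attached by edges with the same decoration). -/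
inductive Tree.Iso {α : Type} : {p : Bool} → Tree α p → Tree α p → Prop
  | leaf (p : Bool) (a : α) : Tree.Iso (.leaf p a) (.leaf p a)
  | node (p : Bool) {T₁ T₂ U₁ U₂ : Tree α p} {T₃ U₃ : Tree α (!p)} :
      Tree.Iso T₁ U₁ → Tree.Iso T₂ U₂ → Tree.Iso T₃ U₃ →
      Tree.Iso (.node p T₁ T₂ T₃) (.node p U₁ U₂ U₃)
  | swap (p : Bool) {T₁ T₂ U₁ U₂ : Tree α p} {T₃ U₃ : Tree α (!p)} :
      Tree.Iso T₁ U₂ → Tree.Iso T₂ U₁ → Tree.Iso T₃ U₃ →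
      Tree.Iso (.node p T₁ T₂ T₃) (.node p U₁ U₂ U₃)

theorem Tree.Iso.refl {α : Type} {p : Bool} (T : Tree α p) : Tree.Iso T T := by
  induction T with
  | leaf p a => exact .leaf p a
  | node p T₁ T₂ T₃ h₁ h₂ h₃ => exact .node p h₁ h₂ h₃

theorem Tree.Iso.symm {α : Type} {p : Bool} {T U : Tree α p} (h : Tree.Iso T U) :
    Tree.Iso U T := by
  induction h with
  | leaf p a => exact .leaf p a
  | node p _ _ _ h₁ h₂ h₃ => exact .node p h₁ h₂ h₃
  | swap p _ _ _ h₁ h₂ h₃ => exact .swap p h₂ h₁ h₃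

theorem Tree.Iso.trans {α : Type} {p : Bool} {T U V : Tree α p} (h : Tree.Iso T U)
    (h' : Tree.Iso U V) : Tree.Iso T V := by
  induction h with
  | leaf p a => exact h'
  | node p _ _ _ h₁ h₂ h₃ =>
    cases h' with
    | node _ k₁ k₂ k₃ => exact .node p (h₁ k₁) (h₂ k₂) (h₃ k₃)
    | swap _ k₁ k₂ k₃ => exact .swap p (h₁ k₁) (h₂ k₂) (h₃ k₃)
  | swap p _ _ _ h₁ h₂ h₃ =>
    cases h' with
    | node _ k₁ k₂ k₃ => exact .swap p (h₁ k₂) (h₂ k₁) (h₃ k₃)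
    | swap _ k₁ k₂ k₃ => exact .node p (h₁ k₂) (h₂ k₁) (h₃ k₃)

/-- The setoid whose classes are the non-planar trees. -/
def isoSetoid (α : Type) (p : Bool) : Setoid (Tree α p) where
  r := Tree.Iso
  iseqv := ⟨Tree.Iso.refl, Tree.Iso.symm, Tree.Iso.trans⟩

/-- Forget the frequencies and keep the edge decorations: `T_𝔢^𝔣 ↦ T_𝔢`. -/
def Tree.shape : {p : Bool} → Tree ℤ p → Tree Unit p
  | _, .leaf p _ => .leaf p ()
  | _, .node p T₁ T₂ T₃ => .node p T₁.shape T₂.shape T₃.shape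

open Classical in
/-- The symmetry factor of a tree with edge decorations only: at each inner node, with branches
`∏ T_j^{γ_j}` (the `T_j` pairwise distinct as non-planar trees), it has the factor
`∏ S(T_j)^{γ_j} γ_j!`. -/
noncomputable def Tree.symShape : {p : Bool} → Tree Unit p → ℕ
  | _, .leaf _ _ => 1
  | _, .node _ T₁ T₂ T₃ =>
      T₁.symShape * T₂.symShape * T₃.symShape * (if Tree.Iso T₁ T₂ then 2 else 1)

/-- The symmetry factor `S(T)`. It only sees the edge decorations, not the frequencies. -/
noncomputable def HatTree.sym {p : Bool} (T : HatTree ℤ p) : ℕ := T.toTree.shape.symShape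

/-- The underlying planar tree with edge decorations is the chosen planar representative of its
non-planar tree. Summing over all `T : HatTree ℤ p` with `T.IsRep` is summing over all non-planar
trees `T_𝔢` with edge decorations and, for each of them, over all the frequency decorations `𝔣` of
the leaves of `T_𝔢` (each leaf frequency being a free summation variable, as in
`∑_{k = -k₁ + k₂ + k₃}`). -/
def HatTree.IsRep {p : Bool} (T : HatTree ℤ p) : Prop :=
  Quotient.out (Quotient.mk (isoSetoid Unit p) T.toTree.shape) = T.toTree.shape

/-! ### Letters, words, arborification -/

/-- A letter: a tree `I_{(t2,p)}(λ_k I_{(t1,p)}(λ_{k₁}) I_{(t1,p)}(λ_{k₂}) I_{(t1,1-p)}(λ_{k₃}))`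
with `k = k₁ + k₂ - k₃`. Resonant letters are included; the alphabet `A` is made of the
non-resonant ones. -/
structure Letter where
  p : Bool
  k₁ : ℤ
  k₂ : ℤ
  k₃ : ℤ

/-- The tree of a letter. -/
def Letter.toHatTree (a : Letter) : HatTree ℤ a.p :=
  ⟨.leaf a.p a.k₁, .leaf a.p a.k₂, .leaf (!a.p) a.k₃⟩

/-- `𝓕` of a letter. -/
def Letter.osc (a : Letter) : ℤ := a.toHatTree.osc

/-- The non-resonance condition
`P_{(t2,p)}(𝔣(u)) + ∑_{e = (u,v)} P_{(t(e),p(e))}(𝔣(v)) ≠ 0` at the inner node of the letter. -/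
def Letter.NonRes (a : Letter) : Prop := a.osc ≠ 0

/-- Words are written as `T_m ⋯ T_1`, i.e. the head of the list is `T_m`. -/
abbrev Word := List Letter

/-- The linear span of the words. -/
abbrev WordSpan := Word →₀ ℂ

/-- The shuffle of two words. -/
noncomputable def shuffleWord : Word → Word → WordSpan
  | [], v => Finsupp.single v 1
  | a :: u, [] => Finsupp.single (a :: u) 1
  | a :: u, b :: v =>
      (shuffleWord u (b :: v)).mapDomain (List.cons a)
        + (shuffleWord (a :: u) v).mapDomain (List.cons b)
  termination_by u v => u.length + v.length

/-- The shuffle product, i.e. the bilinear extension of `shuffleWord`. -/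
noncomputable def shuffle (x y : WordSpan) : WordSpan :=
  x.sum fun u c => y.sum fun v d => (c * d) • shuffleWord u v

/-- The letter at an inner node with branches `T₁, T₂, T₃`: cut all the edges of type `t2` above
that node. -/
def nodeLetter (p : Bool) (T₁ T₂ : Tree ℤ p) (T₃ : Tree ℤ (!p)) : Letter :=
  ⟨p, T₁.freq, T₂.freq, T₃.freq⟩

/-- The arborification map: `𝔞` of a leaf is the empty word, and the letter of an inner node is put
to the right of the shuffle of the arborifications of the branches,
`𝔞(B_+^a(τ₁, τ₂, τ₃)) = (𝔞(τ₁) ⧢ 𝔞(τ₂) ⧢ 𝔞(τ₃)) a`. -/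
noncomputable def Tree.arb : {p : Bool} → Tree ℤ p → WordSpan
  | _, .leaf _ _ => Finsupp.single [] 1
  | _, .node p T₁ T₂ T₃ =>
      (shuffle (shuffle T₁.arb T₂.arb) T₃.arb).mapDomain
        (fun w => w ++ [nodeLetter p T₁ T₂ T₃])

/-- The arborification map on trees whose root edge has type `t2`. -/
noncomputable def HatTree.arb {p : Bool} (T : HatTree ℤ p) : WordSpan := T.toTree.arb

/-! ### Resonant and non-resonant trees -/

open Classical in
/-- The number of inner nodes (with incoming edge of type `t2`) at which the non-resonance
condition fails. -/
noncomputable def Tree.numRes : {p : Bool} → Tree ℤ p → ℕ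
  | _, .leaf _ _ => 0
  | _, .node p T₁ T₂ T₃ =>
      T₁.numRes + T₂.numRes + T₃.numRes
        + (if (nodeLetter p T₁ T₂ T₃).NonRes then 0 else 1)

open Classical in
/-- The number of inner nodes connected to three leaves at which the non-resonance condition
fails. -/
noncomputable def Tree.numResTerminal : {p : Bool} → Tree ℤ p → ℕ
  | _, .leaf _ _ => 0
  | _, .node p T₁ T₂ T₃ =>
      T₁.numResTerminal + T₂.numResTerminal + T₃.numResTerminal
        + (if T₁.order = 0 ∧ T₂.order = 0 ∧ T₃.order = 0 ∧ ¬ (nodeLetter p T₁ T₂ T₃).NonRes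
            then 1 else 0)

/-- The set `𝒯̂_p^{n,k}`: the non-resonant trees of order `n` with root frequency `k`. -/
def hatT (p : Bool) (n : ℕ) (k : ℤ) : Set (HatTree ℤ p) :=
  {T | T.IsRep ∧ T.order = n ∧ T.freq = k ∧ T.toTree.numRes = 0}

/-- The set `𝒯̂_{res,p}^{n,k}`: the same, except that the non-resonance condition fails at exactly
one inner node, and that this node is connected to three leaves. -/
def hatTres (p : Bool) (n : ℕ) (k : ℤ) : Set (HatTree ℤ p) :=
  {T | T.IsRep ∧ T.order = n ∧ T.freq = k ∧ T.toTree.numRes = 1 ∧ T.toTree.numResTerminal = 1}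

/-! ### Elementary differentials -/

/-- `v_{k,0} = v_k` and `v_{k,1} = conj v_k`. -/
noncomputable def vcoef (v : ℤ → ℂ) (p : Bool) (k : ℤ) : ℂ :=
  if p then (starRingEnd ℂ) (v k) else v k

/-- The elementary differential `Υ(T)(v)`. At an inner node it has the factor
`∂_v² ∂_{v̄} (v² v̄) = 2` if `p = 0`, and `∂_v ∂_{v̄}² (v̄² v) = 2` if `p = 1`. -/
noncomputable def Tree.ups (v : ℤ → ℂ) : {p : Bool} → Tree ℤ p → ℂ
  | _, .leaf p k => vcoef v p k
  | _, .node _ T₁ T₂ T₃ => 2 * (T₁.ups v * T₂.ups v * T₃.ups v)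

/-- The elementary differential `Υ(T)(v)` of a tree whose root edge has type `t2`. -/
noncomputable def HatTree.ups {p : Bool} (v : ℤ → ℂ) (T : HatTree ℤ p) : ℂ := T.toTree.ups v

/-- The derivative of `Υ(T)` at `v` in the direction `w`, by the Leibniz rule. -/
noncomputable def Tree.dups (v w : ℤ → ℂ) : {p : Bool} → Tree ℤ p → ℂ
  | _, .leaf p k => vcoef w p k
  | _, .node _ T₁ T₂ T₃ =>
      2 * (T₁.dups v w * T₂.ups v * T₃.ups v + T₁.ups v * T₂.dups v w * T₃.ups v
        + T₁.ups v * T₂.ups v * T₃.dups v w)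

/-- The derivative of `Υ(T)` at `v` in the direction `w`. -/
noncomputable def HatTree.dups {p : Bool} (v w : ℤ → ℂ) (T : HatTree ℤ p) : ℂ :=
  T.toTree.dups v w

/-! ### The truncated character `Ψ` and `Ψ̂` -/

/-- `∑_j 𝓕(T_j)` for a word `T_m ⋯ T_1`. -/
def wordOsc (w : Word) : ℤ := (w.map Letter.osc).sum

open Classical in
/-- `Ψ` on the words. For `w = T_m ⋯ T_1` with non-resonant letters, it is
`1_{⋂_j A(T_j⋯T_1)^c} e^{i t ∑_{j ≤ m} 𝓕(T_j)} / ∏_{j ≤ m} (𝓕(T_1) + ⋯ + 𝓕(T_j))`, with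
`A(T_j⋯T_1) = {|𝓕(T_1) + ⋯ + 𝓕(T_j)| ≤ N}`; the words `T_j⋯T_1`, `1 ≤ j ≤ m`, are the
`w.drop i`, `i < m`. Words with a letter outside the alphabet `A` of non-resonant letters are sent
to `0`. -/
noncomputable def psiWord (N t : ℝ) (w : Word) : ℂ :=
  if (∀ a ∈ w, a.NonRes) ∧ (∀ i < w.length, N < |(wordOsc (w.drop i) : ℝ)|) then
    Complex.exp (Complex.I * (wordOsc w : ℂ) * (t : ℂ))
      / ∏ i ∈ Finset.range w.length, (wordOsc (w.drop i) : ℂ)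
  else 0

/-- `Ψ̂` on the words: `Ψ̂(T_m⋯T_1)(t) = e^{i 𝓕(T_m) t} Ψ(T_{m-1}⋯T_1)(t) / ∑_{j ≤ m} 𝓕(T_j)`. -/
noncomputable def psiHatWord (N t : ℝ) : Word → ℂ
  | [] => 0
  | a :: w =>
      Complex.exp (Complex.I * (a.osc : ℂ) * (t : ℂ)) * psiWord N t w / (wordOsc (a :: w) : ℂ)

/-- `(∑_{j ≤ m} 𝓕(T_j)) Ψ̂(T_m⋯T_1)(t)` with the common factor cancelled, i.e.
`e^{i 𝓕(T_m) t} Ψ(T_{m-1}⋯T_1)(t)`. It also makes sense when `∑_{j ≤ m} 𝓕(T_j) = 0`. -/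
noncomputable def oscPsiHatWord (N t : ℝ) : Word → ℂ
  | [] => 0
  | a :: w => Complex.exp (Complex.I * (a.osc : ℂ) * (t : ℂ)) * psiWord N t w

/-- Linear extension of a function on words. -/
noncomputable def wordLinear (f : Word → ℂ) (x : WordSpan) : ℂ := x.sum fun w c => c * f w

/-- `Ψ(𝔞(T))(t)`. -/
noncomputable def HatTree.psi {p : Bool} (N t : ℝ) (T : HatTree ℤ p) : ℂ :=
  wordLinear (psiWord N t) T.arb

/-- `Ψ̂(𝔞(T))(t)`. -/
noncomputable def HatTree.psiHat {p : Bool} (N t : ℝ) (T : HatTree ℤ p) : ℂ :=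
  wordLinear (psiHatWord N t) T.arb

/-- `𝓕(T) Ψ̂(𝔞(T))(t)` with the factor `𝓕(T)`, which is the denominator in `Ψ̂` for every word of
`𝔞(T)`, cancelled. -/
noncomputable def HatTree.oscPsiHat {p : Bool} (N t : ℝ) (T : HatTree ℤ p) : ℂ :=
  wordLinear (oscPsiHatWord N t) T.arb

/-! ### The terms of the normal form -/

/-- The coefficient `-ε(T) / S(T)`, where `ε(T) = (-1)^{number of (t2,1) edges}`. -/
noncomputable def HatTree.coef {p : Bool} (T : HatTree ℤ p) : ℂ :=
  -((-1) ^ T.conjOrder / (T.sym : ℂ))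

/-- Summand of `𝒩_0^{(n)}`. -/
noncomputable def termN0 (N t : ℝ) (v : ℤ → ℂ) (T : HatTree ℤ false) : ℂ :=
  T.coef * T.ups v * T.psi N t

/-- Summand of `𝒩^{(n)}` and of `ℛ^{(n)}`. -/
noncomputable def termN (N t : ℝ) (v : ℤ → ℂ) (T : HatTree ℤ false) : ℂ :=
  T.coef * T.ups v * (Complex.I * T.oscPsiHat N t)

open Classical in
/-- Summand of `𝒩_1^{(n)}`: that of `𝒩^{(n)}` restricted to `|𝓕(T)| ≤ N`. -/
noncomputable def termN1 (N t : ℝ) (v : ℤ → ℂ) (T : HatTree ℤ false) : ℂ :=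
  if |(T.osc : ℝ)| ≤ N then termN N t v T else 0

/-- Summand of `𝒩_2^{(n)}`. -/
noncomputable def termN2 (N t : ℝ) (v : ℤ → ℂ) (T : HatTree ℤ false) : ℂ :=
  T.coef * T.ups v * (Complex.I * (T.osc : ℂ) * T.psi N t)

/-- Summand of the derivative of `𝒩_0^{(n)}` with respect to `v` in the direction `w`. -/
noncomputable def termDN0 (N t : ℝ) (v w : ℤ → ℂ) (T : HatTree ℤ false) : ℂ :=
  T.coef * T.dups v w * T.psi N t

/-- `𝒩_0^{(n)}(v)(k)` at time `t`. -/
noncomputable def calN0 (N : ℝ) (n : ℕ) (t : ℝ) (v : ℤ → ℂ) (k : ℤ) : ℂ :=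
  ∑' T : hatT false n k, termN0 N t v T

/-- `𝒩^{(n)}(v)(k)` at time `t`. -/
noncomputable def calN (N : ℝ) (n : ℕ) (t : ℝ) (v : ℤ → ℂ) (k : ℤ) : ℂ :=
  ∑' T : hatT false n k, termN N t v T

/-- `𝒩_1^{(n)}(v)(k)` at time `t`. -/
noncomputable def calN1 (N : ℝ) (n : ℕ) (t : ℝ) (v : ℤ → ℂ) (k : ℤ) : ℂ :=
  ∑' T : hatT false n k, termN1 N t v T

/-- `𝒩_2^{(n)}(v)(k)` at time `t`. -/
noncomputable def calN2 (N : ℝ) (n : ℕ) (t : ℝ) (v : ℤ → ℂ) (k : ℤ) : ℂ :=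
  ∑' T : hatT false n k, termN2 N t v T

/-- `ℛ^{(n)}(v)(k)` at time `t`. -/
noncomputable def calR (N : ℝ) (n : ℕ) (t : ℝ) (v : ℤ → ℂ) (k : ℤ) : ℂ :=
  ∑' T : hatTres false n k, termN N t v T

/-- The derivative of `𝒩_0^{(n)}(v)(k)` with respect to `v` in the direction `w`, at frozen time
`t` (term by term). -/
noncomputable def calDN0 (N : ℝ) (n : ℕ) (t : ℝ) (v w : ℤ → ℂ) (k : ℤ) : ℂ :=
  ∑' T : hatT false n k, termDN0 N t v w T

/-! ### The equation -/

instance instFactTwoPiPos : Fact (0 < 2 * Real.pi) := ⟨Real.two_pi_pos⟩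

/-- The torus `ℝ / 2πℤ`. -/
abbrev Torus := AddCircle (2 * Real.pi)

/-- `u` is a solution on the open time set `J` of `i ∂_t u + ∂_x² u = |u|² u` on the torus, which
is continuous in time with values in the functions with absolutely summable Fourier coefficients.
The equation holds in the sense of distributions in space, i.e. it is tested against all the
characters `x ↦ e^{-ikx}`. -/
structure IsNLSSolution (J : Set ℝ) (u : ℝ → C(Torus, ℂ)) : Prop where
  summable : ∀ t ∈ J, Summable fun k : ℤ => ‖fourierCoeff (u t) k‖
  continuous : ∀ t ∈ J, Filter.Tendsto
    (fun s => ∑' k : ℤ, ‖fourierCoeff (u s) k - fourierCoeff (u t) k‖) (nhds t) (nhds 0)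
  equation : ∀ t ∈ J, ∀ k : ℤ, HasDerivAt (fun s => fourierCoeff (u s) k)
    (-Complex.I * ((k : ℂ) ^ 2 * fourierCoeff (u t) k
      + fourierCoeff (fun x => ((‖u t x‖ ^ 2 : ℝ) : ℂ) * u t x) k)) t

/-- The Fourier coefficients `v_k(t) = e^{i t k²} u_k(t)` of `v(t) = e^{-i t ∂_x²} u(t)`. -/
noncomputable def twisted (u : ℝ → C(Torus, ℂ)) (t : ℝ) (k : ℤ) : ℂ :=
  Complex.exp (Complex.I * (t : ℂ) * (k : ℂ) ^ 2) * fourierCoeff (u t) k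

end NormalForm

open Filter Topology

namespace NormalForm

/-! ## Words with multiplicity -/

/-! The identities express one differentiation by parts, in which differentiating a leaf matches
removing the first letter of a word.

Each word of `𝔞(T)` uses the letter of every inner node exactly once, so `Ψ(𝔞(T))` oscillates with
the single phase `𝓕(T)`, and differentiating it in time produces `i𝓕(T)Ψ(𝔞(T))`, the summand of
`𝒩_2`. The rest of the derivative falls on the leaves, where `∂_t v` is replaced by the cubic
nonlinearity (`hasDerivAt_twisted`), split into its non-resonant and resonant parts. This amounts to
growing an inner node with three leaves out of a leaf. Conversely, the first letter of a word of
`𝔞(T)` is always the letter of a node with three leaves, and what remains is a word of the tree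
where that node is cut back to a leaf (`Tree.heads_words`). Hence `𝓕(T)Ψ̂(𝔞(T))` is a sum over such
nodes of a phase times `Ψ` of the cut tree, and `tsum_planar_graft` is the resulting change of
variables between (tree of order `n`, leaf, three frequencies) and (tree of order `n + 1`, node with
three leaves). Since `Ψ` kills resonant trees, the two parts give exactly `𝒩^{(n+1)}` and
`ℛ^{(n+1)}`. The splitting `𝒩 = 𝒩_1 + 𝒩_2` holds tree by tree, as the last cutoff in `Ψ` is a test
on `|𝓕(T)|`.

Symmetry factors disappear on passing to planar trees: a non-planar tree of order `n` has `2 ^ n /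
S(T)` planar representatives (`ncard_iso_mul_symShape`), and `2 ^ n` is the constant in `Υ(T)`.
Planar trees thus carry weight one up to sign, and grafting is a bijection without combinatorial
factors (`tsum_hatTree`).

Convergence rests on three bounds: retained denominators are nonzero integers, so `|Ψ| ≤ 1` on
words; `𝔞(T)` has at most `n!` words; the products over leaves, summed over all trees of order `n`,
give a constant times the power `2n + 1` of the `ℓ¹` norm (`hasSum_pr`). Termwise differentiation
uses a time-dependent majorant whose sum is explicit and continuous in time
(`hasDerivAt_tsum_of_dominated`). -/

/-- The multiset of the shuffles of two words. -/
def shuffles {α : Type*} : List α → List α → Multiset (List α)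
  | [], v => {v}
  | a :: u, [] => {a :: u}
  | a :: u, b :: v =>
      (shuffles u (b :: v)).map (List.cons a) + (shuffles (a :: u) v).map (List.cons b)
  termination_by u v => u.length + v.length

/-- The shuffle product of two multisets of words. -/
def shuffleProd {α : Type*} (X Y : Multiset (List α)) : Multiset (List α) :=
  X.bind fun u => Y.bind fun v => shuffles u v

/-- The words of the arborification, with multiplicity and with the letters labelled by `f`. -/
def Tree.words {α : Type*} (f : Letter → α) : {p : Bool} → Tree ℤ p → Multiset (List α)
  | _, .leaf _ _ => {[]}
  | _, .node p T₁ T₂ T₃ =>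
      (shuffleProd (shuffleProd (T₁.words f) (T₂.words f)) (T₃.words f)).map
        (· ++ [f (nodeLetter p T₁ T₂ T₃)])

theorem shuffles_nil_left {α : Type*} (v : List α) : shuffles [] v = {v} := by
  rw [shuffles]

theorem shuffles_nil_right {α : Type*} (u : List α) : shuffles u [] = {u} := by
  cases u <;> rw [shuffles]

theorem shuffles_comm {α : Type*} (u v : List α) : shuffles u v = shuffles v u := by
  induction u generalizing v with
  | nil => rw [shuffles_nil_left, shuffles_nil_right]
  | cons a u ihu =>
    induction v with
    | nil => rw [shuffles_nil_left, shuffles_nil_right]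
    | cons b v ihv => rw [shuffles, shuffles, ihu, ihv, add_comm]

theorem map_shuffles {α β : Type*} (g : α → β) (u v : List α) :
    (shuffles u v).map (List.map g) = shuffles (u.map g) (v.map g) := by
  induction u generalizing v with
  | nil => simp [shuffles_nil_left]
  | cons a u ihu =>
    induction v with
    | nil => simp [shuffles_nil_right]
    | cons b v ihv =>
      simp only [List.map_cons] at ihv
      simp only [List.map_cons]
      rw [shuffles, shuffles, ← List.map_cons, ← ihu, ← ihv]
      simp [Multiset.map_map]

theorem coe_of_mem_shuffles {α : Type*} {u v w : List α} (h : w ∈ shuffles u v) :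
    (w : Multiset α) = u + v := by
  induction u generalizing v w with
  | nil => simp_all [shuffles_nil_left]
  | cons a u ihu =>
    induction v generalizing w with
    | nil => simp_all [shuffles_nil_right]
    | cons b v ihv =>
      rw [shuffles, Multiset.mem_add, Multiset.mem_map, Multiset.mem_map] at h
      rcases h with ⟨x, hx, rfl⟩ | ⟨x, hx, rfl⟩
      · rw [← Multiset.cons_coe, ihu hx, ← Multiset.cons_coe a u, Multiset.cons_add]
      · rw [← Multiset.cons_coe, ihv hx, ← Multiset.cons_coe b v, Multiset.add_cons]

theorem shuffleProd_comm {α : Type*} (X Y : Multiset (List α)) :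
    shuffleProd X Y = shuffleProd Y X := by
  unfold shuffleProd
  rw [Multiset.bind_bind]
  simp_rw [shuffles_comm]

theorem map_shuffleProd {α β : Type*} (g : α → β) (X Y : Multiset (List α)) :
    (shuffleProd X Y).map (List.map g)
      = shuffleProd (X.map (List.map g)) (Y.map (List.map g)) := by
  simp [shuffleProd, Multiset.map_bind, Multiset.bind_map, map_shuffles]

theorem coe_of_mem_shuffleProd {α : Type*} {X Y : Multiset (List α)} {A B : Multiset α}
    (hX : ∀ w ∈ X, (w : Multiset α) = A) (hY : ∀ w ∈ Y, (w : Multiset α) = B) :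
    ∀ w ∈ shuffleProd X Y, (w : Multiset α) = A + B := by
  intro w hw
  simp only [shuffleProd, Multiset.mem_bind] at hw
  obtain ⟨u, hu, v, hv, hw⟩ := hw
  rw [coe_of_mem_shuffles hw, hX u hu, hY v hv]

theorem Tree.map_words {α β : Type*} (f : Letter → α) (g : α → β) {p : Bool} (T : Tree ℤ p) :
    (T.words f).map (List.map g) = T.words (g ∘ f) := by
  induction T with
  | leaf p a => simp [Tree.words]
  | node p T₁ T₂ T₃ h₁ h₂ h₃ =>
    simp only [Tree.words, ← h₁, ← h₂, ← h₃, ← map_shuffleProd, Multiset.map_map]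
    simp

/-- The letters of the inner nodes, with multiplicity. -/
def Tree.letters : {p : Bool} → Tree ℤ p → Multiset Letter
  | _, .leaf _ _ => 0
  | _, .node p T₁ T₂ T₃ =>
      T₁.letters + T₂.letters + T₃.letters + {nodeLetter p T₁ T₂ T₃}

/-- Shuffling only interleaves, so no letter is lost or repeated. Hence all words of a tree share
their length, their total oscillation and the presence of a resonant letter. -/
theorem Tree.coe_of_mem_words {α : Type*} (f : Letter → α) {p : Bool} (T : Tree ℤ p) :
    ∀ w ∈ T.words f, (w : Multiset α) = T.letters.map f := by
  induction T with
  | leaf p a => simp [Tree.words, Tree.letters]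
  | node p T₁ T₂ T₃ h₁ h₂ h₃ =>
    intro w hw
    simp only [Tree.words, Multiset.mem_map] at hw
    obtain ⟨u, hu, rfl⟩ := hw
    have := coe_of_mem_shuffleProd (coe_of_mem_shuffleProd h₁ h₂) h₃ u hu
    rw [← Multiset.coe_add, this]
    simp [Tree.letters]

theorem Tree.card_letters {p : Bool} (T : Tree ℤ p) : T.letters.card = T.order := by
  induction T with
  | leaf p a => simp [Tree.order, Tree.letters]
  | node p T₁ T₂ T₃ h₁ h₂ h₃ => simp [Tree.order, Tree.letters, h₁, h₂, h₃]

/-- Every edge except the root edge belongs to exactly one letter: a `t2` edge to that of its upper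
node, a `t1` edge to that of the inner node it starts from. -/
theorem Tree.osc_eq_sum_letters {p : Bool} (T : Tree ℤ p) :
    T.osc = edgeSymbol .t1 p T.freq + (T.letters.map Letter.osc).sum := by
  induction T with
  | leaf p a => simp [Tree.osc, Tree.letters, Tree.freq]
  | node p T₁ T₂ T₃ h₁ h₂ h₃ =>
    simp only [Tree.osc, Tree.letters, Multiset.map_add, Multiset.sum_add, h₁, h₂, h₃,
      Multiset.map_singleton, Multiset.sum_singleton, Tree.freq]
    simp only [Letter.osc, HatTree.osc, Letter.toHatTree, HatTree.freq, HatTree.toTree, Tree.freq,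
      nodeLetter, Tree.osc]
    ring

theorem HatTree.osc_eq_sum_letters {p : Bool} (T : HatTree ℤ p) :
    T.osc = (T.toTree.letters.map Letter.osc).sum := by
  have h := T.toTree.osc_eq_sum_letters
  have h' : T.toTree.osc = edgeSymbol .t1 p T.toTree.freq + T.osc := rfl
  linarith

/-- The oscillation carried by the inner nodes. -/
def Tree.nodeOsc {p : Bool} (T : Tree ℤ p) : ℤ := (T.letters.map Letter.osc).sum

theorem Tree.numRes_eq_zero_iff {p : Bool} (T : Tree ℤ p) :
    T.numRes = 0 ↔ ∀ a ∈ T.letters, a.NonRes := by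
  induction T with
  | leaf p a => simp [Tree.numRes, Tree.letters]
  | node p T₁ T₂ T₃ h₁ h₂ h₃ =>
    simp only [Tree.numRes, Tree.letters, Multiset.mem_add, Multiset.mem_singleton]
    constructor
    · intro h a ha
      split_ifs at h with hr
      · rcases ha with ((ha | ha) | ha) | rfl
        · exact h₁.1 (by omega) a ha
        · exact h₂.1 (by omega) a ha
        · exact h₃.1 (by omega) a ha
        · exact hr
    · intro h
      rw [h₁.2 fun a ha => h a (by tauto), h₂.2 fun a ha => h a (by tauto),
        h₃.2 fun a ha => h a (by tauto), if_pos (h _ (by tauto))]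

/-! ### The span of the words -/

/-- A multiset of words as an element of the span of the words. -/
noncomputable def toSpan (X : Multiset Word) : WordSpan :=
  (X.map fun w => Finsupp.single w (1 : ℂ)).sum

@[simp] theorem toSpan_zero : toSpan 0 = 0 := by simp [toSpan]

@[simp] theorem toSpan_singleton (w : Word) : toSpan {w} = Finsupp.single w 1 := by simp [toSpan]

@[simp] theorem toSpan_add (X Y : Multiset Word) : toSpan (X + Y) = toSpan X + toSpan Y := by
  simp [toSpan]

theorem mapDomain_toSpan (g : Word → Word) (X : Multiset Word) :
    (toSpan X).mapDomain g = toSpan (X.map g) := by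
  induction X using Multiset.induction_on with
  | empty => simp
  | cons w X ih =>
    rw [← Multiset.singleton_add, toSpan_add, Finsupp.mapDomain_add, ih, Multiset.map_add,
      toSpan_add]
    simp [Finsupp.mapDomain_single]

theorem wordLinear_toSpan (f : Word → ℂ) (X : Multiset Word) :
    wordLinear f (toSpan X) = (X.map f).sum := by
  induction X using Multiset.induction_on with
  | empty => simp [wordLinear]
  | cons w X ih =>
    rw [← Multiset.singleton_add, toSpan_add, Multiset.map_add, Multiset.sum_add, ← ih]
    unfold wordLinear
    rw [Finsupp.sum_add_index' (by simp) (by intros; ring)]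
    simp

theorem shuffleWord_eq (u v : Word) : shuffleWord u v = toSpan (shuffles u v) := by
  induction u generalizing v with
  | nil => rw [shuffleWord, shuffles_nil_left, toSpan_singleton]
  | cons a u ihu =>
    induction v with
    | nil => rw [shuffleWord, shuffles_nil_right, toSpan_singleton]
    | cons b v ihv =>
      rw [shuffleWord, shuffles, ihu, ihv, toSpan_add, mapDomain_toSpan, mapDomain_toSpan]

theorem shuffle_add_left (x x' y : WordSpan) :
    shuffle (x + x') y = shuffle x y + shuffle x' y := by
  unfold shuffle
  rw [Finsupp.sum_add_index']
  · simp
  · intro u c c'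
    rw [← Finsupp.sum_add]
    simp [add_mul, add_smul]

theorem shuffle_add_right (x y y' : WordSpan) :
    shuffle x (y + y') = shuffle x y + shuffle x y' := by
  unfold shuffle
  rw [← Finsupp.sum_add]
  congr 1
  ext1 u; ext1 c
  rw [Finsupp.sum_add_index']
  · simp
  · intro v d d'
    simp [mul_add, add_smul]

theorem shuffle_toSpan (X Y : Multiset Word) :
    shuffle (toSpan X) (toSpan Y) = toSpan (shuffleProd X Y) := by
  induction X using Multiset.induction_on with
  | empty => simp [shuffle, shuffleProd]
  | cons u X ih =>
    rw [← Multiset.singleton_add, toSpan_add, shuffle_add_left, ih, shuffleProd, shuffleProd,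
      Multiset.add_bind, toSpan_add, Multiset.singleton_bind]
    congr 1
    clear ih
    induction Y using Multiset.induction_on with
    | empty => simp [shuffle]
    | cons v Y ih =>
      rw [← Multiset.singleton_add, toSpan_add, shuffle_add_right, ih, Multiset.add_bind,
        toSpan_add, Multiset.singleton_bind, ← shuffleWord_eq]
      simp [shuffle]

/-- The coefficients in `𝔞(T)` are multiplicities, so a multiset of words records it completely and
linear extension becomes a finite sum. -/
theorem Tree.arb_eq {p : Bool} (T : Tree ℤ p) : T.arb = toSpan (T.words id) := by
  induction T with
  | leaf p a => simp [Tree.words, Tree.arb]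
  | node p T₁ T₂ T₃ h₁ h₂ h₃ =>
    simp only [Tree.words, Tree.arb, h₁, h₂, h₃, shuffle_toSpan, mapDomain_toSpan, id]

/-! ### The characters on words of oscillations -/

open Classical in
/-- `Ψ` on words of oscillations. -/
noncomputable def psiOsc (N t : ℝ) : List ℤ → ℂ
  | [] => 1
  | a :: w =>
      if a ≠ 0 ∧ N < |((a + w.sum : ℤ) : ℝ)| then
        Complex.exp (Complex.I * (a : ℂ) * (t : ℂ)) * psiOsc N t w / ((a + w.sum : ℤ) : ℂ)
      else 0

theorem wordOsc_eq (w : Word) : wordOsc w = (w.map Letter.osc).sum := rfl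

theorem psiWord_nil (N t : ℝ) : psiWord N t [] = 1 := by
  simp [psiWord, wordOsc]

-- Prepending a letter creates a single new partial sum, hence one new test, one new denominator and
-- one new phase. This is the recursion that links `Ψ` to `Ψ̂`.
open Classical in
theorem psiWord_cons (N t : ℝ) (a : Letter) (w : Word) :
    psiWord N t (a :: w) = if a.osc ≠ 0 ∧ N < |(wordOsc (a :: w) : ℝ)| then
        Complex.exp (Complex.I * (a.osc : ℂ) * (t : ℂ)) * psiWord N t w / (wordOsc (a :: w) : ℂ)
      else 0 := by
  have hc : ((∀ b ∈ a :: w, b.NonRes) ∧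
        (∀ i < (a :: w).length, N < |(wordOsc ((a :: w).drop i) : ℝ)|)) ↔
      (a.osc ≠ 0 ∧ N < |(wordOsc (a :: w) : ℝ)|) ∧
        ((∀ b ∈ w, b.NonRes) ∧ (∀ i < w.length, N < |(wordOsc (w.drop i) : ℝ)|)) := by
    rw [List.forall_mem_cons, List.length_cons, Nat.forall_lt_succ_left]
    simp only [List.drop_zero, List.drop_succ_cons, Letter.NonRes]
    tauto
  unfold psiWord
  by_cases h₁ : a.osc ≠ 0 ∧ N < |(wordOsc (a :: w) : ℝ)|
  · by_cases h₂ : (∀ b ∈ w, b.NonRes) ∧ (∀ i < w.length, N < |(wordOsc (w.drop i) : ℝ)|)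
    · rw [if_pos (hc.2 ⟨h₁, h₂⟩), if_pos h₁, if_pos h₂, List.length_cons,
        Finset.prod_range_succ']
      simp only [List.drop_zero, List.drop_succ_cons]
      have : (wordOsc (a :: w) : ℂ) = a.osc + wordOsc w := by simp [wordOsc]
      nth_rewrite 1 [this]
      rw [mul_add, add_mul, Complex.exp_add]
      ring
    · rw [if_neg (fun h => h₂ (hc.1 h).2), if_pos h₁, if_neg h₂]
      simp
  · rw [if_neg (fun h => h₁ (hc.1 h).1), if_neg h₁]

/-- `Ψ` sees letters only through their oscillations. Exchanging the first two branches changes the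
letter but not its oscillation, so invariance under `Tree.Iso` can be proved at the level of
integers. -/
theorem psiWord_eq (N t : ℝ) (w : Word) : psiWord N t w = psiOsc N t (w.map Letter.osc) := by
  induction w with
  | nil => simp [psiWord_nil, psiOsc]
  | cons a w ih =>
    rw [psiWord_cons, List.map_cons, psiOsc, ih]
    have : wordOsc (a :: w) = a.osc + (w.map Letter.osc).sum := by simp [wordOsc]
    rw [this]

theorem norm_exp_osc (a : ℤ) (t : ℝ) : ‖Complex.exp (Complex.I * (a : ℂ) * (t : ℂ))‖ = 1 := by
  have : Complex.I * (a : ℂ) * (t : ℂ) = ((a * t : ℝ) : ℂ) * Complex.I := by push_cast; ring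
  rw [this, Complex.norm_exp_ofReal_mul_I]

/-- As `N ≥ 0`, a partial sum that passes the cutoff is a nonzero integer, so dividing by it does
not increase the modulus. -/
theorem norm_psiOsc_le {N : ℝ} (hN : 0 ≤ N) (t : ℝ) (w : List ℤ) : ‖psiOsc N t w‖ ≤ 1 := by
  induction w with
  | nil => simp [psiOsc]
  | cons a w ih =>
    rw [psiOsc]
    split_ifs with h
    · rw [norm_div, norm_mul, norm_exp_osc, one_mul]
      have h1 : (1 : ℝ) ≤ ‖((a + w.sum : ℤ) : ℂ)‖ := by
        rw [Complex.norm_intCast]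
        have : a + w.sum ≠ 0 := by
          intro h0
          rw [h0] at h
          simp at h
          linarith
        exact_mod_cast Int.one_le_abs this
      exact div_le_one_of_le₀ (ih.trans h1) (norm_nonneg _)
    · simp

theorem hasDerivAt_psiOsc (N t : ℝ) (w : List ℤ) :
    HasDerivAt (fun s : ℝ => psiOsc N s w) (Complex.I * (w.sum : ℂ) * psiOsc N t w) t := by
  induction w with
  | nil => simpa [psiOsc] using hasDerivAt_const t (1 : ℂ)
  | cons a w ih =>
    simp only [psiOsc]
    split_ifs with h
    · have he : HasDerivAt (fun s : ℝ => Complex.exp (Complex.I * (a : ℂ) * (s : ℂ)))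
          (Complex.exp (Complex.I * (a : ℂ) * (t : ℂ)) * (Complex.I * (a : ℂ))) t := by
        have := ((hasDerivAt_id (t : ℂ)).const_mul (Complex.I * (a : ℂ))).cexp.comp_ofReal
        simpa using this
      refine ((he.mul ih).div_const _).congr_deriv ?_
      push_cast [List.sum_cons]
      ring
    · simpa using hasDerivAt_const t (0 : ℂ)

theorem psiOsc_eq_zero {N t : ℝ} {w : List ℤ} (h : (0 : ℤ) ∈ w) : psiOsc N t w = 0 := by
  induction w with
  | nil => simp at h
  | cons a w ih =>
    rw [psiOsc]
    rcases List.mem_cons.1 h with rfl | h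
    · simp
    · simp [ih h]

/-- `Ψ(𝔞(T))(t)`. -/
noncomputable def Tree.psi (N t : ℝ) {p : Bool} (T : Tree ℤ p) : ℂ :=
  ((T.words Letter.osc).map (psiOsc N t)).sum

/-- `𝓕(T) Ψ̂(𝔞(T))(t)` with the factor `𝓕(T)` cancelled. -/
noncomputable def Tree.oscPsiHat (N t : ℝ) {p : Bool} (T : Tree ℤ p) : ℂ :=
  ((T.words Letter.osc).map fun w => match w with
    | [] => 0
    | a :: w => Complex.exp (Complex.I * (a : ℂ) * (t : ℂ)) * psiOsc N t w).sum

theorem HatTree.psi_eq (N t : ℝ) {p : Bool} (T : HatTree ℤ p) :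
    T.psi N t = T.toTree.psi N t := by
  rw [HatTree.psi, HatTree.arb, Tree.arb_eq, wordLinear_toSpan, Tree.psi,
    ← Function.comp_id Letter.osc, ← Tree.map_words, Multiset.map_map]
  congr 2
  ext w
  exact psiWord_eq N t w

theorem HatTree.oscPsiHat_eq (N t : ℝ) {p : Bool} (T : HatTree ℤ p) :
    T.oscPsiHat N t = T.toTree.oscPsiHat N t := by
  rw [HatTree.oscPsiHat, HatTree.arb, Tree.arb_eq, wordLinear_toSpan, Tree.oscPsiHat,
    ← Function.comp_id Letter.osc, ← Tree.map_words, Multiset.map_map]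
  congr 2
  ext w
  cases w with
  | nil => rfl
  | cons a w =>
    simp [oscPsiHatWord, psiWord_eq]

theorem Tree.sum_of_mem_words {p : Bool} (T : Tree ℤ p) {w : List ℤ}
    (hw : w ∈ T.words Letter.osc) : w.sum = T.nodeOsc := by
  rw [← Multiset.sum_coe, T.coe_of_mem_words _ w hw, Tree.nodeOsc]

theorem HatTree.oscPsiHat_eq_osc_mul_psiHat (N t : ℝ) {p : Bool} (T : HatTree ℤ p)
    (h : T.osc ≠ 0) : T.oscPsiHat N t = (T.osc : ℂ) * T.psiHat N t := by
  rw [HatTree.oscPsiHat, HatTree.psiHat, HatTree.arb, Tree.arb_eq, wordLinear_toSpan,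
    wordLinear_toSpan, ← Multiset.sum_map_mul_left]
  congr 1
  apply Multiset.map_congr rfl
  intro w hw
  cases w with
  | nil => simp [oscPsiHatWord, psiHatWord]
  | cons a w =>
    have : wordOsc (a :: w) = T.osc := by
      rw [T.osc_eq_sum_letters, wordOsc_eq, ← Multiset.sum_coe, ← Multiset.map_coe,
        T.toTree.coe_of_mem_words _ _ hw, Multiset.map_id]
    have h' : (T.osc : ℂ) ≠ 0 := by exact_mod_cast h
    simp only [oscPsiHatWord, psiHatWord, this]
    field_simp

theorem Tree.hasDerivAt_psi (N t : ℝ) {p : Bool} (T : Tree ℤ p) :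
    HasDerivAt (fun s : ℝ => T.psi N s) (Complex.I * (T.nodeOsc : ℂ) * T.psi N t) t := by
  have key : ∀ X : Multiset (List ℤ), (∀ w ∈ X, w.sum = T.nodeOsc) →
      HasDerivAt (fun s : ℝ => (X.map (psiOsc N s)).sum)
        (Complex.I * (T.nodeOsc : ℂ) * (X.map (psiOsc N t)).sum) t := by
    intro X
    induction X using Multiset.induction_on with
    | empty => intro _; simpa using hasDerivAt_const t (0 : ℂ)
    | cons w X ih =>
      intro h
      simp only [Multiset.map_cons, Multiset.sum_cons, mul_add]
      refine HasDerivAt.add ?_ (ih fun w hw => h w (Multiset.mem_cons_of_mem hw))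
      have := hasDerivAt_psiOsc N t w
      rwa [h w (Multiset.mem_cons_self w X)] at this
  exact key _ fun w hw => T.sum_of_mem_words hw

/-- A resonant letter occurs in every word of the tree. This lets the non-resonance condition be
dropped from the index sets of sums involving `Ψ`. -/
theorem Tree.psi_eq_zero_of_numRes {N t : ℝ} {p : Bool} {T : Tree ℤ p} (h : T.numRes ≠ 0) :
    T.psi N t = 0 := by
  rw [Ne, Tree.numRes_eq_zero_iff] at h
  push Not at h
  obtain ⟨a, ha, hr⟩ := h
  have hr0 : a.osc = 0 := by simpa [Letter.NonRes] using hr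
  apply Multiset.sum_eq_zero
  intro x hx
  obtain ⟨w, hw, rfl⟩ := Multiset.mem_map.1 hx
  apply psiOsc_eq_zero
  rw [← Multiset.mem_coe, T.coe_of_mem_words _ w hw, ← hr0]
  exact Multiset.mem_map_of_mem _ ha

theorem Tree.words_length {p : Bool} (T : Tree ℤ p) {α : Type*} (f : Letter → α) {w : List α}
    (hw : w ∈ T.words f) : w.length = T.order := by
  rw [← Multiset.coe_card, T.coe_of_mem_words f w hw, Multiset.card_map, Tree.card_letters]

/-- The cutoff at the full word tests the total oscillation. Order zero is excluded because the
empty word carries no test. -/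
theorem Tree.psi_eq_zero_of_le {N t : ℝ} {p : Bool} {T : Tree ℤ p} (h : T.order ≠ 0)
    (hN : |(T.nodeOsc : ℝ)| ≤ N) : T.psi N t = 0 := by
  apply Multiset.sum_eq_zero
  intro x hx
  obtain ⟨w, hw, rfl⟩ := Multiset.mem_map.1 hx
  have hs := T.sum_of_mem_words hw
  cases w with
  | nil => exact absurd (T.words_length _ hw).symm h
  | cons a w =>
    rw [psiOsc, if_neg]
    rintro ⟨-, h2⟩
    rw [List.sum_cons] at hs
    rw [hs] at h2
    linarith

/-- `Ψ` imposes on the first letter two tests that `Ψ̂` omits, non-resonance and the cutoff on the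
whole word. Both are satisfied here, so only the last denominator differs. -/
theorem Tree.oscPsiHat_eq_of_lt {N t : ℝ} (hN : 0 ≤ N) {p : Bool} {T : Tree ℤ p}
    (h : T.order ≠ 0) (hr : T.numRes = 0) (hT : N < |(T.nodeOsc : ℝ)|) :
    T.oscPsiHat N t = (T.nodeOsc : ℂ) * T.psi N t := by
  rw [Tree.oscPsiHat, Tree.psi, ← Multiset.sum_map_mul_left]
  congr 1
  apply Multiset.map_congr rfl
  intro w hw
  have hs := T.sum_of_mem_words hw
  cases w with
  | nil => exact absurd (T.words_length _ hw).symm h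
  | cons a w =>
    have ha : a ∈ T.letters.map Letter.osc := by
      rw [← T.coe_of_mem_words _ _ hw]; simp
    obtain ⟨b, hb, rfl⟩ := Multiset.mem_map.1 ha
    have h0 : T.nodeOsc ≠ 0 := by
      intro h0
      rw [h0] at hT
      simp at hT
      linarith
    rw [List.sum_cons] at hs
    rw [psiOsc, hs, if_pos ⟨T.numRes_eq_zero_iff.1 hr b hb, hT⟩]
    have h' : (T.nodeOsc : ℂ) ≠ 0 := by exact_mod_cast h0
    field_simp

/-! ## Trees with a hole -/

/-- A tree of `𝒯_p` one of whose subtrees has been removed. -/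
inductive Ctx : Bool → Type
  | hole (p : Bool) : Ctx p
  | fst (p : Bool) (C : Ctx p) (T₂ : Tree ℤ p) (T₃ : Tree ℤ (!p)) : Ctx p
  | snd (p : Bool) (T₁ : Tree ℤ p) (C : Ctx p) (T₃ : Tree ℤ (!p)) : Ctx p
  | thd (p : Bool) (T₁ T₂ : Tree ℤ p) (C : Ctx (!p)) : Ctx p

/-- Fill the hole. -/
def Ctx.fill (F : ∀ q, Tree ℤ q) : {p : Bool} → Ctx p → Tree ℤ p
  | _, .hole p => F p
  | _, .fst p C T₂ T₃ => .node p (C.fill F) T₂ T₃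
  | _, .snd p T₁ C T₃ => .node p T₁ (C.fill F) T₃
  | _, .thd p T₁ T₂ C => .node p T₁ T₂ (C.fill F)

/-- The conjugation index at the hole. -/
def Ctx.holeType : {p : Bool} → Ctx p → Bool
  | _, .hole p => p
  | _, .fst _ C _ _ => C.holeType
  | _, .snd _ _ C _ => C.holeType
  | _, .thd _ _ _ C => C.holeType

/-- All the ways to write a tree as a filled context, with a filling recognized by `hd`. -/
def Tree.marks {β : Type*} (hd : ∀ q, Tree ℤ q → Option β) :
    {p : Bool} → Tree ℤ p → Multiset (Ctx p × β)
  | _, .leaf p a => (hd p (.leaf p a)).elim 0 fun b => {(.hole p, b)}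
  | _, .node p T₁ T₂ T₃ =>
      ((hd p (.node p T₁ T₂ T₃)).elim 0 fun b => {(.hole p, b)})
        + (T₁.marks hd).map (fun Q => (.fst p Q.1 T₂ T₃, Q.2))
        + (T₂.marks hd).map (fun Q => (.snd p T₁ Q.1 T₃, Q.2))
        + (T₃.marks hd).map (fun Q => (.thd p T₁ T₂ Q.1, Q.2))

section marks

variable {β : Type*} {hd : ∀ q, Tree ℤ q → Option β} {ins : β → ∀ q, Tree ℤ q}

theorem mem_elim_hole {p : Bool} (o : Option β) (Q : Ctx p × β) :
    Q ∈ (o.elim 0 fun b => {((.hole p : Ctx p), b)} : Multiset (Ctx p × β)) ↔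
      Q.1 = .hole p ∧ o = some Q.2 := by
  cases o with
  | none => simp
  | some b =>
    rcases Q with ⟨C, c⟩
    simp [Prod.ext_iff, eq_comm]

/-- The hypothesis makes `hd` the partial inverse of `ins`. Together with `Tree.nodup_marks`, the
marks of a tree enumerate the fibre of the filling map above it, which is what the rearrangements of
series need. -/
theorem Tree.mem_marks (h : ∀ q T b, hd q T = some b ↔ ins b q = T) {p : Bool} (T : Tree ℤ p)
    (Q : Ctx p × β) : Q ∈ T.marks hd ↔ Q.1.fill (ins Q.2) = T := by
  induction T with
  | leaf p a =>
    rcases Q with ⟨C, b⟩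
    rw [Tree.marks, mem_elim_hole, h]
    cases C <;> simp [Ctx.fill]
  | node p T₁ T₂ T₃ h₁ h₂ h₃ =>
    rcases Q with ⟨C, b⟩
    simp only [Tree.marks, Multiset.mem_add, mem_elim_hole, h, Multiset.mem_map, Prod.exists,
      Prod.mk.injEq, h₁, h₂, h₃]
    cases C with
    | hole => simp [Ctx.fill]
    | fst p C U₂ U₃ =>
      simp only [Ctx.fill, Tree.node.injEq, reduceCtorEq, false_and, and_false, exists_false,
        false_or, or_false, Ctx.fst.injEq]
      constructor
      · rintro ⟨C', b', h, ⟨rfl, rfl, rfl⟩, rfl⟩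
        exact ⟨h, rfl, rfl⟩
      · rintro ⟨h, rfl, rfl⟩
        exact ⟨C, b, h, ⟨rfl, rfl, rfl⟩, rfl⟩
    | snd p U₁ C U₃ =>
      simp only [Ctx.fill, Tree.node.injEq, reduceCtorEq, false_and, and_false, exists_false,
        false_or, or_false, Ctx.snd.injEq]
      constructor
      · rintro ⟨C', b', h, ⟨rfl, rfl, rfl⟩, rfl⟩
        exact ⟨rfl, h, rfl⟩
      · rintro ⟨rfl, h, rfl⟩
        exact ⟨C, b, h, ⟨rfl, rfl, rfl⟩, rfl⟩
    | thd p U₁ U₂ C =>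
      simp only [Ctx.fill, Tree.node.injEq, reduceCtorEq, false_and, and_false, exists_false,
        false_or, Ctx.thd.injEq]
      constructor
      · rintro ⟨C', b', h, ⟨rfl, rfl, rfl⟩, rfl⟩
        exact ⟨rfl, rfl, h⟩
      · rintro ⟨rfl, rfl, h⟩
        exact ⟨C, b, h, ⟨rfl, rfl, rfl⟩, rfl⟩

theorem Tree.nodup_marks {p : Bool} (T : Tree ℤ p) : (T.marks hd).Nodup := by
  have hel : ∀ {p : Bool} (o : Option β),
      (o.elim 0 fun b => {((.hole p : Ctx p), b)} : Multiset (Ctx p × β)).Nodup := by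
    intro p o
    cases o <;> simp
  induction T with
  | leaf p a => exact hel _
  | node p T₁ T₂ T₃ h₁ h₂ h₃ =>
    rw [Tree.marks]
    refine Multiset.nodup_add.2 ⟨Multiset.nodup_add.2 ⟨Multiset.nodup_add.2
      ⟨hel _, h₁.map ?_, ?_⟩, h₂.map ?_, ?_⟩, h₃.map ?_, ?_⟩
    · intro Q Q' h
      simp only [Prod.mk.injEq, Ctx.fst.injEq] at h
      exact Prod.ext (by simp_all) h.2
    · rw [Multiset.disjoint_left]
      intro Q hQ hQ'
      rw [mem_elim_hole] at hQ
      simp only [Multiset.mem_map] at hQ'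
      obtain ⟨Q', -, rfl⟩ := hQ'
      simp at hQ
    · intro Q Q' h
      simp only [Prod.mk.injEq, Ctx.snd.injEq] at h
      exact Prod.ext (by simp_all) h.2
    · rw [Multiset.disjoint_left]
      intro Q hQ hQ'
      rw [Multiset.mem_add, mem_elim_hole] at hQ
      simp only [Multiset.mem_map] at hQ hQ'
      obtain ⟨Q', -, rfl⟩ := hQ'
      simp at hQ
    · intro Q Q' h
      simp only [Prod.mk.injEq, Ctx.thd.injEq] at h
      exact Prod.ext (by simp_all) h.2
    · rw [Multiset.disjoint_left]
      intro Q hQ hQ'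
      rw [Multiset.mem_add, Multiset.mem_add, mem_elim_hole] at hQ
      simp only [Multiset.mem_map] at hQ hQ'
      obtain ⟨Q', -, rfl⟩ := hQ'
      simp at hQ

end marks

/-- The decoration of a tree that is a leaf. -/
def Tree.leafVal {p : Bool} : Tree ℤ p → Option ℤ
  | .leaf _ a => some a
  | .node _ _ _ _ => none

theorem Tree.leafVal_eq_some {p : Bool} (T : Tree ℤ p) (a : ℤ) :
    T.leafVal = some a ↔ .leaf p a = T := by
  cases T <;> simp [Tree.leafVal, eq_comm]

/-- The decorations of a tree made of an inner node with three leaves. -/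
def Tree.tripleVal {p : Bool} : Tree ℤ p → Option (ℤ × ℤ × ℤ)
  | .leaf _ _ => none
  | .node _ T₁ T₂ T₃ =>
      T₁.leafVal.bind fun a => T₂.leafVal.bind fun b => T₃.leafVal.map fun c => (a, b, c)

/-- An inner node with three leaves. -/
def tripleTree (b : ℤ × ℤ × ℤ) (p : Bool) : Tree ℤ p :=
  .node p (.leaf p b.1) (.leaf p b.2.1) (.leaf (!p) b.2.2)

theorem Tree.tripleVal_eq_some {p : Bool} (T : Tree ℤ p) (b : ℤ × ℤ × ℤ) :
    T.tripleVal = some b ↔ tripleTree b p = T := by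
  cases T with
  | leaf => simp [Tree.tripleVal, tripleTree]
  | node p T₁ T₂ T₃ =>
    rcases b with ⟨b₁, b₂, b₃⟩
    simp only [Tree.tripleVal, tripleTree, Option.bind_eq_some_iff, Option.map_eq_some_iff,
      Tree.leafVal_eq_some, Tree.node.injEq, Prod.mk.injEq]
    constructor
    · rintro ⟨_, h₁, _, h₂, _, h₃, rfl, rfl, rfl⟩
      exact ⟨h₁, h₂, h₃⟩
    · rintro ⟨h₁, h₂, h₃⟩
      exact ⟨_, h₁, _, h₂, _, h₃, rfl, rfl, rfl⟩

/-- The frequency of the inner node of a `tripleTree`. -/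
def tripleFreq (b : ℤ × ℤ × ℤ) : ℤ := b.1 + b.2.1 - b.2.2

/-- The leaves of a tree. -/
def Tree.leafMarks {p : Bool} (T : Tree ℤ p) : Multiset (Ctx p × ℤ) :=
  T.marks fun _ => Tree.leafVal

/-- The inner nodes of a tree that are connected to three leaves. -/
def Tree.tripleMarks {p : Bool} (T : Tree ℤ p) : Multiset (Ctx p × (ℤ × ℤ × ℤ)) :=
  T.marks fun _ => Tree.tripleVal

/-- Fill a context with an inner node with three leaves. -/
def graft {p : Bool} (Q : Ctx p × (ℤ × ℤ × ℤ)) : Tree ℤ p := Q.1.fill (tripleTree Q.2)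

/-- Fill a context with a leaf. -/
def fillLeaf {p : Bool} (Q : Ctx p × ℤ) : Tree ℤ p := Q.1.fill fun q => .leaf q Q.2

/-- Replace the node with three leaves by a leaf. -/
def cut {p : Bool} (Q : Ctx p × (ℤ × ℤ × ℤ)) : Tree ℤ p := fillLeaf (Q.1, tripleFreq Q.2)

/-- The letter of the node with three leaves. -/
def markLetter {p : Bool} (Q : Ctx p × (ℤ × ℤ × ℤ)) : Letter :=
  ⟨Q.1.holeType, Q.2.1, Q.2.2.1, Q.2.2.2⟩

theorem Tree.mem_leafMarks {p : Bool} (T : Tree ℤ p) (Q : Ctx p × ℤ) :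
    Q ∈ T.leafMarks ↔ fillLeaf Q = T :=
  T.mem_marks (ins := fun b q => .leaf q b) (fun _ T b => T.leafVal_eq_some b) Q

theorem Tree.mem_tripleMarks {p : Bool} (T : Tree ℤ p) (Q : Ctx p × (ℤ × ℤ × ℤ)) :
    Q ∈ T.tripleMarks ↔ graft Q = T :=
  T.mem_marks (fun _ T b => T.tripleVal_eq_some b) Q

theorem Ctx.freq_fill {F G : ∀ q, Tree ℤ q} (h : ∀ q, (F q).freq = (G q).freq) {p : Bool}
    (C : Ctx p) : (C.fill F).freq = (C.fill G).freq := by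
  induction C with
  | hole p => exact h p
  | fst p C T₂ T₃ ih => simp [Ctx.fill, Tree.freq, ih]
  | snd p T₁ C T₃ ih => simp [Ctx.fill, Tree.freq, ih]
  | thd p T₁ T₂ C ih => simp [Ctx.fill, Tree.freq, ih]

/-- The new leaf inherits the frequency of the removed node, so every frequency below it, and with
it every remaining letter, is unchanged. -/
theorem freq_cut {p : Bool} (Q : Ctx p × (ℤ × ℤ × ℤ)) : (cut Q).freq = (graft Q).freq :=
  Ctx.freq_fill (fun q => by simp [Tree.freq, tripleTree, tripleFreq]) Q.1

theorem order_graft {p : Bool} (Q : Ctx p × (ℤ × ℤ × ℤ)) :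
    (graft Q).order = (cut Q).order + 1 := by
  rcases Q with ⟨C, b⟩
  simp only [graft, cut, fillLeaf]
  induction C with
  | hole p => rfl
  | fst p C T₂ T₃ ih => simp only [Ctx.fill, Tree.order, ih]; ring
  | snd p T₁ C T₃ ih => simp only [Ctx.fill, Tree.order, ih]; ring
  | thd p T₁ T₂ C ih => simp only [Ctx.fill, Tree.order, ih]; ring

theorem conjOrder_graft {p : Bool} (Q : Ctx p × (ℤ × ℤ × ℤ)) :
    (graft Q).conjOrder = (cut Q).conjOrder + (tripleTree Q.2 Q.1.holeType).conjOrder := by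
  rcases Q with ⟨C, b⟩
  simp only [graft, cut, fillLeaf]
  induction C with
  | hole p => simp [Ctx.fill, Tree.conjOrder, Ctx.holeType]
  | fst p C T₂ T₃ ih => simp only [Ctx.fill, Tree.conjOrder, ih, Ctx.holeType]; ring
  | snd p T₁ C T₃ ih => simp only [Ctx.fill, Tree.conjOrder, ih, Ctx.holeType]; ring
  | thd p T₁ T₂ C ih => simp only [Ctx.fill, Tree.conjOrder, ih, Ctx.holeType]; ring

theorem nodeLetter_congr {p : Bool} {T₁ U₁ T₂ U₂ : Tree ℤ p} {T₃ U₃ : Tree ℤ (!p)}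
    (h₁ : T₁.freq = U₁.freq) (h₂ : T₂.freq = U₂.freq) (h₃ : T₃.freq = U₃.freq) :
    nodeLetter p T₁ T₂ T₃ = nodeLetter p U₁ U₂ U₃ := by
  simp [nodeLetter, h₁, h₂, h₃]

theorem numRes_graft {p : Bool} (Q : Ctx p × (ℤ × ℤ × ℤ)) :
    (graft Q).numRes = (cut Q).numRes + (tripleTree Q.2 Q.1.holeType).numRes := by
  rcases Q with ⟨C, b⟩
  have hf : ∀ {p} (C : Ctx p), (C.fill (tripleTree b)).freq
      = (C.fill fun q => .leaf q (tripleFreq b)).freq := fun C => (freq_cut (C, b)).symm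
  simp only [graft, cut, fillLeaf]
  induction C with
  | hole p => simp [Ctx.fill, Tree.numRes, Ctx.holeType]
  | fst p C T₂ T₃ ih =>
    simp only [Ctx.fill, Tree.numRes, ih, Ctx.holeType]
    rw [nodeLetter_congr (hf C) rfl rfl]
    ring
  | snd p T₁ C T₃ ih =>
    simp only [Ctx.fill, Tree.numRes, ih, Ctx.holeType]
    rw [nodeLetter_congr rfl (hf C) rfl]
    ring
  | thd p T₁ T₂ C ih =>
    simp only [Ctx.fill, Tree.numRes, ih, Ctx.holeType]
    rw [nodeLetter_congr rfl rfl (hf C)]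
    ring

theorem numRes_tripleTree_of_nonRes {p : Bool} {Q : Ctx p × (ℤ × ℤ × ℤ)}
    (h : (markLetter Q).NonRes) : (tripleTree Q.2 Q.1.holeType).numRes = 0 := by
  simp only [tripleTree, Tree.numRes, zero_add]
  exact if_pos h

theorem numRes_tripleTree_of_not_nonRes {p : Bool} {Q : Ctx p × (ℤ × ℤ × ℤ)}
    (h : ¬ (markLetter Q).NonRes) : (tripleTree Q.2 Q.1.holeType).numRes = 1 := by
  simp only [tripleTree, Tree.numRes, zero_add]
  exact if_neg h

theorem Tree.numResTerminal_le {p : Bool} (T : Tree ℤ p) : T.numResTerminal ≤ T.numRes := by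
  induction T with
  | leaf p a => simp [Tree.numRes, Tree.numResTerminal]
  | node p T₁ T₂ T₃ h₁ h₂ h₃ =>
    rw [Tree.numRes, Tree.numResTerminal]
    split_ifs <;> first | omega | tauto

theorem numResTerminal_graft_pos {p : Bool} (Q : Ctx p × (ℤ × ℤ × ℤ))
    (h : ¬ (markLetter Q).NonRes) : 1 ≤ (graft Q).numResTerminal := by
  rcases Q with ⟨C, b⟩
  simp only [graft, markLetter] at h ⊢
  induction C with
  | hole p =>
    rw [Ctx.fill, tripleTree, Tree.numResTerminal, if_pos ⟨rfl, rfl, rfl, h⟩]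
    omega
  | fst p C T₂ T₃ ih => have := ih h; rw [Ctx.fill, Tree.numResTerminal]; omega
  | snd p T₁ C T₃ ih => have := ih h; rw [Ctx.fill, Tree.numResTerminal]; omega
  | thd p T₁ T₂ C ih => have := ih h; rw [Ctx.fill, Tree.numResTerminal]; omega

theorem Tree.card_tripleMarks_le {p : Bool} (T : Tree ℤ p) :
    T.tripleMarks.card ≤ T.order := by
  unfold Tree.tripleMarks
  induction T with
  | leaf p a => simp [Tree.marks, Tree.tripleVal]
  | node p T₁ T₂ T₃ h₁ h₂ h₃ =>
    simp only [Tree.marks, Multiset.card_add, Multiset.card_map, Tree.order]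
    have : (((Tree.node p T₁ T₂ T₃).tripleVal.elim 0 fun b => {(.hole p, b)} :
        Multiset (Ctx p × (ℤ × ℤ × ℤ)))).card ≤ 1 := by
      cases (Tree.node p T₁ T₂ T₃).tripleVal <;> simp
    omega

/-! ### First letters of words -/

/-- The first letter and the remaining word. -/
def headOf {α : Type*} : List α → Multiset (α × List α)
  | [] => 0
  | a :: w => {(a, w)}

/-- The first letters and the remaining words. -/
def heads {α : Type*} (X : Multiset (List α)) : Multiset (α × List α) := X.bind headOf

/-- Shuffle the remaining words with the words of `Y`. -/
def headShuffle {α : Type*} (h : Multiset (α × List α)) (Y : Multiset (List α)) :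
    Multiset (α × List α) :=
  h.bind fun x => (shuffleProd {x.2} Y).map (Prod.mk x.1)

/-- The first letter of a shuffle comes from one of the two words, the other being left intact:
extracting the first letter is a derivation for the shuffle product. -/
theorem headOf_bind_shuffles {α : Type*} (u v : List α) :
    (shuffles u v).bind headOf = headShuffle (headOf u) {v} + headShuffle (headOf v) {u} := by
  cases u with
  | nil =>
    cases v with
    | nil => simp [shuffles_nil_left, headOf, headShuffle]
    | cons b v => simp [shuffles_nil_left, shuffles_nil_right, headOf, headShuffle, shuffleProd]
  | cons a u =>
    cases v with
    | nil => simp [shuffles_nil_right, headOf, headShuffle, shuffleProd]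
    | cons b v =>
      rw [shuffles, Multiset.add_bind, Multiset.bind_map, Multiset.bind_map]
      simp only [headOf, headShuffle, shuffleProd, Multiset.singleton_bind,
        Multiset.bind_singleton]
      rw [shuffles_comm v (a :: u)]

theorem heads_shuffleProd {α : Type*} (X Y : Multiset (List α)) :
    heads (shuffleProd X Y) = headShuffle (heads X) Y + headShuffle (heads Y) X := by
  have h1 : headShuffle (heads X) Y
      = X.bind fun u => Y.bind fun v => headShuffle (headOf u) {v} := by
    rw [headShuffle, heads, Multiset.bind_assoc]
    refine Multiset.bind_congr fun u _ => ?_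
    simp only [headShuffle, shuffleProd, Multiset.singleton_bind]
    rw [Multiset.bind_bind]
    refine Multiset.bind_congr fun x _ => ?_
    rw [Multiset.map_bind]
  have h2 : headShuffle (heads Y) X
      = X.bind fun u => Y.bind fun v => headShuffle (headOf v) {u} := by
    rw [Multiset.bind_bind, headShuffle, heads, Multiset.bind_assoc]
    refine Multiset.bind_congr fun u _ => ?_
    simp only [headShuffle, shuffleProd, Multiset.singleton_bind]
    rw [Multiset.bind_bind]
    refine Multiset.bind_congr fun x _ => ?_
    rw [Multiset.map_bind]
  rw [h1, h2, heads, shuffleProd, Multiset.bind_assoc, ← Multiset.bind_add]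
  refine Multiset.bind_congr fun u _ => ?_
  rw [Multiset.bind_assoc, ← Multiset.bind_add]
  exact Multiset.bind_congr fun v _ => headOf_bind_shuffles u v

theorem headShuffle_add {α : Type*} (h h' : Multiset (α × List α)) (Y : Multiset (List α)) :
    headShuffle (h + h') Y = headShuffle h Y + headShuffle h' Y :=
  Multiset.add_bind _ _ _

theorem headShuffle_bind {α ι : Type*} (M : Multiset ι) (g : ι → α)
    (A : ι → Multiset (List α)) (Y : Multiset (List α)) :
    headShuffle (M.bind fun i => (A i).map (Prod.mk (g i))) Y
      = M.bind fun i => (shuffleProd (A i) Y).map (Prod.mk (g i)) := by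
  rw [headShuffle, Multiset.bind_assoc]
  refine Multiset.bind_congr fun i _ => ?_
  rw [Multiset.bind_map]
  simp [shuffleProd, Multiset.map_bind]

/-- The empty word must be excluded, since for it the appended letters would supply the head. -/
theorem heads_map_append {α : Type*} (l : List α) {Z : Multiset (List α)} (h : [] ∉ Z) :
    heads (Z.map (· ++ l)) = (heads Z).map fun x => (x.1, x.2 ++ l) := by
  rw [heads, heads, Multiset.bind_map, Multiset.map_bind]
  refine Multiset.bind_congr fun w hw => ?_
  cases w with
  | nil => exact absurd hw h
  | cons a w => simp [headOf]

theorem Tree.eq_leaf_of_order_eq_zero {p : Bool} {T : Tree ℤ p}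
    (h : T.order = 0) : ∃ a, T = .leaf p a := by
  cases T with
  | leaf p a => exact ⟨a, rfl⟩
  | node => simp [Tree.order] at h

/-- The first letter of a word of `𝔞(T)` is the letter of an inner node connected to three leaves;
the remaining words are those of the tree in which this node is replaced by a leaf. -/
theorem Tree.heads_words {α : Type*} (f : Letter → α) {p : Bool} (T : Tree ℤ p) :
    heads (T.words f)
      = T.tripleMarks.bind fun Q => ((cut Q).words f).map (Prod.mk (f (markLetter Q))) := by
  induction T with
  | leaf p a => simp [heads, Tree.words, headOf, Tree.tripleMarks, Tree.marks, Tree.tripleVal]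
  | node p T₁ T₂ T₃ h₁ h₂ h₃ =>
    by_cases h0 : T₁.order = 0 ∧ T₂.order = 0 ∧ T₃.order = 0
    -- With three leaves as branches the only word is the root letter itself, and cutting leaves a
    -- leaf with the empty word.
    · obtain ⟨a₁, rfl⟩ := Tree.eq_leaf_of_order_eq_zero h0.1
      obtain ⟨a₂, rfl⟩ := Tree.eq_leaf_of_order_eq_zero h0.2.1
      obtain ⟨a₃, rfl⟩ := Tree.eq_leaf_of_order_eq_zero h0.2.2
      simp [heads, Tree.words, headOf, Tree.tripleMarks, Tree.marks, Tree.tripleVal, Tree.leafVal,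
        shuffleProd, shuffles_nil_left, cut, fillLeaf, Ctx.fill, markLetter, Ctx.holeType,
        nodeLetter, Tree.freq]
    -- Some branch is not a leaf, so the shuffles are nonempty and the root letter, which stands
    -- last, is never first; nor is the root a marked node.
    · have hZ : [] ∉ shuffleProd (shuffleProd (T₁.words f) (T₂.words f)) (T₃.words f) := by
        intro h
        have h' := coe_of_mem_shuffleProd (coe_of_mem_shuffleProd (T₁.coe_of_mem_words f)
          (T₂.coe_of_mem_words f)) (T₃.coe_of_mem_words f) _ h
        have := congrArg Multiset.card h'
        simp only [Multiset.coe_card, List.length_nil, Multiset.card_add, Multiset.card_map,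
          Tree.card_letters] at this
        omega
      have hv : (Tree.node p T₁ T₂ T₃).tripleVal = none := by
        cases T₁ with
        | node => simp [Tree.tripleVal, Tree.leafVal]
        | leaf =>
          cases T₂ with
          | node => simp [Tree.tripleVal, Tree.leafVal]
          | leaf =>
            cases T₃ with
            | node => simp [Tree.tripleVal, Tree.leafVal]
            | leaf => simp [Tree.order] at h0
      rw [Tree.words, heads_map_append _ hZ, heads_shuffleProd, heads_shuffleProd, h₁, h₂, h₃,
        headShuffle_add, headShuffle_bind, headShuffle_bind, headShuffle_bind, headShuffle_bind,
        headShuffle_bind]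
      simp only [Tree.tripleMarks, Tree.marks, hv, Option.elim_none, zero_add,
        Multiset.add_bind, Multiset.map_add, Multiset.bind_map, Multiset.map_bind,
        Multiset.map_map]
      congr 1
      · congr 1
        · refine Multiset.bind_congr fun Q hQ => ?_
          have hf := freq_cut Q
          rw [(T₁.mem_tripleMarks Q).1 hQ] at hf
          change _ = Multiset.map _ (Tree.words f (.node p (cut Q) T₂ T₃))
          rw [Tree.words, Multiset.map_map, nodeLetter_congr hf rfl rfl]
          rfl
        · refine Multiset.bind_congr fun Q hQ => ?_
          have hf := freq_cut Q
          rw [(T₂.mem_tripleMarks Q).1 hQ] at hf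
          change _ = Multiset.map _ (Tree.words f (.node p T₁ (cut Q) T₃))
          rw [Tree.words, Multiset.map_map, nodeLetter_congr rfl hf rfl,
            shuffleProd_comm (T₁.words f)]
          rfl
      · refine Multiset.bind_congr fun Q hQ => ?_
        have hf := freq_cut Q
        rw [(T₃.mem_tripleMarks Q).1 hQ] at hf
        change _ = Multiset.map _ (Tree.words f (.node p T₁ T₂ (cut Q)))
        rw [Tree.words, Multiset.map_map, nodeLetter_congr rfl rfl hf,
          shuffleProd_comm _ ((cut Q).words f)]
        rfl

theorem card_heads {α : Type*} {X : Multiset (List α)} (h : [] ∉ X) :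
    (heads X).card = X.card := by
  induction X using Multiset.induction_on with
  | empty => simp [heads]
  | cons w X ih =>
    have := ih fun h' => h (Multiset.mem_cons_of_mem h')
    cases w with
    | nil => exact absurd (Multiset.mem_cons_self _ _) h
    | cons a w =>
      rw [heads] at this ⊢
      simp only [Multiset.cons_bind, Multiset.card_add, headOf, Multiset.card_singleton, this,
        Multiset.card_cons]
      ring

/-- The first letter is chosen among at most `n + 1` nodes, and the rest is a word of a cut tree of
order `n`; the factorial follows by induction. -/
theorem Tree.card_words_le (n : ℕ) : ∀ {p : Bool} (T : Tree ℤ p), T.order = n →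
    (T.words Letter.osc).card ≤ n.factorial := by
  induction n with
  | zero =>
    intro p T h
    obtain ⟨a, rfl⟩ := Tree.eq_leaf_of_order_eq_zero h
    simp [Tree.words]
  | succ n ih =>
    intro p T h
    rw [← card_heads, Tree.heads_words, Multiset.card_bind]
    · calc _ ≤ (T.tripleMarks.map fun _ => n.factorial).sum := by
            refine Multiset.sum_map_le_sum_map _ _ fun Q hQ => ?_
            rw [Function.comp_apply, Multiset.card_map]
            refine ih _ ?_
            have := order_graft Q
            rw [(T.mem_tripleMarks Q).1 hQ] at this
            omega
        _ = T.tripleMarks.card * n.factorial := by simp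
        _ ≤ (n + 1) * n.factorial :=
            Nat.mul_le_mul_right _ (h ▸ T.card_tripleMarks_le)
        _ = _ := (Nat.factorial_succ n).symm
    · intro h'
      have := T.words_length _ h'
      simp [h] at this

theorem Tree.oscPsiHat_eq_sum (N t : ℝ) {p : Bool} (T : Tree ℤ p) :
    T.oscPsiHat N t = (T.tripleMarks.map fun Q =>
      Complex.exp (Complex.I * ((markLetter Q).osc : ℂ) * (t : ℂ)) * (cut Q).psi N t).sum := by
  have h : T.oscPsiHat N t = ((heads (T.words Letter.osc)).map fun x =>
      Complex.exp (Complex.I * (x.1 : ℂ) * (t : ℂ)) * psiOsc N t x.2).sum := by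
    rw [Tree.oscPsiHat, heads]
    generalize T.words Letter.osc = X
    induction X using Multiset.induction_on with
    | empty => simp
    | cons w X ih => cases w <;> simp [headOf, ih]
  rw [h, Tree.heads_words, Multiset.map_bind, Multiset.sum_bind]
  congr 1
  refine Multiset.map_congr rfl fun Q _ => ?_
  rw [Multiset.map_map, Tree.psi, ← Multiset.sum_map_mul_left]
  rfl

theorem norm_sum_map_le {α : Type*} {X : Multiset α} {f : α → ℂ} (h : ∀ w ∈ X, ‖f w‖ ≤ 1) :
    ‖(X.map f).sum‖ ≤ X.card := by
  induction X using Multiset.induction_on with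
  | empty => simp
  | cons w X ih =>
    rw [Multiset.map_cons, Multiset.sum_cons, Multiset.card_cons]
    push_cast
    have h1 := h w (Multiset.mem_cons_self w X)
    have h2 := ih fun w hw => h w (Multiset.mem_cons_of_mem hw)
    linarith [norm_add_le (f w) (X.map f).sum]

theorem Tree.norm_psi_le {N : ℝ} (hN : 0 ≤ N) (t : ℝ) {p : Bool} (T : Tree ℤ p) :
    ‖T.psi N t‖ ≤ (T.order.factorial : ℝ) :=
  (norm_sum_map_le fun w _ => norm_psiOsc_le hN t w).trans
    (by exact_mod_cast T.card_words_le _ rfl)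

theorem Tree.norm_oscPsiHat_le {N : ℝ} (hN : 0 ≤ N) (t : ℝ) {p : Bool} (T : Tree ℤ p) :
    ‖T.oscPsiHat N t‖ ≤ (T.order.factorial : ℝ) := by
  refine (norm_sum_map_le fun w _ => ?_).trans (by exact_mod_cast T.card_words_le _ rfl)
  cases w with
  | nil => simp
  | cons a w =>
    simp only [norm_mul, norm_exp_osc, one_mul]
    exact norm_psiOsc_le hN t w

/-- The total oscillation is the last denominator of `Ψ` and cancels it. So `𝒩_2` obeys the same
bounds as `𝒩_0`, although `𝓕(T)` is unbounded. -/
theorem norm_sum_mul_psiOsc_le {N : ℝ} (hN : 0 ≤ N) (t : ℝ) (w : List ℤ) :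
    ‖(w.sum : ℂ) * psiOsc N t w‖ ≤ 1 := by
  cases w with
  | nil => simp
  | cons a w =>
    rw [psiOsc, List.sum_cons]
    split_ifs with h
    · rw [norm_mul, norm_div, norm_mul, norm_exp_osc, one_mul, mul_div_assoc']
      have := norm_psiOsc_le hN t w
      exact div_le_of_le_mul₀ (norm_nonneg _) zero_le_one
        (by nlinarith [norm_nonneg ((a + w.sum : ℤ) : ℂ)])
    · simp

theorem Tree.norm_nodeOsc_mul_psi_le {N : ℝ} (hN : 0 ≤ N) (t : ℝ) {p : Bool} (T : Tree ℤ p) :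
    ‖(T.nodeOsc : ℂ) * T.psi N t‖ ≤ (T.order.factorial : ℝ) := by
  rw [Tree.psi, ← Multiset.sum_map_mul_left]
  refine (norm_sum_map_le fun w hw => ?_).trans (by exact_mod_cast T.card_words_le _ rfl)
  rw [← T.sum_of_mem_words hw]
  exact norm_sum_mul_psiOsc_le hN t w

/-! ## Products over the leaves -/

/-- The product over the leaves. -/
def Tree.pr {R : Type*} [CommSemiring R] (a : Bool → ℤ → R) : {p : Bool} → Tree ℤ p → R
  | _, .leaf p k => a p k
  | _, .node _ T₁ T₂ T₃ => T₁.pr a * T₂.pr a * T₃.pr a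

/-- The derivative of the product over the leaves, by the Leibniz rule. -/
def Tree.dpr {R : Type*} [CommSemiring R] (a b : Bool → ℤ → R) : {p : Bool} → Tree ℤ p → R
  | _, .leaf p k => b p k
  | _, .node _ T₁ T₂ T₃ =>
      T₁.dpr a b * T₂.pr a * T₃.pr a + T₁.pr a * T₂.dpr a b * T₃.pr a
        + T₁.pr a * T₂.pr a * T₃.dpr a b

theorem Tree.ups_eq (v : ℤ → ℂ) {p : Bool} (T : Tree ℤ p) :
    T.ups v = 2 ^ T.order * T.pr (vcoef v) := by
  induction T with
  | leaf p a => simp [Tree.ups, Tree.pr, Tree.order]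
  | node p T₁ T₂ T₃ h₁ h₂ h₃ => simp only [Tree.ups, Tree.pr, Tree.order, h₁, h₂, h₃]; ring

theorem Tree.dups_eq (v w : ℤ → ℂ) {p : Bool} (T : Tree ℤ p) :
    T.dups v w = 2 ^ T.order * T.dpr (vcoef v) (vcoef w) := by
  induction T with
  | leaf p a => simp [Tree.dups, Tree.dpr, Tree.order]
  | node p T₁ T₂ T₃ h₁ h₂ h₃ =>
    simp only [Tree.dups, Tree.dpr, Tree.order, h₁, h₂, h₃, Tree.ups_eq]; ring

theorem Tree.pr_nonneg {a : Bool → ℤ → ℝ} (ha : ∀ q k, 0 ≤ a q k) {p : Bool} (T : Tree ℤ p) :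
    0 ≤ T.pr a := by
  induction T with
  | leaf p k => exact ha p k
  | node p T₁ T₂ T₃ h₁ h₂ h₃ => exact mul_nonneg (mul_nonneg h₁ h₂) h₃

theorem Tree.norm_pr (a : Bool → ℤ → ℂ) {p : Bool} (T : Tree ℤ p) :
    ‖T.pr a‖ = T.pr fun q k => ‖a q k‖ := by
  induction T with
  | leaf p k => rfl
  | node p T₁ T₂ T₃ h₁ h₂ h₃ => simp only [Tree.pr, norm_mul, h₁, h₂, h₃]

theorem Tree.dpr_nonneg {a b : Bool → ℤ → ℝ} (ha : ∀ q k, 0 ≤ a q k) (hb : ∀ q k, 0 ≤ b q k)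
    {p : Bool} (T : Tree ℤ p) : 0 ≤ T.dpr a b := by
  induction T with
  | leaf p k => exact hb p k
  | node p T₁ T₂ T₃ h₁ h₂ h₃ =>
    have := T₁.pr_nonneg ha
    have := T₂.pr_nonneg ha
    have := T₃.pr_nonneg ha
    rw [Tree.dpr]
    positivity

/-- Expanding the product of `a + b` over the leaves yields, among nonnegative terms, the one
without `b` and those with a single `b`. Leibniz sums are thereby dominated by pure products, whose
sum over trees is explicit. -/
theorem Tree.dpr_le_pr_add {a b : Bool → ℤ → ℝ} (ha : ∀ q k, 0 ≤ a q k)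
    (hb : ∀ q k, 0 ≤ b q k) {p : Bool} (T : Tree ℤ p) :
    T.pr a + T.dpr a b ≤ T.pr fun q k => a q k + b q k := by
  induction T with
  | leaf p k => exact le_rfl
  | node p T₁ T₂ T₃ h₁ h₂ h₃ =>
    have a₁ := T₁.pr_nonneg ha
    have a₂ := T₂.pr_nonneg ha
    have a₃ := T₃.pr_nonneg ha
    have d₁ := T₁.dpr_nonneg ha hb
    have d₂ := T₂.dpr_nonneg ha hb
    have d₃ := T₃.dpr_nonneg ha hb
    calc _ ≤ (T₁.pr a + T₁.dpr a b) * (T₂.pr a + T₂.dpr a b) * (T₃.pr a + T₃.dpr a b) := by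
          rw [Tree.dpr, Tree.pr]
          have e : (T₁.pr a + T₁.dpr a b) * (T₂.pr a + T₂.dpr a b) * (T₃.pr a + T₃.dpr a b)
            = T₁.pr a * T₂.pr a * T₃.pr a + (T₁.dpr a b * T₂.pr a * T₃.pr a
              + T₁.pr a * T₂.dpr a b * T₃.pr a + T₁.pr a * T₂.pr a * T₃.dpr a b)
              + (T₁.dpr a b * T₂.dpr a b * T₃.pr a + T₁.dpr a b * T₂.pr a * T₃.dpr a b
                + T₁.pr a * T₂.dpr a b * T₃.dpr a b + T₁.dpr a b * T₂.dpr a b * T₃.dpr a b) := by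
            ring
          rw [e]
          exact le_add_of_nonneg_right (by positivity)
      _ ≤ _ := by
          rw [Tree.pr]
          exact mul_le_mul (mul_le_mul h₁ h₂ (by positivity) (by linarith)) h₃ (by positivity)
            (mul_nonneg (by linarith) (by linarith))

theorem Tree.norm_dpr_le (a b : Bool → ℤ → ℂ) {p : Bool} (T : Tree ℤ p) :
    ‖T.dpr a b‖ ≤ T.dpr (fun q k => ‖a q k‖) fun q k => ‖b q k‖ := by
  induction T with
  | leaf p k => exact le_rfl
  | node p T₁ T₂ T₃ h₁ h₂ h₃ =>
    have a₁ := T₁.pr_nonneg (a := fun q k => ‖a q k‖) fun q k => norm_nonneg _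
    have a₂ := T₂.pr_nonneg (a := fun q k => ‖a q k‖) fun q k => norm_nonneg _
    have a₃ := T₃.pr_nonneg (a := fun q k => ‖a q k‖) fun q k => norm_nonneg _
    simp only [Tree.dpr]
    refine norm_add₃_le.trans ?_
    simp only [norm_mul, Tree.norm_pr]
    gcongr

theorem Tree.dpr_mono {a b b' : Bool → ℤ → ℝ} (ha : ∀ q k, 0 ≤ a q k)
    (hb : ∀ q k, b q k ≤ b' q k) {p : Bool} (T : Tree ℤ p) : T.dpr a b ≤ T.dpr a b' := by
  induction T with
  | leaf p k => exact hb p k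
  | node p T₁ T₂ T₃ h₁ h₂ h₃ =>
    have a₁ := T₁.pr_nonneg ha
    have a₂ := T₂.pr_nonneg ha
    have a₃ := T₃.pr_nonneg ha
    simp only [Tree.dpr]
    gcongr

theorem Tree.dpr_add {a b b' : Bool → ℤ → ℂ} {p : Bool} (T : Tree ℤ p) :
    T.dpr a (fun q k => b q k + b' q k) = T.dpr a b + T.dpr a b' := by
  induction T with
  | leaf p k => rfl
  | node p T₁ T₂ T₃ h₁ h₂ h₃ => simp only [Tree.dpr, h₁, h₂, h₃]; ring

theorem Tree.hasDerivAt_pr {a : ℝ → Bool → ℤ → ℂ} {b : Bool → ℤ → ℂ} {t : ℝ}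
    (h : ∀ q k, HasDerivAt (fun s => a s q k) (b q k) t) {p : Bool} (T : Tree ℤ p) :
    HasDerivAt (fun s => T.pr (a s)) (T.dpr (a t) b) t := by
  induction T with
  | leaf p k => exact h p k
  | node p T₁ T₂ T₃ h₁ h₂ h₃ =>
    refine ((h₁.mul h₂).mul h₃).congr_deriv ?_
    simp only [Tree.dpr, Pi.mul_apply]
    ring

/-! ## Invariance under permutations of the branches -/

theorem nodeLetter_swap_osc {p : Bool} (T₁ T₂ : Tree ℤ p) (T₃ : Tree ℤ (!p)) :
    (nodeLetter p T₂ T₁ T₃).osc = (nodeLetter p T₁ T₂ T₃).osc := by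
  simp only [nodeLetter, Letter.osc, Letter.toHatTree, HatTree.osc, HatTree.freq, HatTree.toTree,
    Tree.freq, Tree.osc, add_comm T₂.freq]
  ring

namespace Tree.Iso

theorem freq_eq {p : Bool} {T U : Tree ℤ p} (h : Tree.Iso T U) : T.freq = U.freq := by
  induction h with
  | leaf => rfl
  | node p _ _ _ h₁ h₂ h₃ => simp only [Tree.freq, h₁, h₂, h₃]
  | swap p _ _ _ h₁ h₂ h₃ => simp only [Tree.freq, h₁, h₂, h₃]; ring

theorem order_eq {α : Type} {p : Bool} {T U : Tree α p} (h : Tree.Iso T U) :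
    T.order = U.order := by
  induction h with
  | leaf => rfl
  | node p _ _ _ h₁ h₂ h₃ => simp only [Tree.order, h₁, h₂, h₃]
  | swap p _ _ _ h₁ h₂ h₃ => simp only [Tree.order, h₁, h₂, h₃]; ring

theorem conjOrder_eq {α : Type} {p : Bool} {T U : Tree α p} (h : Tree.Iso T U) :
    T.conjOrder = U.conjOrder := by
  induction h with
  | leaf => rfl
  | node p _ _ _ h₁ h₂ h₃ => simp only [Tree.conjOrder, h₁, h₂, h₃]
  | swap p _ _ _ h₁ h₂ h₃ => simp only [Tree.conjOrder, h₁, h₂, h₃]; ring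

theorem letter_osc_eq {p : Bool} {T₁ T₂ U₁ U₂ : Tree ℤ p} {T₃ U₃ : Tree ℤ (!p)}
    (h₁ : Tree.Iso T₁ U₂) (h₂ : Tree.Iso T₂ U₁) (h₃ : Tree.Iso T₃ U₃) :
    (nodeLetter p T₁ T₂ T₃).osc = (nodeLetter p U₁ U₂ U₃).osc := by
  rw [← nodeLetter_swap_osc, nodeLetter_congr h₂.freq_eq h₁.freq_eq h₃.freq_eq]

theorem nonRes_iff {p : Bool} {T₁ T₂ U₁ U₂ : Tree ℤ p} {T₃ U₃ : Tree ℤ (!p)}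
    (h₁ : Tree.Iso T₁ U₂) (h₂ : Tree.Iso T₂ U₁) (h₃ : Tree.Iso T₃ U₃) :
    (nodeLetter p T₁ T₂ T₃).NonRes ↔ (nodeLetter p U₁ U₂ U₃).NonRes := by
  rw [Letter.NonRes, Letter.NonRes, letter_osc_eq h₁ h₂ h₃]

theorem nodeOsc_eq {p : Bool} {T U : Tree ℤ p} (h : Tree.Iso T U) : T.nodeOsc = U.nodeOsc := by
  unfold Tree.nodeOsc
  induction h with
  | leaf => rfl
  | node p i₁ i₂ i₃ h₁ h₂ h₃ =>
    simp [Tree.letters, h₁, h₂, h₃, nodeLetter_congr i₁.freq_eq i₂.freq_eq i₃.freq_eq]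
  | swap p i₁ i₂ i₃ h₁ h₂ h₃ =>
    simp [Tree.letters, h₁, h₂, h₃, letter_osc_eq i₁ i₂ i₃]
    ring

theorem numRes_eq {p : Bool} {T U : Tree ℤ p} (h : Tree.Iso T U) : T.numRes = U.numRes := by
  induction h with
  | leaf => rfl
  | node p i₁ i₂ i₃ h₁ h₂ h₃ =>
    simp only [Tree.numRes, h₁, h₂, h₃]
    rw [nodeLetter_congr i₁.freq_eq i₂.freq_eq i₃.freq_eq]
  | swap p i₁ i₂ i₃ h₁ h₂ h₃ =>
    simp only [Tree.numRes, h₁, h₂, h₃]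
    refine congrArg₂ (· + ·) (by ring) ?_
    classical exact if_congr (nonRes_iff i₁ i₂ i₃) rfl rfl

theorem numResTerminal_eq {p : Bool} {T U : Tree ℤ p} (h : Tree.Iso T U) :
    T.numResTerminal = U.numResTerminal := by
  induction h with
  | leaf => rfl
  | node p i₁ i₂ i₃ h₁ h₂ h₃ =>
    simp only [Tree.numResTerminal, h₁, h₂, h₃]
    rw [nodeLetter_congr i₁.freq_eq i₂.freq_eq i₃.freq_eq, i₁.order_eq, i₂.order_eq, i₃.order_eq]
  | swap p i₁ i₂ i₃ h₁ h₂ h₃ =>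
    simp only [Tree.numResTerminal, h₁, h₂, h₃]
    refine congrArg₂ (· + ·) (by ring) ?_
    classical
    refine if_congr ?_ rfl rfl
    rw [i₁.order_eq, i₂.order_eq, i₃.order_eq, nonRes_iff i₁ i₂ i₃, and_left_comm]

theorem pr_eq {R : Type*} [CommSemiring R] (a : Bool → ℤ → R) {p : Bool} {T U : Tree ℤ p}
    (h : Tree.Iso T U) : T.pr a = U.pr a := by
  induction h with
  | leaf => rfl
  | node p _ _ _ h₁ h₂ h₃ => simp only [Tree.pr, h₁, h₂, h₃]
  | swap p _ _ _ h₁ h₂ h₃ => simp only [Tree.pr, h₁, h₂, h₃]; ring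

theorem dpr_eq {R : Type*} [CommSemiring R] (a b : Bool → ℤ → R) {p : Bool} {T U : Tree ℤ p}
    (h : Tree.Iso T U) : T.dpr a b = U.dpr a b := by
  induction h with
  | leaf => rfl
  | node p i₁ i₂ i₃ h₁ h₂ h₃ =>
    simp only [Tree.dpr, h₁, h₂, h₃, i₁.pr_eq a, i₂.pr_eq a, i₃.pr_eq a]
  | swap p i₁ i₂ i₃ h₁ h₂ h₃ =>
    simp only [Tree.dpr, h₁, h₂, h₃, i₁.pr_eq a, i₂.pr_eq a, i₃.pr_eq a]; ring

/-- The shuffle product is commutative and the oscillation of a letter is symmetric in its first two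
frequencies. The labels must be oscillations: words in the letters themselves are not invariant. -/
theorem words_eq {p : Bool} {T U : Tree ℤ p} (h : Tree.Iso T U) :
    T.words Letter.osc = U.words Letter.osc := by
  induction h with
  | leaf => rfl
  | node p i₁ i₂ i₃ h₁ h₂ h₃ =>
    simp only [Tree.words, h₁, h₂, h₃, nodeLetter_congr i₁.freq_eq i₂.freq_eq i₃.freq_eq]
  | @swap p T₁ T₂ U₁ U₂ T₃ U₃ i₁ i₂ i₃ h₁ h₂ h₃ =>
    simp only [Tree.words, h₁, h₂, h₃, letter_osc_eq i₁ i₂ i₃,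
      shuffleProd_comm (U₂.words Letter.osc)]

theorem psi_eq {N t : ℝ} {p : Bool} {T U : Tree ℤ p} (h : Tree.Iso T U) :
    T.psi N t = U.psi N t := by
  rw [Tree.psi, Tree.psi, h.words_eq]

theorem oscPsiHat_eq {N t : ℝ} {p : Bool} {T U : Tree ℤ p} (h : Tree.Iso T U) :
    T.oscPsiHat N t = U.oscPsiHat N t := by
  rw [Tree.oscPsiHat, Tree.oscPsiHat, h.words_eq]

end Tree.Iso

/-! ## Sums over non-planar trees and sums over planar trees -/

/-- The frequency decorations of a planar tree. -/
abbrev Fib {p : Bool} (s : Tree Unit p) : Type := {T : Tree ℤ p // T.shape = s}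

/-- The frequency decorations of a single edge. -/
def fibLeaf (p : Bool) (a : Unit) : ℤ ≃ Fib (.leaf p a) where
  toFun k := ⟨.leaf p k, rfl⟩
  invFun T := match T with
    | ⟨.leaf _ k, _⟩ => k
    | ⟨.node _ _ _ _, h⟩ => by simp [Tree.shape] at h
  left_inv k := rfl
  right_inv T := by
    rcases T with ⟨T, h⟩
    cases T with
    | leaf => rfl
    | node => simp [Tree.shape] at h

/-- The frequency decorations of a tree are those of its branches. -/
def fibNode {p : Bool} (s₁ s₂ : Tree Unit p) (s₃ : Tree Unit (!p)) :
    (Fib s₁ × Fib s₂) × Fib s₃ ≃ Fib (.node p s₁ s₂ s₃) where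
  toFun x := ⟨.node p x.1.1.1 x.1.2.1 x.2.1, by
    simp only [Tree.shape, x.1.1.2, x.1.2.2, x.2.2]⟩
  invFun T := match T with
    | ⟨.leaf _ _, h⟩ => by simp [Tree.shape] at h
    | ⟨.node _ T₁ T₂ T₃, h⟩ => by
        simp only [Tree.shape, Tree.node.injEq] at h
        exact ((⟨T₁, h.1⟩, ⟨T₂, h.2.1⟩), ⟨T₃, h.2.2⟩)
  left_inv x := rfl
  right_inv T := by
    rcases T with ⟨T, h⟩
    cases T with
    | leaf => simp [Tree.shape] at h
    | node => rfl

/-- An isomorphism of shapes transports frequency decorations. Consequently the sum of an invariant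
function over all decorations depends only on the non-planar shape. -/
theorem Tree.Iso.exists_equiv {p : Bool} {s s' : Tree Unit p} (h : Tree.Iso s s') :
    ∃ e : Fib s ≃ Fib s', ∀ T, Tree.Iso T.1 (e T).1 := by
  induction h with
  | leaf p a => exact ⟨Equiv.refl _, fun T => Tree.Iso.refl _⟩
  | @node p s₁ s₂ r₁ r₂ s₃ r₃ _ _ _ h₁ h₂ h₃ =>
    obtain ⟨e₁, h₁⟩ := h₁
    obtain ⟨e₂, h₂⟩ := h₂
    obtain ⟨e₃, h₃⟩ := h₃
    refine ⟨(fibNode s₁ s₂ s₃).symm.trans (((e₁.prodCongr e₂).prodCongr e₃).trans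
      (fibNode r₁ r₂ r₃)), fun T => ?_⟩
    obtain ⟨x, rfl⟩ := (fibNode s₁ s₂ s₃).surjective T
    rw [Equiv.trans_apply, Equiv.symm_apply_apply]
    exact Tree.Iso.node p (h₁ x.1.1) (h₂ x.1.2) (h₃ x.2)
  | @swap p s₁ s₂ r₁ r₂ s₃ r₃ _ _ _ h₁ h₂ h₃ =>
    obtain ⟨e₁, h₁⟩ := h₁
    obtain ⟨e₂, h₂⟩ := h₂
    obtain ⟨e₃, h₃⟩ := h₃
    refine ⟨(fibNode s₁ s₂ s₃).symm.trans ((((e₁.prodCongr e₂).trans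
      (Equiv.prodComm _ _)).prodCongr e₃).trans (fibNode r₁ r₂ r₃)), fun T => ?_⟩
    obtain ⟨x, rfl⟩ := (fibNode s₁ s₂ s₃).surjective T
    rw [Equiv.trans_apply, Equiv.symm_apply_apply]
    exact Tree.Iso.swap p (h₁ x.1.1) (h₂ x.1.2) (h₃ x.2)

theorem Tree.order_shape {p : Bool} (T : Tree ℤ p) : T.shape.order = T.order := by
  induction T with
  | leaf => rfl
  | node p T₁ T₂ T₃ h₁ h₂ h₃ => simp only [Tree.shape, Tree.order, h₁, h₂, h₃]

theorem finite_order_le (n : ℕ) : ∀ p, {s : Tree Unit p | s.order ≤ n}.Finite := by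
  induction n with
  | zero =>
    intro p
    refine (Set.finite_singleton (Tree.leaf p ())).subset ?_
    intro s hs
    cases s with
    | leaf => rfl
    | node => simp [Tree.order] at hs
  | succ n ih =>
    intro p
    refine ((Set.finite_singleton (Tree.leaf p ())).union
      ((((ih p).prod (ih p)).prod (ih (!p))).image
        fun x => Tree.node p x.1.1 x.1.2 x.2)).subset ?_
    intro s hs
    cases s with
    | leaf => exact Or.inl rfl
    | node p s₁ s₂ s₃ =>
      simp only [Set.mem_ofPred_eq, Tree.order] at hs
      refine Or.inr ⟨((s₁, s₂), s₃), ⟨⟨?_, ?_⟩, ?_⟩, rfl⟩ <;>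
        simp only [Set.mem_ofPred_eq] <;> omega

/-- The planar trees with edge decorations of order `n`. -/
noncomputable def shapes (p : Bool) (n : ℕ) : Finset (Tree Unit p) :=
  Set.Finite.toFinset (s := {s : Tree Unit p | s.order = n})
    ((finite_order_le n p).subset fun _ h => le_of_eq h)

theorem mem_shapes {p : Bool} {n : ℕ} {s : Tree Unit p} : s ∈ shapes p n ↔ s.order = n := by
  simp [shapes]

theorem finite_iso {p : Bool} (s : Tree Unit p) : {s' | Tree.Iso s s'}.Finite :=
  (finite_order_le s.order p).subset fun _ h => (Tree.Iso.order_eq h).ge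

theorem setOf_iso_node {p : Bool} (s₁ s₂ : Tree Unit p) (s₃ : Tree Unit (!p)) :
    {s' | Tree.Iso (.node p s₁ s₂ s₃) s'}
      = ((fun x : (Tree Unit p × Tree Unit p) × Tree Unit (!p) => Tree.node p x.1.1 x.1.2 x.2) ''
          (({s' | Tree.Iso s₁ s'} ×ˢ {s' | Tree.Iso s₂ s'}) ×ˢ {s' | Tree.Iso s₃ s'}))
        ∪ ((fun x : (Tree Unit p × Tree Unit p) × Tree Unit (!p) => Tree.node p x.1.1 x.1.2 x.2) ''
          (({s' | Tree.Iso s₂ s'} ×ˢ {s' | Tree.Iso s₁ s'}) ×ˢ {s' | Tree.Iso s₃ s'})) := by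
  ext s'
  constructor
  · intro h
    cases h with
    | node _ h₁ h₂ h₃ => exact Or.inl ⟨((_, _), _), ⟨⟨h₁, h₂⟩, h₃⟩, rfl⟩
    | swap _ h₁ h₂ h₃ => exact Or.inr ⟨((_, _), _), ⟨⟨h₂, h₁⟩, h₃⟩, rfl⟩
  · rintro (⟨x, ⟨⟨h₁, h₂⟩, h₃⟩, rfl⟩ | ⟨x, ⟨⟨h₁, h₂⟩, h₃⟩, rfl⟩)
    · exact .node p h₁ h₂ h₃
    · exact .swap p h₂ h₁ h₃

/-- The orbit-stabilizer relation: the number of planar representatives of a non-planar tree times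
its symmetry factor is `2 ^ n`. -/
theorem ncard_iso_mul_symShape {p : Bool} (s : Tree Unit p) :
    {s' | Tree.Iso s s'}.ncard * s.symShape = 2 ^ s.order := by
  induction s with
  | leaf p a =>
    have : {s' | Tree.Iso (.leaf p a) s'} = {Tree.leaf p a} := by
      ext s'
      constructor
      · intro h
        cases h
        rfl
      · rintro rfl
        exact .leaf p a
    simp [this, Tree.symShape, Tree.order]
  | node p s₁ s₂ s₃ h₁ h₂ h₃ =>
    have hinj : Function.Injective
        (fun x : (Tree Unit p × Tree Unit p) × Tree Unit (!p) => Tree.node p x.1.1 x.1.2 x.2) := by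
      rintro ⟨⟨a, b⟩, c⟩ ⟨⟨a', b'⟩, c'⟩ h
      simp_all
    rw [setOf_iso_node, Tree.symShape, Tree.order, pow_succ, pow_add, pow_add, ← h₁, ← h₂, ← h₃]
    by_cases h : Tree.Iso s₁ s₂
    -- Isomorphic branches: exchanging them yields no new representative, and the factor `2` in
    -- `symShape` compensates. Otherwise the two families below are disjoint and the count doubles.
    · have : {s' | Tree.Iso s₂ s'} = {s' | Tree.Iso s₁ s'} := by
        ext s'
        exact ⟨fun h' => h.trans h', fun h' => h.symm.trans h'⟩
      rw [this, Set.union_self, Set.ncard_image_of_injective _ hinj, Set.ncard_prod,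
        Set.ncard_prod, if_pos h]
      ring
    · rw [Set.ncard_union_eq ?_ ((((finite_iso s₁).prod (finite_iso s₂)).prod
          (finite_iso s₃)).image _) ((((finite_iso s₂).prod (finite_iso s₁)).prod
          (finite_iso s₃)).image _), Set.ncard_image_of_injective _ hinj,
        Set.ncard_image_of_injective _ hinj, if_neg h]
      · simp only [Set.ncard_prod]
        ring
      · rw [Set.disjoint_left]
        rintro _ ⟨x, ⟨⟨h₁, -⟩, -⟩, rfl⟩ ⟨y, ⟨⟨h₂, -⟩, -⟩, hxy⟩
        rw [hinj hxy] at h₂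
        exact h (h₁.trans h₂.symm)

/-- A planar tree with edge decorations is the chosen representative of its class. -/
def IsRepShape {p : Bool} (s : Tree Unit p) : Prop :=
  Quotient.out (Quotient.mk (isoSetoid Unit p) s) = s

-- The fibre of the representative map above a chosen shape is its whole class, of cardinality `2 ^
-- n / S`; an invariant `Φ` divided by `S` is therefore spread evenly over the class with weight `2
-- ^ (-n)`.
open Classical in
theorem sum_isRepShape {p : Bool} (n : ℕ) (Φ : Tree Unit p → ℂ)
    (hΦ : ∀ s s', Tree.Iso s s' → Φ s = Φ s') :
    (∑ s ∈ shapes p n, if IsRepShape s then Φ s / (s.symShape : ℂ) else 0)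
      = ∑ s ∈ shapes p n, Φ s / 2 ^ n := by
  set r : Tree Unit p → Tree Unit p := fun s => Quotient.out (Quotient.mk (isoSetoid Unit p) s)
    with hr
  have hiso : ∀ s, Tree.Iso (r s) s := fun s => Quotient.mk_out (s := isoSetoid Unit p) s
  have hrep : ∀ s, IsRepShape (r s) := by
    intro s
    simp only [IsRepShape, hr, Quotient.out_eq]
  rw [← Finset.sum_fiberwise_of_maps_to (g := r) (t := shapes p n) (f := fun s => Φ s / 2 ^ n)]
  · refine Finset.sum_congr rfl fun j hj => ?_
    split_ifs with h
    · have hc : {s' | Tree.Iso j s'} = ((shapes p n).filter fun s => r s = j : Finset _) := by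
        ext s
        simp only [Set.mem_ofPred_eq, Finset.coe_filter, mem_shapes]
        constructor
        · intro hs
          refine ⟨by rw [← hs.order_eq]; exact mem_shapes.1 hj, ?_⟩
          have : Quotient.mk (isoSetoid Unit p) s = Quotient.mk (isoSetoid Unit p) j :=
            Quotient.sound hs.symm
          simp only [hr, this]
          exact h
        · rintro ⟨-, rfl⟩
          exact hiso s
      have hcard := ncard_iso_mul_symShape j
      rw [hc, Set.ncard_coe_finset, mem_shapes.1 hj] at hcard
      rw [Finset.sum_congr rfl (g := fun _ => Φ j / 2 ^ n)]
      · have hS : (j.symShape : ℂ) ≠ 0 := by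
          intro h0
          have : j.symShape = 0 := by exact_mod_cast h0
          rw [this, mul_zero] at hcard
          exact absurd hcard.symm (by positivity)
        rw [Finset.sum_const, nsmul_eq_mul]
        have : (2 : ℂ) ^ n = ((shapes p n).filter fun s => r s = j).card * j.symShape := by
          exact_mod_cast hcard.symm
        have h2 : ((((shapes p n).filter fun s => r s = j).card : ℕ) : ℂ) ≠ 0 := by
          intro h0
          rw [h0, zero_mul] at this
          exact pow_ne_zero n two_ne_zero this
        rw [this]
        field_simp
      · intro s hs
        rw [← (Finset.mem_filter.1 hs).2, hΦ _ _ (hiso s)]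
    · symm
      apply Finset.sum_eq_zero
      intro s hs
      rw [← (Finset.mem_filter.1 hs).2] at h
      exact absurd (hrep s) h
  · intro s hs
    rw [mem_shapes, (hiso s).order_eq]
    exact mem_shapes.1 hs

theorem tsum_eq_sum_shapes {p : Bool} {n : ℕ} {F : Tree ℤ p → ℂ} (hF : Summable F)
    (hn : ∀ T, T.order ≠ n → F T = 0) :
    ∑' T, F T = ∑ s ∈ shapes p n, ∑' T : Fib s, F T.1 := by
  rw [← (Equiv.sigmaFiberEquiv (Tree.shape (p := p))).tsum_eq]
  refine (Summable.tsum_sigma ((Equiv.summable_iff (Equiv.sigmaFiberEquiv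
    (Tree.shape (p := p)))).2 hF)).trans ?_
  refine (tsum_eq_sum fun s hs => ?_)
  refine (tsum_congr fun T => ?_).trans tsum_zero
  apply hn
  intro h
  apply hs
  rw [mem_shapes, ← T.2]
  exact T.1.order_shape.trans h

open Classical in
/-- A sum over non-planar trees with the symmetry factors is a sum over planar trees. -/
theorem tsum_isRepShape {p : Bool} {n : ℕ} {F : Tree ℤ p → ℂ} (hF : Summable F)
    (hn : ∀ T, T.order ≠ n → F T = 0) (hI : ∀ T U, Tree.Iso T U → F T = F U) :
    ∑' T, (if IsRepShape T.shape then F T / (T.shape.symShape : ℂ) else 0)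
      = ∑' T, F T / 2 ^ n := by
  rw [tsum_eq_sum_shapes (n := n), tsum_div_const, tsum_eq_sum_shapes hF hn, Finset.sum_div,
    ← sum_isRepShape n fun s => ∑' T : Fib s, F T.1]
  · refine Finset.sum_congr rfl fun s _ => ?_
    by_cases h : IsRepShape s
    · rw [if_pos h, ← tsum_div_const]
      refine tsum_congr fun T => ?_
      rw [T.2, if_pos h]
    · rw [if_neg h]
      refine (tsum_congr fun T => ?_).trans tsum_zero
      rw [T.2, if_neg h]
  · intro s s' h
    obtain ⟨e, he⟩ := h.exists_equiv
    rw [← e.tsum_eq]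
    exact tsum_congr fun T => hI _ _ (he T)
  · refine Summable.of_norm_bounded hF.norm fun T => ?_
    split_ifs
    · rw [norm_div, Complex.norm_natCast]
      rcases Nat.eq_zero_or_pos T.shape.symShape with h | h
      · simp [h]
      · exact div_le_self (norm_nonneg _) (by exact_mod_cast h)
    · simp
  · intro T hT
    simp [hn T hT]

/-! ### Summing products over the leaves over all trees of a given order. -/

theorem hasSum_mul_of_nonneg {ι κ : Type*} {f : ι → ℝ} {g : κ → ℝ} {A B : ℝ} (hf : HasSum f A)
    (hg : HasSum g B) (hf0 : ∀ i, 0 ≤ f i) (hg0 : ∀ i, 0 ≤ g i) :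
    HasSum (fun x : ι × κ => f x.1 * g x.2) (A * B) :=
  hf.mul hg (hf.summable.mul_of_nonneg hg.summable hf0 hg0)

/-- A tree of order `n` has `2n + 1` leaves with independent frequencies, so the sum factorizes. -/
theorem hasSum_pr_fib {a : Bool → ℤ → ℝ} (ha : ∀ q k, 0 ≤ a q k) {A : ℝ}
    (hA : ∀ q, HasSum (a q) A) {p : Bool} (s : Tree Unit p) :
    HasSum (fun T : Fib s => T.1.pr a) (A ^ (2 * s.order + 1)) := by
  induction s with
  | leaf p x =>
    rw [← (fibLeaf p x).hasSum_iff, Tree.order, mul_zero, zero_add, pow_one]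
    exact hA p
  | node p s₁ s₂ s₃ h₁ h₂ h₃ =>
    rw [← (fibNode s₁ s₂ s₃).hasSum_iff]
    have n₁ : ∀ T : Fib s₁, 0 ≤ T.1.pr a := fun T => T.1.pr_nonneg ha
    have n₂ : ∀ T : Fib s₂, 0 ≤ T.1.pr a := fun T => T.1.pr_nonneg ha
    have n₃ : ∀ T : Fib s₃, 0 ≤ T.1.pr a := fun T => T.1.pr_nonneg ha
    have n₁₂ : ∀ x : Fib s₁ × Fib s₂, 0 ≤ x.1.1.pr a * x.2.1.pr a :=
      fun x => mul_nonneg (n₁ x.1) (n₂ x.2)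
    have h123 := hasSum_mul_of_nonneg (hasSum_mul_of_nonneg h₁ h₂ n₁ n₂) h₃ n₁₂ n₃
    have e : A ^ (2 * s₁.order + 1) * A ^ (2 * s₂.order + 1) * A ^ (2 * s₃.order + 1)
        = A ^ (2 * (Tree.node p s₁ s₂ s₃).order + 1) := by
      rw [Tree.order]
      ring
    rw [← e]
    exact h123

/-- The sum over all the trees of order `n` of the products over the leaves. -/
theorem hasSum_pr {a : Bool → ℤ → ℝ} (ha : ∀ q k, 0 ≤ a q k) {A : ℝ}
    (hA : ∀ q, HasSum (a q) A) (p : Bool) (n : ℕ) :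
    HasSum (fun T : Tree ℤ p => if T.order = n then T.pr a else 0)
      ((shapes p n).card * A ^ (2 * n + 1)) := by
  classical
  have h : ∀ s ∈ shapes p n, HasSum (fun T : Tree ℤ p => if T.shape = s then T.pr a else 0)
      (A ^ (2 * n + 1)) := by
    intro s hs
    have := hasSum_pr_fib ha hA s
    rw [mem_shapes.1 hs] at this
    have h' := (hasSum_subtype_iff_indicator (f := fun T : Tree ℤ p => T.pr a)
      (s := {T : Tree ℤ p | T.shape = s})).1 this
    have e : (fun T : Tree ℤ p => if T.shape = s then T.pr a else 0)
        = {T : Tree ℤ p | T.shape = s}.indicator fun T => T.pr a := by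
      ext T
      simp [Set.indicator_apply]
    rw [e]
    exact h'
  have := hasSum_sum h
  rw [Finset.sum_const, nsmul_eq_mul] at this
  convert this using 2 with T
  rw [Finset.sum_ite_eq]
  simp only [mem_shapes, Tree.order_shape]

/-! ## Series dominated by a series with continuous sum -/

section dominated

variable {ι E : Type*} [NormedAddCommGroup E] [CompleteSpace E]

theorem norm_tsum_sub_sum_le {f : ι → E} {a : ι → ℝ} {A : ℝ} (hfa : ∀ i, ‖f i‖ ≤ a i)
    (ha : HasSum a A) (F : Finset ι) : ‖∑' i, f i - ∑ i ∈ F, f i‖ ≤ A - ∑ i ∈ F, a i := by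
  have hf : Summable f := Summable.of_norm_bounded ha.summable hfa
  have h1 : HasSum (fun i : {i // i ∉ F} => f i) (∑' i, f i - ∑ i ∈ F, f i) := by
    rw [F.hasSum_compl_iff, sub_add_cancel]
    exact hf.hasSum
  have h2 : HasSum (fun i : {i // i ∉ F} => a i) (A - ∑ i ∈ F, a i) := by
    rw [F.hasSum_compl_iff, sub_add_cancel]
    exact ha
  exact h1.norm_le_of_bounded h2 fun i => hfa i

/-- A Dini-type argument, needed because the majorant varies with time. The tail `A - ∑ i ∈ F, a i`
is small at `t` for some finite `F`, stays small near `t` by continuity, and only decreases when `F`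
grows. -/
theorem tendstoUniformlyOnFilter_of_dominated {f : ι → ℝ → E} {a : ι → ℝ → ℝ} {A : ℝ → ℝ} {t : ℝ}
    (hfa : ∀ᶠ s in 𝓝 t, ∀ i, ‖f i s‖ ≤ a i s) (ha : ∀ᶠ s in 𝓝 t, HasSum (fun i => a i s) (A s))
    (hac : ∀ i, ContinuousAt (a i) t) (hA : ContinuousAt A t) :
    TendstoUniformlyOnFilter (fun (F : Finset ι) s => ∑ i ∈ F, f i s) (fun s => ∑' i, f i s)
      atTop (𝓝 t) := by
  rw [Metric.tendstoUniformlyOnFilter_iff]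
  intro ε hε
  obtain ⟨F, hF⟩ : ∃ F : Finset ι, A t - ∑ i ∈ F, a i t < ε := by
    have h1 : Tendsto (fun F : Finset ι => A t - ∑ i ∈ F, a i t) atTop (𝓝 (A t - A t)) :=
      tendsto_const_nhds.sub ha.self_of_nhds
    rw [sub_self] at h1
    exact (h1.eventually_lt_const hε).exists
  have hc : ContinuousAt (fun s => A s - ∑ i ∈ F, a i s) t :=
    hA.sub (tendsto_finsetSum _ fun i _ => hac i)
  have h2 : ∀ᶠ s in 𝓝 t, A s - ∑ i ∈ F, a i s < ε := hc.eventually_lt_const hF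
  refine Filter.eventually_prod_iff.2 ⟨fun G => F ≤ G, eventually_ge_atTop F, _,
    (hfa.and ha).and h2, ?_⟩
  rintro G hG s ⟨⟨h3, h4⟩, h5⟩
  rw [dist_eq_norm]
  refine (norm_tsum_sub_sum_le h3 h4 G).trans_lt (lt_of_le_of_lt ?_ h5)
  have : ∑ i ∈ F, a i s ≤ ∑ i ∈ G, a i s :=
    Finset.sum_le_sum_of_subset_of_nonneg hG fun i _ _ => (norm_nonneg _).trans (h3 i)
  linarith

theorem continuousAt_tsum_of_dominated {f : ι → ℝ → E} {a : ι → ℝ → ℝ} {A : ℝ → ℝ} {t : ℝ}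
    (hfa : ∀ᶠ s in 𝓝 t, ∀ i, ‖f i s‖ ≤ a i s) (ha : ∀ᶠ s in 𝓝 t, HasSum (fun i => a i s) (A s))
    (hac : ∀ i, ContinuousAt (a i) t) (hA : ContinuousAt A t) (hf : ∀ i, ContinuousAt (f i) t) :
    ContinuousAt (fun s => ∑' i, f i s) t := by
  have h := tendstoUniformlyOnFilter_of_dominated hfa ha hac hA
  rw [Metric.tendstoUniformlyOnFilter_iff] at h
  refine continuousAt_of_locally_uniform_approx_of_continuousAt fun u hu => ?_
  obtain ⟨ε, hε, hu⟩ := Metric.mem_uniformity_dist.1 hu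
  obtain ⟨p, hp, q, hq, hpq⟩ := Filter.eventually_prod_iff.1 (h ε hε)
  obtain ⟨F, hF⟩ := hp.exists
  exact ⟨{s | q s}, hq, fun s => ∑ i ∈ F, f i s, tendsto_finsetSum _ fun i _ => hf i,
    fun s hs => hu (hpq hF hs)⟩

theorem hasDerivAt_tsum_of_dominated {f f' : ι → ℝ → ℂ} {a : ι → ℝ → ℝ} {A : ℝ → ℝ} {t : ℝ}
    (hfd : ∀ᶠ s in 𝓝 t, ∀ i, HasDerivAt (f i) (f' i s) s)
    (hfs : ∀ᶠ s in 𝓝 t, Summable fun i => f i s)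
    (hfa : ∀ᶠ s in 𝓝 t, ∀ i, ‖f' i s‖ ≤ a i s) (ha : ∀ᶠ s in 𝓝 t, HasSum (fun i => a i s) (A s))
    (hac : ∀ i, ContinuousAt (a i) t) (hA : ContinuousAt A t) :
    HasDerivAt (fun s => ∑' i, f i s) (∑' i, f' i t) t := by
  refine hasDerivAt_of_tendstoUniformlyOnFilter
    (tendstoUniformlyOnFilter_of_dominated hfa ha hac hA) ?_
    (hfs.mono fun s hs => hs.hasSum)
  refine Filter.eventually_prod_iff.2 ⟨fun _ => True, Eventually.of_forall fun _ => trivial, _,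
    hfd, ?_⟩
  intro F _ s hs
  exact HasDerivAt.fun_sum fun i _ => hs i

end dominated

/-! ## Sums over finite fibres -/

section fibres

variable {Q τ : Type*} {e : Q → τ} {m : τ → Multiset Q}

theorem hasSum_fiber {E : Type*} [AddCommMonoid E] [TopologicalSpace E]
    (hn : ∀ T, (m T).Nodup) (hm : ∀ T q, q ∈ m T ↔ e q = T) (g : Q → E) (T : τ) :
    HasSum (fun q : {q // e q = T} => g q) ((m T).map g).sum := by
  have h := Finset.hasSum ⟨m T, hn T⟩ g
  have hq : ∀ q, q ∈ (⟨m T, hn T⟩ : Finset Q) ↔ e q = T := fun q => hm T q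
  rw [← (Equiv.subtypeEquivRight hq).hasSum_iff]
  exact h

/-- Here `m T` lists without repetition the fibre of `e` above `T`. It is applied to grafting and to
filling by a leaf. -/
theorem hasSum_sum_fibers (hn : ∀ T, (m T).Nodup) (hm : ∀ T q, q ∈ m T ↔ e q = T) {g : Q → ℂ}
    (hg : Summable g) : HasSum (fun T => ((m T).map g).sum) (∑' q, g q) := by
  have h := hg.hasSum
  rw [← (Equiv.sigmaFiberEquiv e).hasSum_iff] at h
  exact h.sigma fun T => hasSum_fiber hn hm g T

theorem summable_of_summable_fibers (hn : ∀ T, (m T).Nodup) (hm : ∀ T q, q ∈ m T ↔ e q = T)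
    {g : Q → ℂ} (hg : Summable fun T => ((m T).map fun q => ‖g q‖).sum) : Summable g := by
  refine Summable.of_norm ?_
  rw [← (Equiv.sigmaFiberEquiv e).summable_iff]
  refine (summable_sigma_of_nonneg fun _ => norm_nonneg _).2 ⟨fun T => ?_, ?_⟩
  · exact (hasSum_fiber hn hm (fun q => ‖g q‖) T).summable
  · refine hg.congr fun T => ?_
    exact (hasSum_fiber hn hm (fun q => ‖g q‖) T).tsum_eq.symm

end fibres

/-! ## Planar sums -/

open Classical in
/-- Restrict a function on the trees to those of order `n` with root frequency `k`. -/
noncomputable def planar (n : ℕ) (k : ℤ) (x : Tree ℤ false → ℂ) (T : Tree ℤ false) : ℂ :=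
  if T.order = n ∧ T.freq = k then x T else 0

theorem norm_planar_le {n : ℕ} {k : ℤ} {x : Tree ℤ false → ℂ} {C : ℝ} {a : Tree ℤ false → ℝ}
    (hC : 0 ≤ C) (ha : ∀ T, 0 ≤ a T) (h : ∀ T, T.order = n → ‖x T‖ ≤ C * a T)
    (T : Tree ℤ false) : ‖planar n k x T‖ ≤ C * (if T.order = n then a T else 0) := by
  unfold planar
  by_cases h1 : T.order = n
  · rw [if_pos h1]
    split_ifs
    · exact h T h1
    · simpa using mul_nonneg hC (ha T)
  · rw [if_neg h1, if_neg fun h2 => h1 h2.1]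
    simp

theorem summable_planar {n : ℕ} {k : ℤ} {x : Tree ℤ false → ℂ} {C A : ℝ} {c : ℤ → ℝ}
    (hC : 0 ≤ C) (hc : ∀ k, 0 ≤ c k) (hA : HasSum c A)
    (h : ∀ T, T.order = n → ‖x T‖ ≤ C * T.pr fun _ => c) : Summable (planar n k x) :=
  Summable.of_norm_bounded
    ((hasSum_pr (a := fun _ => c) (fun _ k => hc k) (fun _ => hA) false n).summable.mul_left C)
    (norm_planar_le hC (fun T => T.pr_nonneg fun _ k => hc k) h)

theorem HatTree.toTree_injective {α : Type} {p : Bool} :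
    Function.Injective (HatTree.toTree (α := α) (p := p)) := by
  rintro ⟨a, b, c⟩ ⟨a', b', c'⟩ h
  simp only [HatTree.toTree, Tree.node.injEq] at h
  simp [h]

/-- A sum over non-planar trees, with the symmetry factors, is a sum over planar trees. -/
theorem tsum_hatTree {n : ℕ} (hn : 1 ≤ n) {k : ℤ} {x : Tree ℤ false → ℂ}
    (hx : Summable (planar n k x)) (hI : ∀ T U, Tree.Iso T U → x T = x U)
    {S : Set (HatTree ℤ false)} {P : Tree ℤ false → Prop}
    (hS : ∀ T, T ∈ S ↔ T.IsRep ∧ T.order = n ∧ T.freq = k ∧ P T.toTree)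
    (hP : ∀ T, T.order = n → ¬ P T → x T = 0) {g : HatTree ℤ false → ℂ}
    (hg : ∀ T, T.order = n → P T.toTree → g T = 2 ^ n * x T.toTree / (T.sym : ℂ)) :
    Summable (fun T : S => g T) ∧ ∑' T : S, g T = ∑' T, planar n k x T := by
  classical
  -- The constant `2 ^ n` from `Υ` is kept in front, to be cancelled by the division by `2 ^ n` in
  -- `tsum_isRepShape`.
  set F : Tree ℤ false → ℂ := fun T => 2 ^ n * planar n k x T with hF
  set G : Tree ℤ false → ℂ :=
    fun T => if IsRepShape T.shape then F T / (T.shape.symShape : ℂ) else 0 with hG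
  have hFs : Summable F := hx.mul_left _
  have hgS : S.indicator g = G ∘ HatTree.toTree := by
    ext T
    simp only [Set.indicator_apply, hS, Function.comp_apply, hG, hF, planar]
    change (if IsRepShape T.toTree.shape ∧ T.toTree.order = n ∧ T.toTree.freq = k ∧ P T.toTree
      then g T else 0) = _
    by_cases h1 : IsRepShape T.toTree.shape
    · by_cases h2 : T.toTree.order = n ∧ T.toTree.freq = k
      · by_cases h3 : P T.toTree
        · rw [if_pos ⟨h1, h2.1, h2.2, h3⟩, if_pos h1, if_pos h2]
          exact hg T h2.1 h3
        · rw [if_neg fun h => h3 h.2.2.2, if_pos h1, if_pos h2, hP _ h2.1 h3]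
          simp
      · rw [if_neg fun h => h2 ⟨h.2.1, h.2.2.1⟩, if_pos h1, if_neg h2]
        simp
    · rw [if_neg fun h => h1 h.1, if_neg h1]
  have hGs : Summable G := by
    refine Summable.of_norm_bounded hFs.norm fun T => ?_
    simp only [hG]
    split_ifs
    · rw [norm_div, Complex.norm_natCast]
      rcases Nat.eq_zero_or_pos T.shape.symShape with h | h
      · simp [h]
      · exact div_le_self (norm_nonneg _) (by exact_mod_cast h)
    · simp
  have hF0 : ∀ T : Tree ℤ false, T.order ≠ n → F T = 0 := by
    intro T hT
    simp only [hF, planar]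
    rw [if_neg fun h => hT h.1, mul_zero]
  constructor
  · have := hGs.comp_injective HatTree.toTree_injective
    rw [← hgS] at this
    exact summable_subtype_iff_indicator.2 this
  · rw [tsum_subtype S g, hgS]
    have : ∑' T, (G ∘ HatTree.toTree) T = ∑' T, G T := by
      refine HatTree.toTree_injective.tsum_eq fun T hT => ?_
      cases T with
      -- A leaf is not of the form `toTree`, but it has order `0` and contributes nothing since `n ≥
      -- 1`.
      | leaf =>
        refine absurd ?_ hT
        simp only [hG, hF0 (.leaf false _) (by simp [Tree.order]; omega), zero_div, ite_self]
      | node p T₁ T₂ T₃ => exact ⟨⟨T₁, T₂, T₃⟩, rfl⟩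
    rw [this, tsum_isRepShape hFs hF0]
    · refine tsum_congr fun T => ?_
      simp only [hF]
      field_simp
    · intro T U h
      simp only [hF, planar, h.order_eq, h.freq_eq, hI T U h]

/-! ## Grafting -/

/-- The product over the leaves of a context. -/
def Ctx.pr {R : Type*} [CommSemiring R] (a : Bool → ℤ → R) : {p : Bool} → Ctx p → R
  | _, .hole _ => 1
  | _, .fst _ C T₂ T₃ => C.pr a * T₂.pr a * T₃.pr a
  | _, .snd _ T₁ C T₃ => T₁.pr a * C.pr a * T₃.pr a
  | _, .thd _ T₁ T₂ C => T₁.pr a * T₂.pr a * C.pr a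

theorem Ctx.pr_fill {R : Type*} [CommSemiring R] (a : Bool → ℤ → R) (F : ∀ q, Tree ℤ q) {p : Bool}
    (C : Ctx p) : (C.fill F).pr a = C.pr a * (F C.holeType).pr a := by
  induction C with
  | hole p => simp [Ctx.pr, Ctx.fill, Ctx.holeType]
  | fst p C T₂ T₃ ih => simp only [Ctx.pr, Ctx.fill, Ctx.holeType, Tree.pr, ih]; ring
  | snd p T₁ C T₃ ih => simp only [Ctx.pr, Ctx.fill, Ctx.holeType, Tree.pr, ih]; ring
  | thd p T₁ T₂ C ih => simp only [Ctx.pr, Ctx.fill, Ctx.holeType, Tree.pr, ih]; ring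

theorem Tree.dpr_eq_sum {R : Type*} [CommSemiring R] (a b : Bool → ℤ → R) {p : Bool}
    (T : Tree ℤ p) :
    T.dpr a b = (T.leafMarks.map fun P => P.1.pr a * b P.1.holeType P.2).sum := by
  unfold Tree.leafMarks
  induction T with
  | leaf p k => simp [Tree.marks, Tree.leafVal, Tree.dpr, Ctx.pr, Ctx.holeType]
  | node p T₁ T₂ T₃ h₁ h₂ h₃ =>
    simp only [Tree.marks, Tree.leafVal, Option.elim_none, zero_add, Multiset.map_add,
      Multiset.sum_add, Multiset.map_map, Tree.dpr, h₁, h₂, h₃, Function.comp_def, Ctx.pr,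
      Ctx.holeType]
    simp only [← Multiset.sum_map_mul_left, ← Multiset.sum_map_mul_right]
    congr 1
    · congr 1
      · congr 1
        refine Multiset.map_congr rfl fun P _ => ?_
        ring
      · congr 1
        refine Multiset.map_congr rfl fun P _ => ?_
        ring
    · congr 1
      refine Multiset.map_congr rfl fun P _ => ?_
      ring

theorem norm_vcoef (v : ℤ → ℂ) (q : Bool) (k : ℤ) : ‖vcoef v q k‖ = ‖v k‖ := by
  cases q <;> simp [vcoef]

theorem Tree.norm_pr_vcoef (v : ℤ → ℂ) {p : Bool} (T : Tree ℤ p) :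
    ‖T.pr (vcoef v)‖ = T.pr fun _ k => ‖v k‖ := by
  simp only [Tree.norm_pr, norm_vcoef]

open Classical in
/-- The summands of the cubic nonlinearity `w_k = ∑_{k = k₁ + k₂ - k₃} -i e^{i t 𝓕} v v v̄` and of
its conjugate, restricted to letters satisfying `χ`. -/
noncomputable def cubicTerm (χ : Letter → Prop) (t : ℝ) (v : ℤ → ℂ) (q : Bool)
    (b : ℤ × ℤ × ℤ) : ℂ :=
  if χ ⟨q, b.1, b.2.1, b.2.2⟩ then
    -((sgn q : ℂ) * Complex.I * Complex.exp (Complex.I *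
      ((Letter.osc ⟨q, b.1, b.2.1, b.2.2⟩ : ℤ) : ℂ) * (t : ℂ))
        * (vcoef v q b.1 * vcoef v q b.2.1 * vcoef v (!q) b.2.2))
  else 0

/-- The restriction of the cubic nonlinearity to letters satisfying `χ`. -/
noncomputable def cubic (χ : Letter → Prop) (t : ℝ) (v : ℤ → ℂ) (k : ℤ) : ℂ :=
  ∑' b : {b // tripleFreq b = k}, cubicTerm χ t v false b

theorem Letter.osc_flip (b : ℤ × ℤ × ℤ) :
    Letter.osc ⟨true, b.1, b.2.1, b.2.2⟩ = -Letter.osc ⟨false, b.1, b.2.1, b.2.2⟩ := by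
  simp only [Letter.osc, Letter.toHatTree, HatTree.osc, HatTree.freq, HatTree.toTree, Tree.freq,
    Tree.osc, edgeSymbol, symbol, sgn]
  simp
  ring

/-- Conjugation reverses the phase, matched by `Letter.osc_flip`, and the sign of `i`, matched by
`sgn`. The hypothesis says that `χ` does not distinguish an equation from its conjugate. -/
theorem conj_cubicTerm {χ : Letter → Prop}
    (hχ : ∀ b : ℤ × ℤ × ℤ, χ ⟨true, b.1, b.2.1, b.2.2⟩ ↔ χ ⟨false, b.1, b.2.1, b.2.2⟩)
    (t : ℝ) (v : ℤ → ℂ) (b : ℤ × ℤ × ℤ) :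
    (starRingEnd ℂ) (cubicTerm χ t v false b) = cubicTerm χ t v true b := by
  unfold cubicTerm
  rw [Letter.osc_flip]
  by_cases h : χ ⟨false, b.1, b.2.1, b.2.2⟩
  · rw [if_pos h, if_pos ((hχ b).2 h)]
    simp [vcoef, sgn, ← Complex.exp_conj]
  · rw [if_neg h, if_neg fun h' => h ((hχ b).1 h')]
    simp

theorem vcoef_cubic {χ : Letter → Prop}
    (hχ : ∀ b : ℤ × ℤ × ℤ, χ ⟨true, b.1, b.2.1, b.2.2⟩ ↔ χ ⟨false, b.1, b.2.1, b.2.2⟩)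
    (t : ℝ) (v : ℤ → ℂ) (q : Bool) (k : ℤ) :
    vcoef (cubic χ t v) q k = ∑' b : {b // tripleFreq b = k}, cubicTerm χ t v q b := by
  cases q with
  | false => simp [vcoef, cubic]
  | true =>
    simp only [vcoef, cubic, if_true, Complex.conj_tsum]
    exact tsum_congr fun b => conj_cubicTerm hχ t v b

open Classical in
/-- The part of `𝓕(T) Ψ̂(𝔞(T))` due to the words whose first letter satisfies `χ`. -/
noncomputable def Tree.headPsi (χ : Letter → Prop) (N t : ℝ) {p : Bool} (T : Tree ℤ p) : ℂ :=
  (T.tripleMarks.map fun Q => if χ (markLetter Q) then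
    Complex.exp (Complex.I * ((markLetter Q).osc : ℂ) * (t : ℂ)) * (cut Q).psi N t else 0).sum

/-- Cutting a non-resonant node leaves the resonant one in place, so `Ψ` of the cut tree vanishes.
-/
theorem Tree.headPsi_nonRes_eq_zero {N t : ℝ} {p : Bool} {T : Tree ℤ p} (h : T.numRes ≠ 0) :
    T.headPsi Letter.NonRes N t = 0 := by
  apply Multiset.sum_eq_zero
  intro x hx
  obtain ⟨Q, hQ, rfl⟩ := Multiset.mem_map.1 hx
  split_ifs with hl
  · rw [Tree.psi_eq_zero_of_numRes, mul_zero]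
    have := numRes_graft Q
    rw [(T.mem_tripleMarks Q).1 hQ, numRes_tripleTree_of_nonRes hl] at this
    rwa [← Nat.add_zero (cut Q).numRes, ← this]
  · rfl

theorem Tree.headPsi_nonRes {N t : ℝ} {p : Bool} {T : Tree ℤ p} (h : T.numRes = 0) :
    T.headPsi Letter.NonRes N t = T.oscPsiHat N t := by
  rw [Tree.headPsi, Tree.oscPsiHat_eq_sum]
  congr 1
  refine Multiset.map_congr rfl fun Q hQ => ?_
  refine if_pos ?_
  by_contra hl
  have := numRes_graft Q
  rw [(T.mem_tripleMarks Q).1 hQ, numRes_tripleTree_of_not_nonRes hl] at this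
  omega

/-- A nonzero summand requires a resonant first letter and a cut tree without resonance. The only
resonant node is then the removed one, which has three leaves: this is why `hatTres` is the right
index set for `ℛ`. -/
theorem Tree.headPsi_res_eq_zero {N t : ℝ} {p : Bool} {T : Tree ℤ p}
    (h : ¬ (T.numRes = 1 ∧ T.numResTerminal = 1)) :
    T.headPsi (fun a => ¬ a.NonRes) N t = 0 := by
  apply Multiset.sum_eq_zero
  intro x hx
  obtain ⟨Q, hQ, rfl⟩ := Multiset.mem_map.1 hx
  split_ifs with hl
  · rw [Tree.psi_eq_zero_of_numRes, mul_zero]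
    have h1 := numRes_graft Q
    have h2 := numResTerminal_graft_pos Q hl
    rw [(T.mem_tripleMarks Q).1 hQ] at h1 h2
    rw [numRes_tripleTree_of_not_nonRes hl] at h1
    have := T.numResTerminal_le
    omega
  · rfl

theorem Tree.headPsi_res {N t : ℝ} {p : Bool} {T : Tree ℤ p} (h : T.numRes = 1) :
    T.headPsi (fun a => ¬ a.NonRes) N t = T.oscPsiHat N t := by
  rw [Tree.headPsi, Tree.oscPsiHat_eq_sum]
  congr 1
  refine Multiset.map_congr rfl fun Q hQ => ?_
  split_ifs with hl
  · rw [Tree.psi_eq_zero_of_numRes, mul_zero]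
    have := numRes_graft Q
    rw [(T.mem_tripleMarks Q).1 hQ, numRes_tripleTree_of_nonRes hl] at this
    omega
  · rfl

/-- `-ε(T) ∏_ℓ v_ℓ`. -/
noncomputable def Tree.weight (v : ℤ → ℂ) {p : Bool} (T : Tree ℤ p) : ℂ :=
  -((-1) ^ T.conjOrder * T.pr (vcoef v))

/-- The derivative of `-ε(T) ∏_ℓ v_ℓ` in the direction `w`. -/
noncomputable def Tree.dweight (v w : ℤ → ℂ) {p : Bool} (T : Tree ℤ p) : ℂ :=
  -((-1) ^ T.conjOrder * T.dpr (vcoef v) (vcoef w))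

theorem Tree.norm_weight (v : ℤ → ℂ) {p : Bool} (T : Tree ℤ p) :
    ‖T.weight v‖ = T.pr fun _ k => ‖v k‖ := by
  rw [Tree.weight, norm_neg, norm_mul, norm_pow, norm_neg, norm_one, one_pow, one_mul,
    Tree.norm_pr_vcoef]

theorem Tree.norm_dweight_le (v w : ℤ → ℂ) {p : Bool} (T : Tree ℤ p) :
    ‖T.dweight v w‖ ≤ T.dpr (fun _ k => ‖v k‖) fun _ k => ‖w k‖ := by
  rw [Tree.dweight, norm_neg, norm_mul, norm_pow, norm_neg, norm_one, one_pow, one_mul]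
  have := T.norm_dpr_le (vcoef v) (vcoef w)
  simpa only [norm_vcoef] using this

theorem Tree.norm_headPsi_summand_le {N : ℝ} (hN : 0 ≤ N) (t : ℝ) (χ : Letter → Prop)
    [DecidablePred χ] {p : Bool} (Q : Ctx p × (ℤ × ℤ × ℤ)) {n : ℕ} (hQ : (graft Q).order = n + 1) :
    ‖(if χ (markLetter Q) then
      Complex.exp (Complex.I * ((markLetter Q).osc : ℂ) * (t : ℂ)) * (cut Q).psi N t else 0)‖
        ≤ (n.factorial : ℝ) := by
  split_ifs
  · rw [norm_mul, norm_exp_osc, one_mul]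
    have := (cut Q).norm_psi_le hN t
    rw [order_graft] at hQ
    rwa [Nat.succ_injective hQ] at this
  · simp

/-- Grafting the cubic nonlinearity onto the leaves of the trees of order `n` gives the trees of
order `n + 1`. -/
theorem tsum_planar_graft {N : ℝ} (hN : 0 ≤ N) (t : ℝ) {v : ℤ → ℂ} (hv : Summable fun k => ‖v k‖)
    {χ : Letter → Prop}
    (hχ : ∀ b : ℤ × ℤ × ℤ, χ ⟨true, b.1, b.2.1, b.2.2⟩ ↔ χ ⟨false, b.1, b.2.1, b.2.2⟩)
    (n : ℕ) (k : ℤ) :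
    ∑' T, planar (n + 1) k (fun T => T.weight v * (Complex.I * T.headPsi χ N t)) T
      = -∑' T, planar n k (fun T => T.dweight v (cubic χ t v) * T.psi N t) T := by
  classical
  -- `K` is the summand indexed by a tree of order `n + 1` with a marked node; `H` is the order `n`
  -- summand with the factor of the marked leaf left out. Absolute summability of `K` justifies
  -- regrouping it along three maps: `graft`, forgetting the three frequencies, and `fillLeaf`.
  set K : Ctx false × (ℤ × ℤ × ℤ) → ℂ := fun Q =>
    planar (n + 1) k (fun T => T.weight v * Complex.I) (graft Q)
      * (if χ (markLetter Q) then
        Complex.exp (Complex.I * ((markLetter Q).osc : ℂ) * (t : ℂ)) * (cut Q).psi N t else 0)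
    with hK
  set H : Ctx false × ℤ → ℂ := fun P => planar n k
    (fun T => (-1) ^ T.conjOrder * T.psi N t) (fillLeaf P) * P.1.pr (vcoef v) with hH
  have hn : ∀ T : Tree ℤ false, T.tripleMarks.Nodup := fun T => T.nodup_marks
  have hm : ∀ (T : Tree ℤ false) Q, Q ∈ T.tripleMarks ↔ graft Q = T :=
    fun T Q => T.mem_tripleMarks Q
  have hKs : Summable K := by
    refine summable_of_summable_fibers hn hm ?_
    have hp := (hasSum_pr (a := fun _ k => ‖v k‖) (fun _ k => norm_nonneg _)
      (fun _ => hv.hasSum) false (n + 1)).summable.mul_left ((n + 1 : ℝ) * (n.factorial : ℝ))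
    refine Summable.of_nonneg_of_le (fun T => ?_) (fun T => ?_) hp
    · refine Multiset.sum_nonneg fun x hx => ?_
      obtain ⟨Q, -, rfl⟩ := Multiset.mem_map.1 hx
      exact norm_nonneg _
    · by_cases hT : T.order = n + 1
      · calc _ ≤ (T.tripleMarks.map fun _ => (T.pr fun _ k => ‖v k‖) * (n.factorial : ℝ)).sum := by
              refine Multiset.sum_map_le_sum_map _ _ fun Q hQ => ?_
              have hQT := (hm T Q).1 hQ
              simp only [hK, norm_mul]
              refine mul_le_mul ?_ (Tree.norm_headPsi_summand_le hN t χ Q (hQT ▸ hT))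
                (norm_nonneg _) (T.pr_nonneg fun _ _ => norm_nonneg _)
              rw [hQT, planar]
              split_ifs
              · rw [norm_mul, Complex.norm_I, mul_one, Tree.norm_weight]
              · rw [norm_zero]
                exact T.pr_nonneg fun _ _ => norm_nonneg _
          _ = T.tripleMarks.card * ((T.pr fun _ k => ‖v k‖) * (n.factorial : ℝ)) := by simp
          _ ≤ (n + 1 : ℝ) * ((T.pr fun _ k => ‖v k‖) * (n.factorial : ℝ)) := by
              refine mul_le_mul_of_nonneg_right ?_
                (mul_nonneg (T.pr_nonneg fun _ _ => norm_nonneg _) (by positivity))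
              have := T.card_tripleMarks_le
              rw [hT] at this
              exact_mod_cast this
          _ = _ := by rw [if_pos hT]; ring
      · rw [if_neg hT, mul_zero]
        refine (Multiset.sum_eq_zero fun x hx => ?_).le
        obtain ⟨Q, hQ, rfl⟩ := Multiset.mem_map.1 hx
        simp only [hK]
        rw [(hm T Q).1 hQ, planar, if_neg fun h => hT h.1]
        simp
  have h1 : HasSum (planar (n + 1) k (fun T => T.weight v * (Complex.I * T.headPsi χ N t)))
      (∑' Q, K Q) := by
    have := hasSum_sum_fibers hn hm hKs
    convert this using 1
    ext T
    have e : (T.tripleMarks.map K).sum = planar (n + 1) k (fun T => T.weight v * Complex.I) T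
        * T.headPsi χ N t := by
      rw [Tree.headPsi, ← Multiset.sum_map_mul_left]
      congr 1
      refine Multiset.map_congr rfl fun Q hQ => ?_
      simp only [hK]
      rw [(hm T Q).1 hQ]
    rw [e]
    unfold planar
    split_ifs
    · ring
    · simp
  have hKH : ∀ Q, K Q = H (Q.1, tripleFreq Q.2) * cubicTerm χ t v Q.1.holeType Q.2 := by
    intro Q
    simp only [hK, hH, planar]
    rw [← freq_cut, order_graft]
    change _ = (if (cut Q).order = n ∧ (cut Q).freq = k then _ else _) * _ * _
    simp only [Nat.add_right_cancel_iff]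
    by_cases hc : (cut Q).order = n ∧ (cut Q).freq = k
    · rw [if_pos hc, if_pos hc, cubicTerm]
      change _ * (if χ (markLetter Q) then _ else _)
        = _ * _ * (if χ (markLetter Q) then _ else _)
      split_ifs
      · have e1 : (graft Q).pr (vcoef v) = Q.1.pr (vcoef v) * (vcoef v Q.1.holeType Q.2.1
            * vcoef v Q.1.holeType Q.2.2.1 * vcoef v (!Q.1.holeType) Q.2.2.2) :=
          Ctx.pr_fill _ _ _
        have e2 : ((-1 : ℂ)) ^ (graft Q).conjOrder
            = (-1) ^ (cut Q).conjOrder * (sgn Q.1.holeType : ℂ) := by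
          rw [conjOrder_graft, pow_add]
          congr 1
          generalize Q.1.holeType = q
          cases q <;> simp [tripleTree, Tree.conjOrder, sgn]
        rw [Tree.weight, e1, e2]
        change _ = (-1) ^ (cut Q).conjOrder * (cut Q).psi N t * _ * _
        simp only [markLetter]
        ring
      · simp
    · rw [if_neg hc, if_neg hc]
      simp
  -- For a fixed leaf, summing over the triples with the right frequency reassembles the
  -- nonlinearity at that leaf.
  have h2 : HasSum (fun P : Ctx false × ℤ => H P * vcoef (cubic χ t v) P.1.holeType P.2)
      (∑' Q, K Q) := by
    set φ : Ctx false × (ℤ × ℤ × ℤ) → Ctx false × ℤ := fun Q => (Q.1, tripleFreq Q.2) with hφ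
    have hs := (Equiv.sigmaFiberEquiv φ).summable_iff.2 hKs
    have := hs.hasSum
    have h3 := this.sigma fun P => (hs.sigma_factor P).hasSum
    have e : ∑' c, (K ∘ (Equiv.sigmaFiberEquiv φ)) c = ∑' Q, K Q :=
      (Equiv.sigmaFiberEquiv φ).tsum_eq K
    rw [e] at h3
    convert h3 using 1
    ext P
    rw [vcoef_cubic hχ, ← tsum_mul_left]
    let E : {b // tripleFreq b = P.2} ≃ {Q // φ Q = P} :=
      { toFun := fun b => ⟨(P.1, b.1), Prod.ext rfl b.2⟩
        invFun := fun Q => ⟨Q.1.2, congrArg Prod.snd Q.2⟩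
        left_inv := fun b => rfl
        right_inv := fun Q => Subtype.ext (Prod.ext (congrArg Prod.fst Q.2).symm rfl) }
    rw [← E.tsum_eq]
    refine tsum_congr fun b => ?_
    change _ = K (P.1, b.1)
    rw [hKH, b.2]
  -- Summing over the leaves of a fixed tree is the Leibniz rule `Tree.dpr_eq_sum`.
  have h3 : HasSum (planar n k fun T => -(T.dweight v (cubic χ t v) * T.psi N t))
      (∑' Q, K Q) := by
    have hn' : ∀ T : Tree ℤ false, T.leafMarks.Nodup := fun T => T.nodup_marks
    have hm' : ∀ (T : Tree ℤ false) P, P ∈ T.leafMarks ↔ fillLeaf P = T :=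
      fun T P => T.mem_leafMarks P
    have := hasSum_sum_fibers hn' hm' h2.summable
    rw [h2.tsum_eq] at this
    convert this using 1
    ext T
    have e : (T.leafMarks.map fun P => H P * vcoef (cubic χ t v) P.1.holeType P.2).sum
        = planar n k (fun T => (-1) ^ T.conjOrder * T.psi N t) T
          * T.dpr (vcoef v) (vcoef (cubic χ t v)) := by
      rw [Tree.dpr_eq_sum, ← Multiset.sum_map_mul_left]
      congr 1
      refine Multiset.map_congr rfl fun P hP => ?_
      simp only [hH]
      rw [(hm' T P).1 hP, mul_assoc]
    rw [e]
    unfold planar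
    split_ifs
    · simp only [Tree.dweight]; ring
    · simp
  rw [h1.tsum_eq, ← h3.tsum_eq, ← tsum_neg]
  refine tsum_congr fun T => ?_
  unfold planar
  split_ifs <;> simp

/-! ## Fourier coefficients of the nonlinearity -/

/-- The `k`-th Fourier coefficient as a continuous linear functional. -/
theorem exists_fourierCoeff_clm (k : ℤ) :
    ∃ L : C(Torus, ℂ) →L[ℂ] ℂ, ∀ f, L f = fourierCoeff f k := by
  refine ⟨(innerSL ℂ (fourierBasis (T := 2 * Real.pi) k)).comp
    (ContinuousMap.toLp (E := ℂ) 2 AddCircle.haarAddCircle ℂ), fun f => ?_⟩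
  rw [← fourierCoeff_toLp, ← fourierBasis_repr, HilbertBasis.repr_apply_apply]
  rfl

theorem hasSum_fourier_star {f : C(Torus, ℂ)}
    (h : HasSum (fun i => fourierCoeff f i • fourier i) f) :
    HasSum (fun i => (starRingEnd ℂ) (fourierCoeff f i) • (fourier (-i) : C(Torus, ℂ)))
      (star f) := by
  convert h.star using 1
  ext i x
  simp

theorem smul_fourier_mul (c₁ c₂ c₃ : ℂ) (b : ℤ × ℤ × ℤ) :
    (c₁ • fourier b.1 : C(Torus, ℂ)) * ((c₂ • fourier b.2.1) * (c₃ • fourier (-b.2.2)))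
      = (c₁ * c₂ * c₃) • (fourier (tripleFreq b) : C(Torus, ℂ)) := by
  ext x
  rw [tripleFreq, sub_eq_add_neg]
  simp only [ContinuousMap.mul_apply, ContinuousMap.smul_apply, fourier_add, smul_eq_mul]
  ring

theorem hasSum_mul_mul {R ι : Type*} [NormedRing R] [CompleteSpace R] {f g h : ι → R} {a b c : R}
    (hf : HasSum f a) (hg : HasSum g b) (hh : HasSum h c) (hf' : Summable fun i => ‖f i‖)
    (hg' : Summable fun i => ‖g i‖) (hh' : Summable fun i => ‖h i‖) :
    HasSum (fun x : ι × ι × ι => f x.1 * (g x.2.1 * h x.2.2)) (a * (b * c)) :=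
  have h₁ : Summable fun y : ι × ι => ‖g y.1 * h y.2‖ := hg'.mul_norm hh'
  have h₂ : HasSum (fun y : ι × ι => g y.1 * h y.2) (b * c) := hg.mul hh h₁.of_norm
  have h₃ : Summable fun x : ι × ι × ι => ‖f x.1 * (g x.2.1 * h x.2.2)‖ :=
    Summable.mul_norm (f := f) (g := fun y : ι × ι => g y.1 * h y.2) hf' h₁
  HasSum.mul (f := f) (g := fun y : ι × ι => g y.1 * h y.2) hf h₂ h₃.of_norm

/-- Characters have sup norm one, so the Fourier series converges absolutely in `C(Torus, ℂ)` and
may be multiplied out there. -/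
theorem hasSum_fourier_cubic (f : C(Torus, ℂ)) (hf : Summable fun k => ‖fourierCoeff f k‖) :
    HasSum (fun b : ℤ × ℤ × ℤ => (fourierCoeff f b.1 * fourierCoeff f b.2.1
        * (starRingEnd ℂ) (fourierCoeff f b.2.2)) • (fourier (tripleFreq b) : C(Torus, ℂ)))
      (f * (f * star f)) := by
  have h : HasSum (fun i => fourierCoeff f i • fourier i) f :=
    hasSum_fourier_series_of_summable hf.of_norm
  have hn1 : Summable fun i => ‖fourierCoeff f i • (fourier i : C(Torus, ℂ))‖ := by
    simpa only [norm_smul, fourier_norm, mul_one] using hf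
  have hn2 : Summable fun i =>
      ‖(starRingEnd ℂ) (fourierCoeff f i) • (fourier (-i) : C(Torus, ℂ))‖ := by
    simpa only [norm_smul, fourier_norm, mul_one, RCLike.norm_conj] using hf
  exact (hasSum_mul_mul h h (hasSum_fourier_star h) hn1 hn1 hn2).congr_fun
    fun b => (smul_fourier_mul _ _ _ b).symm

theorem mul_mul_star_eq (f : C(Torus, ℂ)) :
    ⇑(f * (f * star f)) = fun x => ((‖f x‖ ^ 2 : ℝ) : ℂ) * f x := by
  ext x
  simp only [ContinuousMap.mul_apply, ContinuousMap.star_apply]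
  rw [← Complex.normSq_eq_norm_sq, ← Complex.mul_conj]
  change _ * (_ * (starRingEnd ℂ) _) = _
  ring

theorem hasSum_fourierCoeff_cubic (f : C(Torus, ℂ)) (hf : Summable fun k => ‖fourierCoeff f k‖)
    (k : ℤ) :
    HasSum (fun b : {b // tripleFreq b = k} => fourierCoeff f b.1.1 * fourierCoeff f b.1.2.1
        * (starRingEnd ℂ) (fourierCoeff f b.1.2.2))
      (fourierCoeff (fun x => ((‖f x‖ ^ 2 : ℝ) : ℂ) * f x) k) := by
  obtain ⟨L, hL⟩ := exists_fourierCoeff_clm k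
  have h4 := L.hasSum (hasSum_fourier_cubic f hf)
  rw [hL, mul_mul_star_eq] at h4
  refine (hasSum_subtype_iff_indicator (s := {b | tripleFreq b = k})
    (f := fun b : ℤ × ℤ × ℤ => fourierCoeff f b.1 * fourierCoeff f b.2.1
        * (starRingEnd ℂ) (fourierCoeff f b.2.2))).2 ?_
  refine h4.congr_fun fun b => ?_
  rw [map_smul, hL, fourierCoeff_fourier]
  by_cases hb : tripleFreq b = k
  · subst hb
    simp
  · simp [Ne.symm hb, hb]

theorem Letter.osc_false (b : ℤ × ℤ × ℤ) :
    Letter.osc ⟨false, b.1, b.2.1, b.2.2⟩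
      = tripleFreq b ^ 2 - b.1 ^ 2 - b.2.1 ^ 2 + b.2.2 ^ 2 := by
  simp only [Letter.osc, Letter.toHatTree, HatTree.osc, HatTree.freq, HatTree.toTree, Tree.freq,
    Tree.osc, edgeSymbol, symbol, sgn, tripleFreq]
  simp
  ring

theorem norm_twisted (u : ℝ → C(Torus, ℂ)) (t : ℝ) (k : ℤ) :
    ‖twisted u t k‖ = ‖fourierCoeff (u t) k‖ := by
  have : Complex.I * (t : ℂ) * (k : ℂ) ^ 2 = ((t * k ^ 2 : ℝ) : ℂ) * Complex.I := by
    push_cast; ring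
  rw [twisted, norm_mul, this, Complex.norm_exp_ofReal_mul_I, one_mul]

theorem cubicTerm_twisted (u : ℝ → C(Torus, ℂ)) (t : ℝ) (b : ℤ × ℤ × ℤ) :
    cubicTerm (fun _ => True) t (twisted u t) false b
      = -Complex.I * Complex.exp (Complex.I * (t : ℂ) * (tripleFreq b : ℂ) ^ 2)
        * (fourierCoeff (u t) b.1 * fourierCoeff (u t) b.2.1
          * (starRingEnd ℂ) (fourierCoeff (u t) b.2.2)) := by
  -- Since `𝓕 = k² - k₁² - k₂² + k₃²` with `k = tripleFreq b`, the twists of the three factors turn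
  -- the resonance phase into `e^{itk²}`.
  have e : Complex.exp (Complex.I * (t : ℂ) * (tripleFreq b : ℂ) ^ 2)
      = Complex.exp (Complex.I * ((tripleFreq b ^ 2 - b.1 ^ 2 - b.2.1 ^ 2 + b.2.2 ^ 2 : ℤ) : ℂ)
          * (t : ℂ)) * Complex.exp (Complex.I * (t : ℂ) * (b.1 : ℂ) ^ 2)
        * Complex.exp (Complex.I * (t : ℂ) * (b.2.1 : ℂ) ^ 2)
        * Complex.exp (-(Complex.I * (t : ℂ) * (b.2.2 : ℂ) ^ 2)) := by
    rw [← Complex.exp_add, ← Complex.exp_add, ← Complex.exp_add]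
    congr 1
    push_cast
    ring
  rw [cubicTerm, if_pos trivial, Letter.osc_false, e]
  simp only [vcoef, twisted, sgn, map_mul, ← Complex.exp_conj, map_pow, Complex.conj_I,
    Complex.conj_ofReal, map_intCast]
  simp only [Bool.not_false, if_true, Bool.false_eq_true, if_false, neg_mul]
  push_cast
  ring

/-- Differentiating the twist cancels the Laplacian, leaving only the nonlinearity. -/
theorem hasDerivAt_twisted {J : Set ℝ} {u : ℝ → C(Torus, ℂ)} (hu : IsNLSSolution J u) {t : ℝ}
    (ht : t ∈ J) (k : ℤ) :
    HasDerivAt (fun s => twisted u s k) (cubic (fun _ => True) t (twisted u t) k) t := by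
  have h1 := hu.equation t ht k
  have h2 : HasDerivAt (fun s : ℝ => Complex.exp (Complex.I * (s : ℂ) * (k : ℂ) ^ 2))
      (Complex.exp (Complex.I * (t : ℂ) * (k : ℂ) ^ 2) * (Complex.I * (k : ℂ) ^ 2)) t := by
    have := (((hasDerivAt_id (t : ℂ)).const_mul Complex.I).mul_const
      ((k : ℂ) ^ 2)).cexp.comp_ofReal
    simpa using this
  refine (h2.mul h1).congr_deriv ?_
  have h3 := (hasSum_fourierCoeff_cubic (u t) (hu.summable t ht) k).tsum_eq
  rw [← h3, cubic]
  have h4 : ∀ b : {b // tripleFreq b = k}, cubicTerm (fun _ => True) t (twisted u t) false b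
      = -Complex.I * Complex.exp (Complex.I * (t : ℂ) * (k : ℂ) ^ 2)
        * (fourierCoeff (u t) b.1.1 * fourierCoeff (u t) b.1.2.1
          * (starRingEnd ℂ) (fourierCoeff (u t) b.1.2.2)) := by
    intro b
    rw [cubicTerm_twisted, b.2]
  rw [tsum_congr h4, tsum_mul_left]
  ring

/-! ## The cubic sums of absolute values -/

/-- The sum of the absolute values of the summands of the cubic nonlinearity. -/
noncomputable def cubicAbs (v : ℤ → ℂ) (k : ℤ) : ℝ :=
  ∑' b : {b // tripleFreq b = k}, ‖v b.1.1‖ * (‖v b.1.2.1‖ * ‖v b.1.2.2‖)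

theorem hasSum_triple {v : ℤ → ℂ} {A : ℝ} (hA : HasSum (fun k => ‖v k‖) A) :
    HasSum (fun b : ℤ × ℤ × ℤ => ‖v b.1‖ * (‖v b.2.1‖ * ‖v b.2.2‖)) (A * (A * A)) := by
  have hn : ∀ k, 0 ≤ ‖v k‖ := fun k => norm_nonneg _
  exact hasSum_mul_of_nonneg hA (hasSum_mul_of_nonneg hA hA hn hn) hn
    fun b => mul_nonneg (hn _) (hn _)

theorem hasSum_cubicAbs {v : ℤ → ℂ} {A : ℝ} (hA : HasSum (fun k => ‖v k‖) A) :
    HasSum (cubicAbs v) (A * (A * A)) := by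
  have h := (Equiv.sigmaFiberEquiv tripleFreq).hasSum_iff.2 (hasSum_triple hA)
  exact h.sigma fun k => (h.summable.sigma_factor k).hasSum

theorem cubicAbs_nonneg (v : ℤ → ℂ) (k : ℤ) : 0 ≤ cubicAbs v k :=
  tsum_nonneg fun _ => by positivity

theorem norm_cubicTerm_le (χ : Letter → Prop) (t : ℝ) (v : ℤ → ℂ) (q : Bool) (b : ℤ × ℤ × ℤ) :
    ‖cubicTerm χ t v q b‖ ≤ ‖v b.1‖ * (‖v b.2.1‖ * ‖v b.2.2‖) := by
  unfold cubicTerm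
  split_ifs
  · have : ‖(sgn q : ℂ)‖ = 1 := by cases q <;> simp [sgn]
    rw [norm_neg, norm_mul, norm_mul, norm_mul, this, Complex.norm_I, norm_exp_osc, norm_mul,
      norm_mul, norm_vcoef, norm_vcoef, norm_vcoef]
    linarith
  · rw [norm_zero]
    positivity

theorem summable_cubicTerm (χ : Letter → Prop) (t : ℝ) {v : ℤ → ℂ}
    (hv : Summable fun k => ‖v k‖) (k : ℤ) :
    Summable fun b : {b // tripleFreq b = k} => cubicTerm χ t v false b :=
  Summable.of_norm_bounded ((hasSum_triple hv.hasSum).summable.subtype _)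
    fun b => norm_cubicTerm_le χ t v false b

theorem norm_cubic_le (χ : Letter → Prop) (t : ℝ) {v : ℤ → ℂ}
    (hv : Summable fun k => ‖v k‖) (k : ℤ) : ‖cubic χ t v k‖ ≤ cubicAbs v k :=
  tsum_of_norm_bounded (((hasSum_triple hv.hasSum).summable.subtype _).hasSum)
    fun b => norm_cubicTerm_le χ t v false b

theorem cubic_add_cubic_not (χ : Letter → Prop) (t : ℝ) {v : ℤ → ℂ}
    (hv : Summable fun k => ‖v k‖) (k : ℤ) :
    cubic (fun _ => True) t v k = cubic χ t v k + cubic (fun a => ¬ χ a) t v k := by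
  rw [cubic, cubic, cubic,
    ← (summable_cubicTerm χ t hv k).tsum_add (summable_cubicTerm _ t hv k)]
  refine tsum_congr fun b => ?_
  unfold cubicTerm
  by_cases h : χ ⟨false, b.1.1, b.1.2.1, b.1.2.2⟩ <;> simp [h]

/-! ## The terms of the normal form as planar sums -/

section terms

variable {N : ℝ} {n : ℕ} {k : ℤ} {v : ℤ → ℂ}

theorem HatTree.coef_mul_ups {T : HatTree ℤ false} (hT : T.order = n) :
    T.coef * T.ups v = 2 ^ n * T.toTree.weight v / (T.sym : ℂ) := by
  have h : T.toTree.order = n := hT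
  rw [HatTree.coef, HatTree.ups, Tree.ups_eq, h, Tree.weight, HatTree.conjOrder]
  ring

theorem HatTree.coef_mul_dups {w : ℤ → ℂ} {T : HatTree ℤ false} (hT : T.order = n) :
    T.coef * T.dups v w = 2 ^ n * T.toTree.dweight v w / (T.sym : ℂ) := by
  have h : T.toTree.order = n := hT
  rw [HatTree.coef, HatTree.dups, Tree.dups_eq, h, Tree.dweight, HatTree.conjOrder]
  ring

theorem HatTree.osc_eq_nodeOsc {p : Bool} (T : HatTree ℤ p) : T.osc = T.toTree.nodeOsc :=
  T.osc_eq_sum_letters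

theorem Tree.Iso.weight_eq {p : Bool} {T U : Tree ℤ p} (h : Tree.Iso T U) :
    T.weight v = U.weight v := by
  rw [Tree.weight, Tree.weight, h.conjOrder_eq, h.pr_eq]

theorem Tree.Iso.dweight_eq {w : ℤ → ℂ} {p : Bool} {T U : Tree ℤ p} (h : Tree.Iso T U) :
    T.dweight v w = U.dweight v w := by
  rw [Tree.dweight, Tree.dweight, h.conjOrder_eq, h.dpr_eq]

theorem norm_weight_mul_le {y : Tree ℤ false → ℂ}
    (hy : ∀ T, T.order = n → ‖y T‖ ≤ (n.factorial : ℝ)) {T : Tree ℤ false} (hT : T.order = n) :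
    ‖T.weight v * y T‖ ≤ (n.factorial : ℝ) * T.pr fun _ k => ‖v k‖ := by
  rw [norm_mul, Tree.norm_weight, mul_comm]
  exact mul_le_mul_of_nonneg_right (hy T hT) (T.pr_nonneg fun _ _ => norm_nonneg _)

theorem norm_dweight_mul_le {w : ℤ → ℂ} {W : ℤ → ℝ} (hw : ∀ k, ‖w k‖ ≤ W k)
    {y : Tree ℤ false → ℂ} (hy : ∀ T, T.order = n → ‖y T‖ ≤ (n.factorial : ℝ))
    {T : Tree ℤ false} (hT : T.order = n) :
    ‖T.dweight v w * y T‖ ≤ (n.factorial : ℝ) * T.dpr (fun _ k => ‖v k‖) fun _ => W := by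
  rw [norm_mul, mul_comm]
  refine mul_le_mul (hy T hT) ((T.norm_dweight_le v w).trans
    (T.dpr_mono (fun _ _ => norm_nonneg _) fun _ k => hw k)) (norm_nonneg _) (by positivity)

theorem summable_weight (hv : Summable fun k => ‖v k‖) {y : Tree ℤ false → ℂ}
    (hy : ∀ T, T.order = n → ‖y T‖ ≤ (n.factorial : ℝ)) :
    Summable (planar n k fun T => T.weight v * y T) :=
  summable_planar (by positivity) (fun _ => norm_nonneg _) hv.hasSum
    fun _ hT => norm_weight_mul_le hy hT

theorem summable_dweight (hv : Summable fun k => ‖v k‖) {w : ℤ → ℂ}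
    (hw : ∀ k, ‖w k‖ ≤ cubicAbs v k) {y : Tree ℤ false → ℂ}
    (hy : ∀ T, T.order = n → ‖y T‖ ≤ (n.factorial : ℝ)) :
    Summable (planar n k fun T => T.dweight v w * y T) := by
  refine summable_planar (c := fun k => ‖v k‖ + cubicAbs v k) (C := n.factorial) (by positivity)
    (fun k => add_nonneg (norm_nonneg _) (cubicAbs_nonneg v k))
    (hv.hasSum.add (hasSum_cubicAbs hv.hasSum)) fun T hT => ?_
  refine (norm_dweight_mul_le hw hy hT).trans (mul_le_mul_of_nonneg_left ?_ (by positivity))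
  have := T.dpr_le_pr_add (a := fun _ k => ‖v k‖) (b := fun _ => cubicAbs v)
    (fun _ _ => norm_nonneg _) fun _ => cubicAbs_nonneg v
  have := T.pr_nonneg (a := fun _ k => ‖v k‖) fun _ _ => norm_nonneg _
  linarith

theorem norm_psi_le_factorial (hN : 0 ≤ N) (t : ℝ) (T : Tree ℤ false) (hT : T.order = n) :
    ‖T.psi N t‖ ≤ (n.factorial : ℝ) := hT ▸ T.norm_psi_le hN t

theorem norm_headPsi_nonRes_le (hN : 0 ≤ N) (t : ℝ) (T : Tree ℤ false) (hT : T.order = n) :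
    ‖Complex.I * T.headPsi Letter.NonRes N t‖ ≤ (n.factorial : ℝ) := by
  rw [norm_mul, Complex.norm_I, one_mul]
  by_cases h : T.numRes = 0
  · rw [Tree.headPsi_nonRes h]
    exact hT ▸ T.norm_oscPsiHat_le hN t
  · rw [Tree.headPsi_nonRes_eq_zero h, norm_zero]
    positivity

theorem norm_headPsi_res_le (hN : 0 ≤ N) (t : ℝ) (T : Tree ℤ false) (hT : T.order = n) :
    ‖Complex.I * T.headPsi (fun a => ¬ a.NonRes) N t‖ ≤ (n.factorial : ℝ) := by
  rw [norm_mul, Complex.norm_I, one_mul]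
  by_cases h : T.numRes = 1 ∧ T.numResTerminal = 1
  · rw [Tree.headPsi_res h.1]
    exact hT ▸ T.norm_oscPsiHat_le hN t
  · rw [Tree.headPsi_res_eq_zero h, norm_zero]
    positivity

theorem norm_nodeOsc_psi_le (hN : 0 ≤ N) (t : ℝ) (T : Tree ℤ false) (hT : T.order = n) :
    ‖Complex.I * (T.nodeOsc : ℂ) * T.psi N t‖ ≤ (n.factorial : ℝ) := by
  rw [mul_assoc, norm_mul, Complex.norm_I, one_mul]
  exact hT ▸ T.norm_nodeOsc_mul_psi_le hN t

theorem Tree.Iso.headPsi_nonRes_eq {t : ℝ} {p : Bool} {T U : Tree ℤ p} (h : Tree.Iso T U) :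
    T.headPsi Letter.NonRes N t = U.headPsi Letter.NonRes N t := by
  by_cases h0 : T.numRes = 0
  · rw [Tree.headPsi_nonRes h0, Tree.headPsi_nonRes (h.numRes_eq ▸ h0), h.oscPsiHat_eq]
  · rw [Tree.headPsi_nonRes_eq_zero h0, Tree.headPsi_nonRes_eq_zero (h.numRes_eq ▸ h0)]

theorem Tree.Iso.headPsi_res_eq {t : ℝ} {p : Bool} {T U : Tree ℤ p} (h : Tree.Iso T U) :
    T.headPsi (fun a => ¬ a.NonRes) N t = U.headPsi (fun a => ¬ a.NonRes) N t := by
  by_cases h0 : T.numRes = 1 ∧ T.numResTerminal = 1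
  · rw [Tree.headPsi_res h0.1, Tree.headPsi_res (h.numRes_eq ▸ h0.1), h.oscPsiHat_eq]
  · rw [Tree.headPsi_res_eq_zero h0, Tree.headPsi_res_eq_zero]
    rwa [← h.numRes_eq, ← h.numResTerminal_eq]

theorem mem_hatT (T : HatTree ℤ false) : T ∈ hatT false n k ↔
    T.IsRep ∧ T.order = n ∧ T.freq = k ∧ T.toTree.numRes = 0 := Iff.rfl

theorem calN0_eq (hN : 0 ≤ N) (hn : 1 ≤ n) (t : ℝ) (hv : Summable fun k => ‖v k‖) :
    Summable (fun T : hatT false n k => termN0 N t v T) ∧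
      calN0 N n t v k = ∑' T, planar n k (fun T => T.weight v * T.psi N t) T := by
  refine tsum_hatTree hn (summable_weight hv (norm_psi_le_factorial hN t)) (fun T U h => ?_)
    (P := fun T => T.numRes = 0) mem_hatT (fun T _ h => ?_) fun T hT _ => ?_
  · rw [h.weight_eq, h.psi_eq]
  · rw [Tree.psi_eq_zero_of_numRes h, mul_zero]
  · rw [termN0, HatTree.coef_mul_ups hT, HatTree.psi_eq]
    ring

theorem calN2_eq (hN : 0 ≤ N) (hn : 1 ≤ n) (t : ℝ) (hv : Summable fun k => ‖v k‖) :
    Summable (fun T : hatT false n k => termN2 N t v T) ∧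
      calN2 N n t v k = ∑' T, planar n k
        (fun T => T.weight v * (Complex.I * (T.nodeOsc : ℂ) * T.psi N t)) T := by
  refine tsum_hatTree hn (summable_weight hv (norm_nodeOsc_psi_le hN t)) (fun T U h => ?_)
    (P := fun T => T.numRes = 0) mem_hatT (fun T _ h => ?_) fun T hT _ => ?_
  · rw [h.weight_eq, h.psi_eq, h.nodeOsc_eq]
  · rw [Tree.psi_eq_zero_of_numRes h, mul_zero, mul_zero]
  · rw [termN2, HatTree.coef_mul_ups hT, HatTree.psi_eq, HatTree.osc_eq_nodeOsc]
    ring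

/-- `headPsi` replaces `oscPsiHat`, which does not test its first letter and may survive on resonant
trees. With `headPsi` the sum extends to all planar trees, the form required for grafting. -/
theorem calN_eq (hN : 0 ≤ N) (hn : 1 ≤ n) (t : ℝ) (hv : Summable fun k => ‖v k‖) :
    Summable (fun T : hatT false n k => termN N t v T) ∧
      calN N n t v k = ∑' T, planar n k
        (fun T => T.weight v * (Complex.I * T.headPsi Letter.NonRes N t)) T := by
  refine tsum_hatTree hn (summable_weight hv (norm_headPsi_nonRes_le hN t)) (fun T U h => ?_)
    (P := fun T => T.numRes = 0) mem_hatT (fun T _ h => ?_) fun T hT h => ?_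
  · rw [h.weight_eq, h.headPsi_nonRes_eq]
  · rw [Tree.headPsi_nonRes_eq_zero h, mul_zero, mul_zero]
  · rw [termN, HatTree.coef_mul_ups hT, HatTree.oscPsiHat_eq, Tree.headPsi_nonRes h]
    ring

theorem calR_eq (hN : 0 ≤ N) (hn : 1 ≤ n) (t : ℝ) (hv : Summable fun k => ‖v k‖) :
    Summable (fun T : hatTres false n k => termN N t v T) ∧
      calR N n t v k = ∑' T, planar n k
        (fun T => T.weight v * (Complex.I * T.headPsi (fun a => ¬ a.NonRes) N t)) T := by
  refine tsum_hatTree hn (summable_weight hv (norm_headPsi_res_le hN t)) (fun T U h => ?_)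
    (P := fun T => T.numRes = 1 ∧ T.numResTerminal = 1) (fun T => Iff.rfl) (fun T _ h => ?_)
    fun T hT h => ?_
  · rw [h.weight_eq, h.headPsi_res_eq]
  · rw [Tree.headPsi_res_eq_zero h, mul_zero, mul_zero]
  · rw [termN, HatTree.coef_mul_ups hT, HatTree.oscPsiHat_eq, Tree.headPsi_res h.1]
    ring

theorem calDN0_eq (hN : 0 ≤ N) (hn : 1 ≤ n) (t : ℝ) (hv : Summable fun k => ‖v k‖) {w : ℤ → ℂ}
    (hw : ∀ k, ‖w k‖ ≤ cubicAbs v k) :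
    Summable (fun T : hatT false n k => termDN0 N t v w T) ∧
      calDN0 N n t v w k = ∑' T, planar n k (fun T => T.dweight v w * T.psi N t) T := by
  refine tsum_hatTree hn (summable_dweight hv hw (norm_psi_le_factorial hN t)) (fun T U h => ?_)
    (P := fun T => T.numRes = 0) mem_hatT (fun T _ h => ?_) fun T hT _ => ?_
  · rw [h.dweight_eq, h.psi_eq]
  · rw [Tree.psi_eq_zero_of_numRes h, mul_zero]
  · rw [termDN0, HatTree.coef_mul_dups hT, HatTree.psi_eq]
    ring

/-- Inside the cutoff `Ψ` vanishes and the whole term goes to `𝒩_1`; outside it `𝓕Ψ̂ = 𝓕Ψ`. -/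
theorem termN_eq_add (hN : 0 ≤ N) (hn : 1 ≤ n) (t : ℝ) (v : ℤ → ℂ) (T : hatT false n k) :
    termN N t v T = termN1 N t v T + termN2 N t v T := by
  have ho : T.1.toTree.order ≠ 0 := by
    have : T.1.toTree.order = n := T.2.2.1
    omega
  rw [termN1, termN2, HatTree.psi_eq, HatTree.osc_eq_nodeOsc]
  split_ifs with h
  · rw [Tree.psi_eq_zero_of_le ho h]
    ring
  · rw [termN, HatTree.oscPsiHat_eq,
      Tree.oscPsiHat_eq_of_lt hN ho T.2.2.2.2 (not_le.1 h)]
    ring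

/-! ### Trees with one inner node: the equation itself. -/

theorem tripleTree_injective (p : Bool) : Function.Injective fun b => tripleTree b p := by
  intro b b' h
  have h1 := (Tree.tripleVal_eq_some (tripleTree b' p) b').2 rfl
  have h2 := (Tree.tripleVal_eq_some (tripleTree b' p) b).2 h
  rw [h1] at h2
  exact (Option.some.inj h2).symm

theorem exists_tripleTree {p : Bool} {T : Tree ℤ p} (h : T.order = 1) :
    ∃ b, tripleTree b p = T := by
  cases T with
  | leaf => simp [Tree.order] at h
  | node p T₁ T₂ T₃ =>
    simp only [Tree.order] at h
    obtain ⟨a₁, rfl⟩ := Tree.eq_leaf_of_order_eq_zero (T := T₁) (by omega)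
    obtain ⟨a₂, rfl⟩ := Tree.eq_leaf_of_order_eq_zero (T := T₂) (by omega)
    obtain ⟨a₃, rfl⟩ := Tree.eq_leaf_of_order_eq_zero (T := T₃) (by omega)
    exact ⟨(a₁, a₂, a₃), rfl⟩

/-- Cutting the only node leaves a leaf, for which `Ψ = 1`. No cutoff acts at this order, so the
result does not depend on `N`. -/
theorem tsum_planar_one (χ : Letter → Prop) (N t : ℝ) (v : ℤ → ℂ) (k : ℤ) :
    ∑' T, planar 1 k (fun T => T.weight v * (Complex.I * T.headPsi χ N t)) T = cubic χ t v k := by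
  classical
  rw [← (tripleTree_injective false).tsum_eq]
  · refine Eq.trans ?_ (tsum_subtype {b | tripleFreq b = k} (cubicTerm χ t v false)).symm
    refine tsum_congr fun b => ?_
    rw [planar, Set.indicator_apply]
    have h1 : (tripleTree b false).order = 1 := rfl
    have h2 : (tripleTree b false).freq = tripleFreq b := rfl
    rw [h1, h2]
    simp only [true_and, Set.mem_ofPred_eq]
    refine if_congr Iff.rfl ?_ rfl
    have h3 : (tripleTree b false).tripleMarks = {(Ctx.hole false, b)} := by
      simp [tripleTree, Tree.tripleMarks, Tree.marks, Tree.tripleVal, Tree.leafVal]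
    rw [Tree.headPsi, h3, Multiset.map_singleton, Multiset.sum_singleton, cubicTerm]
    have h4 : (cut (Ctx.hole false, b)).psi N t = 1 := by
      simp [cut, fillLeaf, Ctx.fill, Tree.psi, Tree.words, psiOsc]
    have h5 : markLetter (Ctx.hole false, b) = ⟨false, b.1, b.2.1, b.2.2⟩ := rfl
    rw [h4, h5]
    split_ifs
    · simp [Tree.weight, tripleTree, Tree.conjOrder, Tree.pr, sgn]
      ring
    · simp
  · intro T hT
    by_contra h
    refine hT ?_
    rw [planar, if_neg]
    rintro ⟨h1, -⟩
    exact h (exists_tripleTree h1)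

theorem calN_one (hN : 0 ≤ N) (t : ℝ) (hv : Summable fun k => ‖v k‖) :
    calN N 1 t v = cubic Letter.NonRes t v := by
  ext k
  rw [(calN_eq hN le_rfl t hv).2, tsum_planar_one]

theorem calR_one (hN : 0 ≤ N) (t : ℝ) (hv : Summable fun k => ‖v k‖) :
    calR N 1 t v = cubic (fun a => ¬ a.NonRes) t v := by
  ext k
  rw [(calR_eq hN le_rfl t hv).2, tsum_planar_one]

theorem nonRes_flip (b : ℤ × ℤ × ℤ) : Letter.NonRes ⟨true, b.1, b.2.1, b.2.2⟩ ↔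
    Letter.NonRes ⟨false, b.1, b.2.1, b.2.2⟩ := by
  rw [Letter.NonRes, Letter.NonRes, Letter.osc_flip, Ne, neg_eq_zero]

theorem calN_succ (hN : 0 ≤ N) (hn : 1 ≤ n) (t : ℝ) (hv : Summable fun k => ‖v k‖) :
    calN N (n + 1) t v k = -calDN0 N n t v (calN N 1 t v) k := by
  rw [(calN_eq hN (by omega) t hv).2, tsum_planar_graft hN t hv nonRes_flip, calN_one hN t hv,
    (calDN0_eq hN hn t hv (norm_cubic_le _ t hv)).2]

theorem calR_succ (hN : 0 ≤ N) (hn : 1 ≤ n) (t : ℝ) (hv : Summable fun k => ‖v k‖) :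
    calR N (n + 1) t v k = -calDN0 N n t v (calR N 1 t v) k := by
  rw [(calR_eq hN (by omega) t hv).2,
    tsum_planar_graft hN t hv fun b => not_congr (nonRes_flip b), calR_one hN t hv,
    (calDN0_eq hN hn t hv (norm_cubic_le _ t hv)).2]

end terms

/-! ## Differentiation in time -/

section time

variable {N : ℝ} {n : ℕ} {k : ℤ} {J : Set ℝ} {u : ℝ → C(Torus, ℂ)}

theorem summable_twisted (hu : IsNLSSolution J u) {t : ℝ} (ht : t ∈ J) :
    Summable fun k => ‖twisted u t k‖ := by
  simpa only [norm_twisted] using hu.summable t ht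

theorem continuousAt_tsum_norm_twisted (hJ : IsOpen J) (hu : IsNLSSolution J u) {t : ℝ}
    (ht : t ∈ J) : ContinuousAt (fun s => ∑' k, ‖twisted u s k‖) t := by
  simp only [norm_twisted]
  rw [ContinuousAt, tendsto_iff_norm_sub_tendsto_zero]
  refine squeeze_zero' (Eventually.of_forall fun s => norm_nonneg _) ?_ (hu.continuous t ht)
  filter_upwards [hJ.mem_nhds ht] with s hs
  have h1 := hu.summable s hs
  have h2 := hu.summable t ht
  rw [← h1.tsum_sub h2]
  have h3 : Summable fun k => ‖fourierCoeff (u s) k - fourierCoeff (u t) k‖ :=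
    Summable.of_nonneg_of_le (fun _ => norm_nonneg _) (fun k => norm_sub_le _ _) (h1.add h2)
  refine tsum_of_norm_bounded h3.hasSum fun k => ?_
  exact abs_norm_sub_norm_le _ _

theorem continuousAt_twisted (hu : IsNLSSolution J u) {t : ℝ} (ht : t ∈ J) (k : ℤ) :
    ContinuousAt (fun s => ‖twisted u s k‖) t :=
  (hasDerivAt_twisted hu ht k).continuousAt.norm

theorem continuousAt_cubicAbs (hJ : IsOpen J) (hu : IsNLSSolution J u) {t : ℝ} (ht : t ∈ J)
    (k : ℤ) : ContinuousAt (fun s => cubicAbs (twisted u s) k) t := by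
  have hc : ∀ b : ℤ × ℤ × ℤ, ContinuousAt (fun s => ‖twisted u s b.1‖
      * (‖twisted u s b.2.1‖ * ‖twisted u s b.2.2‖)) t := fun b =>
    (continuousAt_twisted hu ht _).mul
      ((continuousAt_twisted hu ht _).mul (continuousAt_twisted hu ht _))
  have hA := continuousAt_tsum_norm_twisted hJ hu ht
  -- The majorant is the same series without the frequency constraint; its sum is the cube of the
  -- `ℓ¹` norm, which is continuous in time.
  have h := continuousAt_tsum_of_dominated (t := t)
    (f := fun (b : ℤ × ℤ × ℤ) s => {b | tripleFreq b = k}.indicator (fun b => ‖twisted u s b.1‖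
      * (‖twisted u s b.2.1‖ * ‖twisted u s b.2.2‖)) b)
    (a := fun b s => ‖twisted u s b.1‖ * (‖twisted u s b.2.1‖ * ‖twisted u s b.2.2‖))
    (A := fun s => (∑' k, ‖twisted u s k‖) * ((∑' k, ‖twisted u s k‖) * (∑' k, ‖twisted u s k‖)))
    (Eventually.of_forall fun s b => ?_) ?_ hc (hA.mul (hA.mul hA)) fun b => ?_
  · refine h.congr (Eventually.of_forall fun s => ?_)
    exact (tsum_subtype {b | tripleFreq b = k} fun b => ‖twisted u s b.1‖
      * (‖twisted u s b.2.1‖ * ‖twisted u s b.2.2‖)).symm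
  · refine (norm_indicator_le_norm_self _ _).trans (le_of_eq ?_)
    exact Real.norm_of_nonneg (by positivity)
  · filter_upwards [hJ.mem_nhds ht] with s hs
    exact hasSum_triple (summable_twisted hu hs).hasSum
  · by_cases hb : tripleFreq b = k
    · simpa [Set.indicator_apply, hb] using hc b
    · simpa [Set.indicator_apply, hb] using continuousAt_const

theorem Tree.continuousAt_pr {a : ℝ → Bool → ℤ → ℝ} {t : ℝ}
    (h : ∀ q k, ContinuousAt (fun s => a s q k) t) {p : Bool} (T : Tree ℤ p) :
    ContinuousAt (fun s => T.pr (a s)) t := by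
  induction T with
  | leaf p k => exact h p k
  | node p T₁ T₂ T₃ h₁ h₂ h₃ => exact (h₁.mul h₂).mul h₃

theorem hasDerivAt_vcoef {v : ℝ → ℤ → ℂ} {w : ℤ → ℂ} {t : ℝ}
    (h : ∀ k, HasDerivAt (fun s => v s k) (w k) t) (q : Bool) (k : ℤ) :
    HasDerivAt (fun s => vcoef (v s) q k) (vcoef w q k) t := by
  cases q with
  | false => simpa [vcoef] using h k
  | true => simpa [vcoef] using (h k).star

theorem hasDerivAt_calN0 (hN : 0 ≤ N) (hn : 1 ≤ n) (hJ : IsOpen J) (hu : IsNLSSolution J u)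
    {t : ℝ} (ht : t ∈ J) :
    HasDerivAt (fun s => calN0 N n s (twisted u s) k)
      (∑' T, planar n k (fun T => T.dweight (twisted u t)
          (cubic (fun _ => True) t (twisted u t)) * T.psi N t
        + T.weight (twisted u t) * (Complex.I * (T.nodeOsc : ℂ) * T.psi N t)) T) t := by
  -- Products of `‖v‖ + cubicAbs v` over the leaves dominate both parts of the derivative at once.
  -- If `A` is the `ℓ¹` norm, this sequence has sum `A + A³`, so the majorant has the continuous sum
  -- `n! · #shapes · (A + A³) ^ (2n + 1)`.
  set c : ℝ → Bool → ℤ → ℝ := fun s _ k => ‖twisted u s k‖ + cubicAbs (twisted u s) k with hc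
  have hc0 : ∀ s q k, 0 ≤ c s q k := fun s q k =>
    add_nonneg (norm_nonneg _) (cubicAbs_nonneg _ k)
  have hJt := hJ.mem_nhds ht
  have hA := continuousAt_tsum_norm_twisted hJ hu ht
  have key := hasDerivAt_tsum_of_dominated (t := t)
    (f := fun T s => planar n k (fun T => T.weight (twisted u s) * T.psi N s) T)
    (f' := fun T s => planar n k (fun T => T.dweight (twisted u s)
          (cubic (fun _ => True) s (twisted u s)) * T.psi N s
        + T.weight (twisted u s) * (Complex.I * (T.nodeOsc : ℂ) * T.psi N s)) T)
    (a := fun T s => (n.factorial : ℝ) * (if T.order = n then T.pr (c s) else 0))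
    (A := fun s => (n.factorial : ℝ) * ((shapes false n).card * ((∑' k, ‖twisted u s k‖)
      + (∑' k, ‖twisted u s k‖) * ((∑' k, ‖twisted u s k‖)
        * (∑' k, ‖twisted u s k‖))) ^ (2 * n + 1)))
    ?_ ?_ ?_ ?_ ?_ ?_
  · refine key.congr_of_eventuallyEq ?_
    filter_upwards [hJt] with s hs
    exact (calN0_eq hN hn s (summable_twisted hu hs)).2
  · filter_upwards [hJt] with s hs T
    unfold planar
    split_ifs
    · have h1 := T.hasDerivAt_pr (hasDerivAt_vcoef (hasDerivAt_twisted hu hs))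
      have h2 := ((h1.const_mul ((-1 : ℂ) ^ T.conjOrder)).neg).mul (T.hasDerivAt_psi N s)
      exact h2
    · exact hasDerivAt_const s 0
  · filter_upwards [hJt] with s hs
    exact summable_weight (summable_twisted hu hs) (norm_psi_le_factorial hN s)
  · filter_upwards [hJt] with s hs T
    have hv := summable_twisted hu hs
    refine norm_planar_le (by positivity) (fun T => T.pr_nonneg (hc0 s)) (fun T hT => ?_) T
    refine (norm_add_le _ _).trans ?_
    have h1 := norm_dweight_mul_le (v := twisted u s) (norm_cubic_le (fun _ => True) s hv)
      (norm_psi_le_factorial hN s) hT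
    have h2 := norm_weight_mul_le (v := twisted u s) (norm_nodeOsc_psi_le hN s) hT
    have h3 := T.dpr_le_pr_add (a := fun _ k => ‖twisted u s k‖)
      (b := fun _ => cubicAbs (twisted u s)) (fun _ _ => norm_nonneg _)
      fun _ => cubicAbs_nonneg _
    have h4 := mul_le_mul_of_nonneg_left h3 (by positivity : (0 : ℝ) ≤ n.factorial)
    rw [mul_add] at h4
    linarith
  · filter_upwards [hJt] with s hs
    have hv := (summable_twisted hu hs).hasSum
    exact (hasSum_pr (hc0 s) (fun _ => hv.add (hasSum_cubicAbs hv)) false n).mul_left _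
  · intro T
    refine continuousAt_const.mul ?_
    split_ifs
    · exact T.continuousAt_pr fun q k =>
        (continuousAt_twisted hu ht k).add (continuousAt_cubicAbs hJ hu ht k)
    · exact continuousAt_const
  · exact continuousAt_const.mul (continuousAt_const.mul ((hA.add (hA.mul (hA.mul hA))).pow _))

theorem Tree.dweight_add (v w w' : ℤ → ℂ) {p : Bool} (T : Tree ℤ p) :
    T.dweight v (fun k => w k + w' k) = T.dweight v w + T.dweight v w' := by
  have : vcoef (fun k => w k + w' k) = fun q k => vcoef w q k + vcoef w' q k := by
    ext q k
    cases q <;> simp [vcoef]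
  rw [Tree.dweight, this, Tree.dpr_add, Tree.dweight, Tree.dweight]
  ring

theorem planar_add (n : ℕ) (k : ℤ) (x y : Tree ℤ false → ℂ) (T : Tree ℤ false) :
    planar n k (fun T => x T + y T) T = planar n k x T + planar n k y T := by
  unfold planar
  split_ifs <;> simp

theorem hasDerivAt_calN0_twisted (hN : 0 ≤ N) (hn : 1 ≤ n) (hJ : IsOpen J) (hu : IsNLSSolution J u)
    {t : ℝ} (ht : t ∈ J) :
    HasDerivAt (fun s => calN0 N n s (twisted u s) k)
      (calDN0 N n t (twisted u t) (calN N 1 t (twisted u t)) k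
        + calDN0 N n t (twisted u t) (calR N 1 t (twisted u t)) k
        + calN2 N n t (twisted u t) k) t := by
  refine (hasDerivAt_calN0 hN hn hJ hu ht).congr_deriv ?_
  have hv := summable_twisted hu ht
  have h0 : cubic (fun _ => True) t (twisted u t) = fun k =>
      cubic Letter.NonRes t (twisted u t) k + cubic (fun a => ¬ a.NonRes) t (twisted u t) k :=
    funext fun k => cubic_add_cubic_not Letter.NonRes t hv k
  have s1 := summable_dweight (k := k) hv (norm_cubic_le Letter.NonRes t hv)
    (norm_psi_le_factorial (n := n) hN t)
  have s2 := summable_dweight (k := k) hv (norm_cubic_le (fun a => ¬ a.NonRes) t hv)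
    (norm_psi_le_factorial (n := n) hN t)
  have s3 := summable_weight (k := k) hv (norm_nodeOsc_psi_le (n := n) hN t)
  rw [calN_one hN t hv, calR_one hN t hv, (calDN0_eq hN hn t hv (norm_cubic_le _ t hv)).2,
    (calDN0_eq hN hn t hv (norm_cubic_le _ t hv)).2, (calN2_eq hN hn t hv).2,
    ← s1.tsum_add s2, ← (s1.add s2).tsum_add s3]
  refine tsum_congr fun T => ?_
  rw [← planar_add, ← planar_add]
  unfold planar
  split_ifs
  · rw [h0]
    beta_reduce
    rw [Tree.dweight_add]
    ring
  · rfl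

end time

end NormalForm
-- The normal form identities.
open NormalForm in
theorem mainTheorem1 (N : ℝ) (hN : 0 ≤ N) (J : Set ℝ) (hJ : IsOpen J)
    (u : ℝ → C(Torus, ℂ)) (hu : IsNLSSolution J u) :
    (∀ k : ℤ, ∀ t ∈ J, HasDerivAt (fun s => twisted u s k)
      (calN N 1 t (twisted u t) k + calR N 1 t (twisted u t) k) t) ∧
    ∀ n : ℕ, 1 ≤ n → ∀ k : ℤ,
      (∀ T : HatTree ℤ false, T ∈ hatT false n k ∪ hatTres false n k → T.osc ≠ 0 →
        ∀ t : ℝ, T.oscPsiHat N t = (T.osc : ℂ) * T.psiHat N t) ∧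
      ∀ t ∈ J,
        (Summable (fun T : hatT false n k => termN0 N t (twisted u t) T) ∧
          Summable (fun T : hatT false n k => termN N t (twisted u t) T) ∧
          Summable (fun T : hatT false n k => termN1 N t (twisted u t) T) ∧
          Summable (fun T : hatT false n k => termN2 N t (twisted u t) T) ∧
          Summable (fun T : hatTres false n k => termN N t (twisted u t) T) ∧
          Summable (fun T : hatT false n k =>
            termDN0 N t (twisted u t) (calN N 1 t (twisted u t)) T) ∧
          Summable (fun T : hatT false n k =>
            termDN0 N t (twisted u t) (calR N 1 t (twisted u t)) T)) ∧
        calN N n t (twisted u t) k =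
          calN1 N n t (twisted u t) k + calN2 N n t (twisted u t) k ∧
        calN N (n + 1) t (twisted u t) k =
          -calDN0 N n t (twisted u t) (calN N 1 t (twisted u t)) k ∧
        calR N (n + 1) t (twisted u t) k =
          -calDN0 N n t (twisted u t) (calR N 1 t (twisted u t)) k ∧
        DifferentiableAt ℝ (fun s => calN0 N n s (twisted u s) k) t ∧
        calN2 N n t (twisted u t) k =
          deriv (fun s => calN0 N n s (twisted u s) k) t
            + calN N (n + 1) t (twisted u t) k + calR N (n + 1) t (twisted u t) k := by
  refine ⟨fun k t ht => ?_, fun n hn k => ⟨fun T _ hT t =>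
    T.oscPsiHat_eq_osc_mul_psiHat N t hT, fun t ht => ?_⟩⟩
  · have hv := summable_twisted hu ht
    rw [calN_one hN t hv, calR_one hN t hv, ← cubic_add_cubic_not Letter.NonRes t hv]
    exact hasDerivAt_twisted hu ht k
  · have hv := summable_twisted hu ht
    have sN := (calN_eq (k := k) hN hn t hv).1
    have sN2 := (calN2_eq (k := k) hN hn t hv).1
    have e1 : (fun T : hatT false n k => termN1 N t (twisted u t) T)
        = fun T : hatT false n k => termN N t (twisted u t) T - termN2 N t (twisted u t) T := by
      ext T
      rw [termN_eq_add hN hn]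
      ring
    have sN1 : Summable (fun T : hatT false n k => termN1 N t (twisted u t) T) := by
      rw [e1]
      exact sN.sub sN2
    have hd := hasDerivAt_calN0_twisted (k := k) hN hn hJ hu ht
    refine ⟨⟨(calN0_eq hN hn t hv).1, sN, sN1, sN2, (calR_eq hN hn t hv).1, ?_, ?_⟩, ?_,
      calN_succ hN hn t hv, calR_succ hN hn t hv, hd.differentiableAt, ?_⟩
    · rw [calN_one hN t hv]
      exact (calDN0_eq hN hn t hv (norm_cubic_le _ t hv)).1
    · rw [calR_one hN t hv]
      exact (calDN0_eq hN hn t hv (norm_cubic_le _ t hv)).1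
    · rw [calN, calN1, calN2, ← sN1.tsum_add sN2]
      exact tsum_congr fun T => termN_eq_add hN hn t _ T
    -- The derivative contains the two leaf contributions with a plus sign; they are `-𝒩^{(n+1)}`
    -- and `-ℛ^{(n+1)}`.
    · rw [hd.deriv, calN_succ hN hn t hv, calR_succ hN hn t hv]
      ring
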